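/- **Dual reformulation of a distributionally robust optimization (DRO) problem.** *Setting.* Let $[n]=\{1,\dots,n\}$. For a proper, convex, lower semicontinuous function $h$ on a Euclidean space, $h^*(y)=\sup_x\langle y,x\rangle-h(x)$ is its conjugate, and its perspective, written $\lambda h(x/\lambda)$, is understood literally for $\lambda>0$ and as $\sup_{y\in\mathrm{dom}(h^*)}\langle y,x\rangle$ for $\lambda=0$. A Slater point of $\{x: h_k(x)\le 0\ \forall k\}$ is an element $x^s$ of this set with $x^s\in\mathrm{ri}(\mathrm{dom}(h_k))$ for all $k$ and $h_k(x^s)<0$ for all $k$ for which $h_k$ is not affine. The data are as follows. 1. $\mathcal Z=\{z\in\mathbb R^d: f_k(z)\le 0\ \forall k\in[K]\}$ and $\Theta=\{\theta\in\mathbb R^m: g_l(\theta)\le 0\ \forall l\in[L]\}$, where all $f_k$ and $g_l$ are proper, convex and lower semicontinuous with values in $(-\infty,\infty]$. 2. $\ell(\theta,z)=\max_{i\in[I]}\ell_i(\theta,z)$ with $I\ge 1$ and $\ell_i:\mathbb R^m\times\mathbb R^d\to\mathbb R$ convex in $\theta$ and concave in $z$. 3. The cost $c(z,\hat z)\in[0,\infty]$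 is lower semicontinuous in $(z,\hat z)$ and convex in $z$, and for $z,\hat z\in\mathcal Z$ we have $c(z,\hat z)=0$ if and only if $z=\hat z$. 4. $\hat{\mathbb P}=\sum_{j\in[J]}p_j\delta_{\hat z_j}$ with $p_j>0$, $\sum_jp_j=1$, $\hat z_j\in\mathcal Z$. 5. $\varepsilon>0$, and $\mathbb B$ is the set of all probability distributions $\mathbb Q$ supported on $\mathcal Z$ with $d_c(\mathbb Q,\hat{\mathbb P})\le\varepsilon$, where $d_c(\mathbb Q,\hat{\mathbb P})=\inf_\pi\mathbb E_{(Z,\hat Z)\sim\pi}[c(Z,\hat Z)]$ over all couplings $\pi$ of $\mathbb Q$ and $\hat{\mathbb P}$. *Assumptions.* (a) For all $\mathbb Q\in\mathbb B$ and $\bar\theta\in\Theta$ there is a neighborhood $U$ of $\bar\theta$ in $\Theta$ such that the functions $-\min\{0,\ell(\theta,\cdot)\}$, $\theta\in U$, are uniformly $\mathbb Q$-integrable. (b) There is $\theta\in\Theta$ with $\sup_{\mathbb Q\in\mathbb B}\mathbb E_{Z\sim\mathbb Q}[\ell(\theta,Z)]<\infty$. (c) Every $\hat z_j$ lies in $\mathrm{ri}(\mathrm{dom}(c(\cdot,\hat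 z_j)))$ and is a Slater point of $\mathcal Z$, and $\Theta$ has a Slater point. (d) At least one of the following holds: for some $\mathbb Q\in\mathbb B$ all sublevel sets $\{\theta\in\Theta:\mathbb E_{Z\sim\mathbb Q}[\ell(\theta,Z)]\le a\}$, $a\in\mathbb R$, are compact; or $\mathcal Z$ is compact; or, for every $\hat z\in\mathcal Z$, $c(z,\hat z)/\|z\|\to\infty$ as $\|z\|\to\infty$, $z\in\mathcal Z$. *Conclusion.* Let $$V=\sup_{\mathbb Q\in\mathbb B}\ \inf_{\theta\in\Theta}\ \mathbb E_{Z\sim\mathbb Q}[\ell(\theta,Z)]\in[-\infty,\infty)$$ and consider the finite program $$\begin{array}{cll}\max & -\sum_{i,j}q_{ij}\,\ell_i^{*1}(\alpha_{ij}/q_{ij},\hat z_j+\xi_{ij}/q_{ij})-\sum_l\nu_l\,g_l^*(\beta_l/\nu_l)\\ \text{s.t.}& q_{ij},\nu_l\in\mathbb R_+,\ \xi_{ij}\in\mathbb R^d,\ \alpha_{ij},\beta_l\in\mathbb R^m & \forall i,j,l\\ & q_{ij}f_k(\hat z_j+\xi_{ij}/q_{ij})\le 0 & \forall i,j,k\\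 & \sum_i q_{ij}=p_j & \forall j\\ & \sum_{i,j}\alpha_{ij}+\sum_l\beta_l=0\\ & \sum_{i,j}q_{ij}\,c(\hat z_j+\xi_{ij}/q_{ij},\hat z_j)\le\varepsilon,\end{array}\tag{D}$$ where $\ell_i^{*1}(\alpha,z)=\sup_\theta\langle\alpha,\theta\rangle-\ell_i(\theta,z)$, and where the terms with $q_{ij}$ are the perspectives of $(\alpha,\xi)\mapsto\ell_i^{*1}(\alpha,\hat z_j+\xi)$, $\xi\mapsto f_k(\hat z_j+\xi)$ and $\xi\mapsto c(\hat z_j+\xi,\hat z_j)$. Then: * (D) is a convex program (its feasible set is convex and its extended-real-valued objective function is concave on it), its supremum equals $V$, and it is solvable (it has a maximizer). * Let $(q^\star,\xi^\star,\alpha^\star,\beta^\star,\nu^\star)$ be any maximizer of (D), and put $\mathcal I_j^+=\{i:q^\star_{ij}>0\}$ and $\mathcal I_j^\infty=\{i:q_{ij}^\star=0,\ \xi_{ij}^\star\ne 0\}$. If $\mathcal I_j^\infty=\emptyset$ for all $j$, then $\mathbb Q^\star=\sum_j\sum_{i\in\mathcal I_j^+}q^\star_{ij}\,\delta_{\hat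 z_j+\xi^\star_{ij}/q^\star_{ij}}$ belongs to $\mathbb B$ and attains the supremum $V$. * If $\mathcal I_j^\infty\neq\emptyset$ for some $j$, then the discrete distributions $$\mathbb Q(n)=\sum_j\Big(\sum_{i\in\mathcal I_j^+}q_{ij}^\star\big(1-|\mathcal I_j^\infty|/n\big)\,\delta_{\hat z_j+\xi_{ij}^\star/q_{ij}^\star}+\sum_{i\in\mathcal I_j^\infty}\frac{p_j}{n}\,\delta_{\hat z_j+n\xi_{ij}^\star/p_j}\Big)$$ belong to $\mathbb B$ for all $n>\max_j|\mathcal I_j^\infty|$, and they are asymptotically optimal in the sense that $\lim_{n\to\infty}\mathbb E_{Z\sim\mathbb Q(n)}[\ell(\theta,Z)]$ exists in $[-\infty,\infty]$ for every $\theta\in\Theta$ and $$\inf_{\theta\in\Theta}\ \lim_{n\to\infty}\mathbb E_{Z\sim\mathbb Q(n)}[\ell(\theta,Z)]=V.$$ * In all cases there are finitely supported distributions $\mathbb Q_n\in\mathbb B$, $n\in\mathbb N$, with $\lim_{n\to\infty}\inf_{\theta\in\Theta}\mathbb E_{Z\sim\mathbb Q_n}[\ell(\theta,Z)]=V$. 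-/

import Mathlib

open MeasureTheory Set Filter Topology
open scoped ENNReal

noncomputable section

/-- The Euclidean space `ℝⁿ`. -/
abbrev Euc (n : ℕ) := EuclideanSpace ℝ (Fin n)

/-! ### Convex analysis of extended-real-valued functions -/

section ConvexAnalysis

variable {V : Type*} [NormedAddCommGroup V] [InnerProductSpace ℝ V]

/-- The (effective) domain of `h`. -/
def effDom (h : V → EReal) : Set V := {x | h x < ⊤}

/-- `h` is proper: it never takes the value `-∞` and is not identically `+∞`. -/
def IsProperFn (h : V → EReal) : Prop := (∀ x, ⊥ < h x) ∧ (effDom h).Nonempty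

/-- `h` is convex, that is, its epigraph is a convex set. -/
def IsConvexFn (h : V → EReal) : Prop := Convex ℝ {w : V × ℝ | h w.1 ≤ (w.2 : EReal)}

/-- `h` is proper, convex and lower semicontinuous. -/
def IsClosedConvexFn (h : V → EReal) : Prop :=
  IsProperFn h ∧ IsConvexFn h ∧ LowerSemicontinuous h

/-- `h` is a (finite) affine function; the "linear" constraint functions. -/
def IsAffineFn (h : V → EReal) : Prop :=
  ∃ (a : V) (b : ℝ), ∀ x, h x = ((inner ℝ a x + b : ℝ) : EReal)

/-- The convex conjugate `h*(y) = sup_x ⟨y, x⟩ - h(x)`. -/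
def conjugate (h : V → EReal) (y : V) : EReal :=
  ⨆ x : V, ((inner ℝ y x : ℝ) : EReal) - h x

/-- The support function `δ*_C(x) = sup_{y ∈ C} ⟨y, x⟩` of a set `C`. -/
def supportFn (C : Set V) (x : V) : EReal :=
  ⨆ y ∈ C, ((inner ℝ y x : ℝ) : EReal)

/-- The perspective function `λ h(x / λ)`: for `λ > 0` it is literally this expression, and for
`λ = 0` it is the support function of `dom (h*)` at `x`. -/
def perspective (h : V → EReal) (x : V) (lam : ℝ) : EReal :=
  if 0 < lam then (lam : EReal) * h (lam⁻¹ • x) else supportFn (effDom (conjugate h)) x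

/-- The set `{x | h_k(x) ≤ 0 for all k}`. -/
def constraintSet {M : ℕ} (h : Fin M → V → EReal) : Set V := {x | ∀ k, h k x ≤ 0}

/-- `x` is a Slater point of `{x | h_k(x) ≤ 0 for all k}`. -/
def IsSlaterPoint {M : ℕ} (h : Fin M → V → EReal) (x : V) : Prop :=
  x ∈ constraintSet h ∧ (∀ k, x ∈ intrinsicInterior ℝ (effDom (h k))) ∧
    ∀ k, ¬ IsAffineFn (h k) → h k x < 0

end ConvexAnalysis

/-! ### Optimal transport -/

/-- The couplings (transportation plans) of `P` and `P'`. -/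
def couplings {d : ℕ} (P P' : Measure (Euc d)) : Set (Measure (Euc d × Euc d)) :=
  {π | π.map Prod.fst = P ∧ π.map Prod.snd = P'}

/-- The optimal transport discrepancy `d_c(P, P')`. -/
def transportDiscrepancy {d : ℕ} (c : Euc d → Euc d → ℝ≥0∞) (P P' : Measure (Euc d)) : ℝ≥0∞ :=
  ⨅ π ∈ couplings P P', ∫⁻ w, c w.1 w.2 ∂π

/-- The expectation of `h` under `Q` as an extended real number, namely the integral of the
positive part minus the integral of the negative part. -/
def expectation {d : ℕ} (Q : Measure (Euc d)) (h : Euc d → ℝ) : EReal :=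
  ((∫⁻ z, ENNReal.ofReal (h z) ∂Q : ℝ≥0∞) : EReal) -
    ((∫⁻ z, ENNReal.ofReal (-h z) ∂Q : ℝ≥0∞) : EReal)

/-! ### The distributionally robust optimization problem -/

/-- The raw data of the problem: the saddle functions `ℓ_i`, the transportation cost `c`, the
constraint functions `f_k` of the support set and `g_l` of the feasible set, the probabilities
`p_j` and atoms `ẑ_j` of the reference distribution, and the radius `ε`. -/
structure DROData (m d I J K L : ℕ) where
  saddle : Fin I → Euc m → Euc d → ℝ
  cost : Euc d → Euc d → ℝ≥0∞
  f : Fin K → Euc d → EReal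
  g : Fin L → Euc m → EReal
  p : Fin J → ℝ
  zhat : Fin J → Euc d
  eps : ℝ

namespace DROData

variable {m d I J K L : ℕ} (D : DROData m d I J K L)

/-- The support set `Z`. -/
def suppSet : Set (Euc d) := constraintSet D.f

/-- The feasible set `Θ`. -/
def feasSet : Set (Euc m) := constraintSet D.g

/-- The loss function `ℓ(θ, z) = max_i ℓ_i(θ, z)`. -/
def loss (θ : Euc m) (z : Euc d) : ℝ := ⨆ i, D.saddle i θ z

/-- The reference distribution `∑_j p_j δ_{ẑ_j}`. -/
def refDist : Measure (Euc d) := ∑ j, ENNReal.ofReal (D.p j) • Measure.dirac (D.zhat j)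

/-- The ambiguity set of all probability distributions supported on `Z` within optimal transport
discrepancy `ε` of the reference distribution. -/
def ambiguitySet : Set (Measure (Euc d)) :=
  {Q | IsProbabilityMeasure Q ∧ Q (D.suppSet)ᶜ = 0 ∧
    transportDiscrepancy D.cost Q D.refDist ≤ ENNReal.ofReal D.eps}

/-- The expected loss of the decision `θ` under `Q`. -/
def expectedLoss (Q : Measure (Euc d)) (θ : Euc m) : EReal := expectation Q (D.loss θ)

/-- The objective function `inf_{θ ∈ Θ} E_Q[ℓ(θ, Z)]` of the dual DRO problem. -/
def dualObjective (Q : Measure (Euc d)) : EReal := ⨅ θ ∈ D.feasSet, D.expectedLoss Q θ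

/-- The optimal value `sup_Q inf_θ E_Q[ℓ(θ, Z)]` of the dual DRO problem. -/
def dualValue : EReal := ⨆ Q ∈ D.ambiguitySet, D.dualObjective Q

/-! ### Assumptions -/

/-- The transportation cost satisfies the identity of indiscernibles on the support set. -/
def IdentityOfIndiscernibles : Prop :=
  ∀ z ∈ D.suppSet, ∀ z' ∈ D.suppSet, (D.cost z z' = 0 ↔ z = z')

/-- Local uniform integrability of the negative part of the loss, under every distribution in
the ambiguity set. -/
def LocallyUniformlyIntegrable : Prop :=
  ∀ Q ∈ D.ambiguitySet, ∀ θ₀ ∈ D.feasSet, ∃ U ∈ 𝓝[D.feasSet] θ₀,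
    UniformIntegrable (fun (θ : U) (z : Euc d) => -min 0 (D.loss θ z)) 1 Q

/-- Some feasible decision has a worst-case expected loss below `+∞`. -/
def WorstCaseFinite : Prop :=
  ∃ θ ∈ D.feasSet, (⨆ Q ∈ D.ambiguitySet, D.expectedLoss Q θ) < ⊤

/-- The reference distribution is a probability distribution with finitely many atoms in `Z`,
all of positive weight. -/
structure DiscreteReference : Prop where
  p_pos : ∀ j, 0 < D.p j
  p_sum : ∑ j, D.p j = 1
  zhat_mem : ∀ j, D.zhat j ∈ D.suppSet

/-- Convexity conditions. The functions `ℓ_i` are finite on `ℝᵐ × ℝᵈ`, because `ℓ_i` and `-ℓ_i`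
are both proper; the semicontinuity of finite convex functions on `ℝⁿ` is automatic. -/
structure ConvexityConditions : Prop where
  cost_lsc : LowerSemicontinuous (fun w : Euc d × Euc d => D.cost w.1 w.2)
  cost_convex : ∀ z', IsConvexFn (fun z => (D.cost z z' : EReal))
  saddle_nonempty : 0 < I
  saddle_convex : ∀ i z, ConvexOn ℝ univ (fun θ => D.saddle i θ z)
  saddle_concave : ∀ i θ, ConcaveOn ℝ univ (fun z => D.saddle i θ z)
  f_closedConvex : ∀ k, IsClosedConvexFn (D.f k)
  g_closedConvex : ∀ l, IsClosedConvexFn (D.g l)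

/-- Slater conditions. -/
structure SlaterConditions : Prop where
  atoms : ∀ j, D.zhat j ∈ intrinsicInterior ℝ
      (effDom (fun z => (D.cost z (D.zhat j) : EReal))) ∧ IsSlaterPoint D.f (D.zhat j)
  feasSet : ∃ θ, IsSlaterPoint D.g θ

/-- For some distribution in the ambiguity set, the expected loss is inf-compact on `Θ`. -/
def InfCompact : Prop :=
  ∃ Q ∈ D.ambiguitySet, ∀ a : ℝ, IsCompact {θ | θ ∈ D.feasSet ∧ D.expectedLoss Q θ ≤ (a : EReal)}

/-- For every `ẑ ∈ Z`, the ratio `c(z, ẑ) / ‖z‖` tends to `∞` as `‖z‖ → ∞` with `z ∈ Z`. -/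
def SuperlinearCost : Prop :=
  ∀ z' ∈ D.suppSet, Tendsto (fun z => D.cost z z' / ENNReal.ofReal ‖z‖)
    (Bornology.cobounded (Euc d) ⊓ 𝓟 D.suppSet) (𝓝 ⊤)

/-- At least one of three regularity conditions holds. -/
def RegularityCondition : Prop :=
  D.InfCompact ∨ IsCompact D.suppSet ∨ D.SuperlinearCost

/-! ### The finite convex program -/

end DROData

/-- The decision variables `(q, ξ, α, β, ν)` of the finite program. -/
abbrev DualVar (m d I J L : ℕ) :=
  (Fin I → Fin J → ℝ) × (Fin I → Fin J → Euc d) × (Fin I → Fin J → Euc m) ×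
    (Fin L → Euc m) × (Fin L → ℝ)

namespace DualVar

variable {m d I J L : ℕ} (x : DualVar m d I J L)

/-- The variables `q_ij`. -/
def q (i : Fin I) (j : Fin J) : ℝ := x.1 i j

/-- The variables `ξ_ij`. -/
def xi (i : Fin I) (j : Fin J) : Euc d := x.2.1 i j

/-- The variables `α_ij`. -/
def alpha (i : Fin I) (j : Fin J) : Euc m := x.2.2.1 i j

/-- The variables `β_l`. -/
def beta (l : Fin L) : Euc m := x.2.2.2.1 l

/-- The variables `ν_l`. -/
def nu (l : Fin L) : ℝ := x.2.2.2.2 l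

end DualVar

namespace DROData

variable {m d I J K L : ℕ} (D : DROData m d I J K L)

/-- The partial conjugate `ℓ_i^{*1}(α, z)` of `ℓ_i(θ, z)` in `θ` for fixed `z`. -/
def saddleConj (i : Fin I) (α : Euc m) (z : Euc d) : EReal :=
  conjugate (fun θ : Euc m => (D.saddle i θ z : EReal)) α

/-- `q ℓ_i^{*1}(α / q, ẑ_j + ξ / q)`: the perspective of the function
`(α, ξ) ↦ ℓ_i^{*1}(α, ẑ_j + ξ)` on `ℝᵐ × ℝᵈ`. -/
def saddleTerm (i : Fin I) (j : Fin J) (q : ℝ) (α : Euc m) (ξ : Euc d) : EReal :=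
  perspective (fun w : WithLp 2 (Euc m × Euc d) => D.saddleConj i w.fst (D.zhat j + w.snd))
    (WithLp.toLp 2 (α, ξ)) q

/-- `q f_k(ẑ_j + ξ / q)`: the perspective of `ξ ↦ f_k(ẑ_j + ξ)`. -/
def supportTerm (k : Fin K) (j : Fin J) (q : ℝ) (ξ : Euc d) : EReal :=
  perspective (fun u : Euc d => D.f k (D.zhat j + u)) ξ q

/-- `q c(ẑ_j + ξ / q, ẑ_j)`: the perspective of `ξ ↦ c(ẑ_j + ξ, ẑ_j)`. -/
def costTerm (j : Fin J) (q : ℝ) (ξ : Euc d) : EReal :=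
  perspective (fun u : Euc d => (D.cost (D.zhat j + u) (D.zhat j) : EReal)) ξ q

/-- `ν g_l^*(β / ν)`: the perspective of the conjugate of `g_l`. -/
def feasTerm (l : Fin L) (ν : ℝ) (β : Euc m) : EReal :=
  perspective (conjugate (D.g l)) β ν

/-- The objective function of the finite program. -/
def progObjective (x : DualVar m d I J L) : EReal :=
  -(∑ i, ∑ j, D.saddleTerm i j (x.q i j) (x.alpha i j) (x.xi i j)) -
    ∑ l, D.feasTerm l (x.nu l) (x.beta l)

/-- The feasible set of the finite program. -/
def progFeasible : Set (DualVar m d I J L) :=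
  {x | (∀ i j, 0 ≤ x.q i j) ∧ (∀ l, 0 ≤ x.nu l) ∧
    (∀ i j k, D.supportTerm k j (x.q i j) (x.xi i j) ≤ 0) ∧
    (∀ j, ∑ i, x.q i j = D.p j) ∧
    (∑ i, ∑ j, x.alpha i j) + ∑ l, x.beta l = 0 ∧
    ∑ i, ∑ j, D.costTerm j (x.q i j) (x.xi i j) ≤ (D.eps : EReal)}

/-- `x` is a maximizer (optimal solution) of the finite program. -/
def IsProgMaximizer (x : DualVar m d I J L) : Prop :=
  x ∈ D.progFeasible ∧ ∀ y ∈ D.progFeasible, D.progObjective y ≤ D.progObjective x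

end DROData

/-! ### Distributions constructed from a point of the finite program -/

namespace DualVar

variable {m d I J L : ℕ} (x : DualVar m d I J L)

/-- The index set `I_j^+ = {i | q_ij > 0}`. -/
def posIdx (j : Fin J) : Finset (Fin I) := by
  classical exact Finset.univ.filter (fun i => 0 < x.q i j)

/-- The index set `I_j^∞ = {i | q_ij = 0, ξ_ij ≠ 0}`. -/
def infIdx (j : Fin J) : Finset (Fin I) := by
  classical exact Finset.univ.filter (fun i => x.q i j = 0 ∧ x.xi i j ≠ 0)

end DualVar

namespace DROData

variable {m d I J K L : ℕ} (D : DROData m d I J K L)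

/-- `Q⋆ = ∑_j ∑_{i ∈ I_j^+} q_ij δ_{ẑ_j + ξ_ij / q_ij}`. -/
def starDist (x : DualVar m d I J L) : Measure (Euc d) :=
  ∑ j, ∑ i ∈ x.posIdx j,
    ENNReal.ofReal (x.q i j) • Measure.dirac (D.zhat j + (x.q i j)⁻¹ • x.xi i j)

/-- `Q(n) = ∑_j (∑_{i ∈ I_j^+} q_ij (1 - |I_j^∞| / n) δ_{ẑ_j + ξ_ij / q_ij}
  + ∑_{i ∈ I_j^∞} (p_j / n) δ_{ẑ_j + n ξ_ij / p_j})`. -/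
def seqDist (x : DualVar m d I J L) (n : ℕ) : Measure (Euc d) :=
  ∑ j, ((∑ i ∈ x.posIdx j,
      ENNReal.ofReal (x.q i j * (1 - ((x.infIdx j).card : ℝ) / n)) •
        Measure.dirac (D.zhat j + (x.q i j)⁻¹ • x.xi i j)) +
    ∑ i ∈ x.infIdx j,
      ENNReal.ofReal (D.p j / n) •
        Measure.dirac (D.zhat j + ((n : ℝ) / D.p j) • x.xi i j))

end DROData

end

/-! ### Suprema of affine functions -/

section SupAffine

variable {E : Type*} [NormedAddCommGroup E] [NormedSpace ℝ E]
variable {E' : Type*} [NormedAddCommGroup E'] [NormedSpace ℝ E']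

/-- `F` agrees on `S` with the supremum of a nonempty family of continuous affine functions. -/
def IsSupAffineOn (S : Set E) (F : E → EReal) : Prop :=
  ∃ A : Set ((E →L[ℝ] ℝ) × ℝ), A.Nonempty ∧
    ∀ x ∈ S, F x = ⨆ a ∈ A, ((a.1 x + a.2 : ℝ) : EReal)

theorem IsSupAffineOn.bot_lt {S : Set E} {F : E → EReal} (h : IsSupAffineOn S F) {x : E}
    (hx : x ∈ S) : ⊥ < F x := by
  obtain ⟨A, ⟨a, ha⟩, hA⟩ := h
  rw [hA x hx]
  exact lt_of_lt_of_le (EReal.bot_lt_coe _)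
    (le_iSup₂ (f := fun (a : (E →L[ℝ] ℝ) × ℝ) (_ : a ∈ A) => ((a.1 x + a.2 : ℝ) : EReal)) a ha)

theorem IsSupAffineOn.comp {S : Set E} {F : E → EReal} (h : IsSupAffineOn S F)
    (φ : E' →L[ℝ] E) {S' : Set E'} (hS : ∀ x ∈ S', φ x ∈ S) :
    IsSupAffineOn S' (fun x => F (φ x)) := by
  obtain ⟨A, hne, hA⟩ := h
  refine ⟨(fun a => (a.1.comp φ, a.2)) '' A, hne.image _, fun x hx => ?_⟩
  simp only [hA _ (hS x hx), iSup_image]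
  rfl

theorem EReal.biSup_coe_add_biSup_coe {ι κ : Type*} {A : Set ι} {B : Set κ}
    (u : ι → ℝ) (v : κ → ℝ) :
    (⨆ a ∈ A, (u a : EReal)) + ⨆ b ∈ B, (v b : EReal) =
      ⨆ p ∈ A ×ˢ B, ((u p.1 + v p.2 : ℝ) : EReal) := by
  apply le_antisymm
  · apply EReal.add_le_of_forall_lt
    intro r hr s hs
    obtain ⟨a, ha, hra⟩ := lt_biSup_iff.1 hr
    obtain ⟨b, hb, hsb⟩ := lt_biSup_iff.1 hs
    calc r + s ≤ (u a : EReal) + v b := add_le_add hra.le hsb.le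
      _ = ((u a + v b : ℝ) : EReal) := by push_cast; rfl
      _ ≤ _ := le_iSup₂ (f := fun (p : ι × κ) (_ : p ∈ A ×ˢ B) => ((u p.1 + v p.2 : ℝ) : EReal))
        (a, b) ⟨ha, hb⟩
  · refine iSup₂_le fun p hp => ?_
    push_cast
    exact add_le_add (le_iSup₂ (f := fun (a : ι) (_ : a ∈ A) => (u a : EReal)) p.1 hp.1)
      (le_iSup₂ (f := fun (b : κ) (_ : b ∈ B) => (v b : EReal)) p.2 hp.2)

theorem IsSupAffineOn.add {S : Set E} {F G : E → EReal} (hF : IsSupAffineOn S F)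
    (hG : IsSupAffineOn S G) : IsSupAffineOn S (fun x => F x + G x) := by
  obtain ⟨A, hA, hFA⟩ := hF
  obtain ⟨B, hB, hGB⟩ := hG
  refine ⟨(fun p => p.1 + p.2) '' (A ×ˢ B), (hA.prod hB).image _, fun x hx => ?_⟩
  simp only [hFA x hx, hGB x hx]
  rw [iSup_image, EReal.biSup_coe_add_biSup_coe]
  refine iSup_congr fun p => iSup_congr fun _ => ?_
  simp only [Prod.fst_add, Prod.snd_add, _root_.add_apply]
  norm_cast
  ring

theorem IsSupAffineOn.zero (S : Set E) : IsSupAffineOn S (fun _ => 0) :=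
  ⟨{0}, singleton_nonempty _, fun x _ => by simp⟩

theorem IsSupAffineOn.sum {ι : Type*} {S : Set E} (s : Finset ι) {F : ι → E → EReal}
    (h : ∀ i ∈ s, IsSupAffineOn S (F i)) : IsSupAffineOn S (fun x => ∑ i ∈ s, F i x) := by
  classical
  induction s using Finset.induction_on with
  | empty => simpa using IsSupAffineOn.zero S
  | insert i s hi ih =>
    simp only [Finset.sum_insert hi]
    exact (h i (by simp)).add (ih fun j hj => h j (by simp [hj]))

theorem IsSupAffineOn.le_iff {S : Set E} {F : E → EReal} (h : IsSupAffineOn S F) :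
    ∃ A : Set ((E →L[ℝ] ℝ) × ℝ), ∀ x ∈ S, ∀ r : ℝ, F x ≤ r ↔ ∀ a ∈ A, a.1 x + a.2 ≤ r := by
  obtain ⟨A, _, hA⟩ := h
  refine ⟨A, fun x hx r => ?_⟩
  rw [hA x hx, iSup₂_le_iff]
  simp only [EReal.coe_le_coe_iff]

theorem IsSupAffineOn.convex_epi {S : Set E} {F : E → EReal} (h : IsSupAffineOn S F)
    (hS : Convex ℝ S) : Convex ℝ {w : E × ℝ | w.1 ∈ S ∧ F w.1 ≤ (w.2 : EReal)} := by
  obtain ⟨A, hA⟩ := h.le_iff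
  rintro ⟨x, r⟩ ⟨hx, hr⟩ ⟨y, s⟩ ⟨hy, hs⟩ a b ha hb hab
  have hxy := hS hx hy ha hb hab
  refine ⟨hxy, ?_⟩
  simp only [Prod.fst_add, Prod.smul_fst, Prod.snd_add, Prod.smul_snd, smul_eq_mul] at *
  rw [hA _ hx] at hr
  rw [hA _ hy] at hs
  rw [hA _ hxy]
  intro p hp
  have h1 := mul_le_mul_of_nonneg_left (hr p hp) ha
  have h2 := mul_le_mul_of_nonneg_left (hs p hp) hb
  simp only [map_add, map_smul, smul_eq_mul]
  have h3 : p.2 = a * p.2 + b * p.2 := by rw [← add_mul, hab, one_mul]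
  linarith

theorem IsSupAffineOn.convex_le {S : Set E} {F : E → EReal} (h : IsSupAffineOn S F)
    (hS : Convex ℝ S) (r : ℝ) : Convex ℝ {x | x ∈ S ∧ F x ≤ (r : EReal)} := by
  intro x hx y hy a b ha hb hab
  have := h.convex_epi hS (x := (x, r)) hx (y := (y, r)) hy ha hb hab
  simp only [mem_ofPred_eq, Prod.fst_add, Prod.smul_fst, Prod.snd_add, Prod.smul_snd,
    smul_eq_mul, ← add_mul, hab, one_mul] at this
  exact this

theorem IsSupAffineOn.isClosed_le {S : Set E} {F : E → EReal} (h : IsSupAffineOn S F)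
    (hS : IsClosed S) (r : ℝ) : IsClosed {x | x ∈ S ∧ F x ≤ (r : EReal)} := by
  obtain ⟨A, hA⟩ := h.le_iff
  have : {x | x ∈ S ∧ F x ≤ (r : EReal)} = S ∩ ⋂ a ∈ A, {x | a.1 x + a.2 ≤ r} := by
    ext x
    simp only [mem_ofPred_eq, mem_inter_iff, mem_iInter]
    constructor
    · rintro ⟨h1, h2⟩
      exact ⟨h1, (hA x h1 r).1 h2⟩
    · rintro ⟨h1, h2⟩
      exact ⟨h1, (hA x h1 r).2 h2⟩
  rw [this]
  exact hS.inter (isClosed_biInter fun a _ => _root_.isClosed_le (by fun_prop) continuous_const)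

theorem IsSupAffineOn.convexOn {S T : Set E} {F : E → EReal} (h : IsSupAffineOn S F)
    (hT : Convex ℝ T) (hTS : T ⊆ S) {f : E → ℝ} (hf : ∀ x ∈ T, F x = f x) :
    ConvexOn ℝ T f := by
  obtain ⟨A, hA⟩ := h.le_iff
  refine ⟨hT, fun x hx y hy a b ha hb hab => ?_⟩
  have hxy := hT hx hy ha hb hab
  have h1 := (hA x (hTS hx) (f x)).1 (hf x hx).le
  have h2 := (hA y (hTS hy) (f y)).1 (hf y hy).le
  rw [← EReal.coe_le_coe_iff, ← hf _ hxy, hA _ (hTS hxy)]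
  intro p hp
  have h1 := mul_le_mul_of_nonneg_left (h1 p hp) ha
  have h2 := mul_le_mul_of_nonneg_left (h2 p hp) hb
  simp only [map_add, map_smul, smul_eq_mul]
  have h3 : p.2 = a * p.2 + b * p.2 := by rw [← add_mul, hab, one_mul]
  linarith

end SupAffine

/-- If the sums of the values of real functions over all choices of arguments are bounded by `B`,
then so is the sum of their suprema. -/
theorem EReal.sum_iSup_le {ι : Type*} {X : ι → Type*} [∀ i, Nonempty (X i)]
    (s : Finset ι) (u : ∀ i, X i → ℝ) (B : ℝ)
    (h : ∀ x : ∀ i, X i, ∑ i ∈ s, u i (x i) ≤ B) :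
    ∑ i ∈ s, ⨆ x : X i, (u i x : EReal) ≤ B := by
  classical
  induction s using Finset.induction_on generalizing B with
  | empty =>
    have := h fun i => Classical.arbitrary _
    simp only [Finset.sum_empty] at this ⊢
    exact_mod_cast this
  | insert i s hi ih =>
    rw [Finset.sum_insert hi]
    have key : ∀ y : X i, ∑ j ∈ s, ⨆ x : X j, (u j x : EReal) ≤ ((B - u i y : ℝ) : EReal) := by
      intro y
      refine ih _ fun x => ?_
      have := h (Function.update x i y)
      rw [Finset.sum_insert hi, Function.update_self] at this
      have h2 : ∑ j ∈ s, u j (Function.update x i y j) = ∑ j ∈ s, u j (x j) := by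
        refine Finset.sum_congr rfl fun j hj => ?_
        rw [Function.update_of_ne]
        rintro rfl
        exact hi hj
      linarith
    generalize hT : ∑ j ∈ s, ⨆ x : X j, (u j x : EReal) = T at key ⊢
    have hTtop : T ≠ ⊤ := fun h => by
      have := key (Classical.arbitrary _)
      rw [h] at this
      exact absurd this (not_le.2 (EReal.coe_lt_top _))
    have hTbot : T ≠ ⊥ := by
      rw [← hT]
      refine (Finset.induction_on (motive := fun s => ⊥ < ∑ j ∈ s, ⨆ x : X j, (u j x : EReal))
        s (by simp) fun j s hj h => ?_).ne'
      rw [Finset.sum_insert hj, EReal.bot_lt_add_iff]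
      exact ⟨lt_of_lt_of_le (EReal.bot_lt_coe _)
        (le_iSup (fun x => (u j x : EReal)) (Classical.arbitrary _)), h⟩
    lift T to ℝ using ⟨hTtop, hTbot⟩
    have : ⨆ x : X i, (u i x : EReal) ≤ ((B - T : ℝ) : EReal) := by
      refine iSup_le fun y => ?_
      have := key y
      rw [EReal.coe_le_coe_iff] at this ⊢
      linarith
    calc _ ≤ ((B - T : ℝ) : EReal) + (T : EReal) := by gcongr
      _ = B := by norm_cast; ring

/-! ### Biconjugation and perspectives -/

section FenchelMoreau

variable {V : Type*} [NormedAddCommGroup V] [InnerProductSpace ℝ V]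

theorem inner_sub_le_conjugate (h : V → EReal) (y x : V) :
    ((inner ℝ y x : ℝ) : EReal) - h x ≤ conjugate h y :=
  le_iSup (fun x => ((inner ℝ y x : ℝ) : EReal) - h x) x

theorem IsClosedConvexFn.isClosed_epi {h : V → EReal} (hh : IsClosedConvexFn h) :
    IsClosed {w : V × ℝ | h w.1 ≤ (w.2 : EReal)} := by
  have := hh.2.2.isClosed_epigraph.preimage
    (f := fun w : V × ℝ => (w.1, (w.2 : EReal)))
    (continuous_fst.prodMk (continuous_coe_real_ereal.comp continuous_snd))
  exact this

/-- A closed convex function is the pointwise supremum of its affine minorants. -/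
theorem IsClosedConvexFn.exists_affine_minorant [CompleteSpace V] {h : V → EReal}
    (hh : IsClosedConvexFn h) (u : V) {r : ℝ} (hr : (r : EReal) < h u) :
    ∃ (y : V) (s : ℝ), conjugate h y ≤ s ∧ r < inner ℝ y u - s := by
  have sep : ∀ (u : V) (r : ℝ), (r : EReal) < h u → ∃ (f : V →L[ℝ] ℝ) (s c : ℝ),
      f u + s * r < c ∧ ∀ x (t : ℝ), h x ≤ t → c < f x + s * t := by
    intro u r hr
    obtain ⟨f, c, h1, h2⟩ := geometric_hahn_banach_point_closed (x := (u, r)) hh.2.1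
      hh.isClosed_epi (by simpa using hr)
    have hf : ∀ x t, f (x, t) = f (x, 0) + f (0, 1) * t := by
      intro x t
      have : ((x, t) : V × ℝ) = (x, 0) + t • (0, 1) := by simp
      rw [this, map_add, map_smul, smul_eq_mul, mul_comm]
    refine ⟨f.comp (ContinuousLinearMap.inl ℝ V ℝ), f (0, 1), c, ?_, ?_⟩
    · rw [hf] at h1
      simpa using h1
    · intro x t hx
      have := h2 (x, t) hx
      rw [hf] at this
      simpa using this
  suffices H : ∃ (f : V →L[ℝ] ℝ) (b : ℝ), (∀ x (t : ℝ), h x ≤ t → f x + b ≤ t) ∧ r < f u + b by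
    obtain ⟨f, b, h1, h2⟩ := H
    refine ⟨(InnerProductSpace.toDual ℝ V).symm f, -b, iSup_le fun x => ?_, ?_⟩
    · rw [InnerProductSpace.toDual_symm_apply]
      rcases eq_or_ne (h x) ⊤ with hx | hx
      · simp [hx]
      · have hb := (hh.1.1 x).ne'
        have := h1 x (h x).toReal (EReal.le_coe_toReal hx)
        rw [← EReal.coe_toReal hx hb]
        norm_cast
        linarith
    · rw [InnerProductSpace.toDual_symm_apply]
      linarith
  have norm_sep : ∀ (u : V) (r : ℝ) (f : V →L[ℝ] ℝ) (s c : ℝ), 0 < s → f u + s * r < c →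
      (∀ x (t : ℝ), h x ≤ t → c < f x + s * t) →
      ∃ (f : V →L[ℝ] ℝ) (b : ℝ), (∀ x (t : ℝ), h x ≤ t → f x + b ≤ t) ∧ r < f u + b := by
    intro u r f s c hs h1 h2
    refine ⟨-(s⁻¹ • f), s⁻¹ * c, fun x t hx => ?_, ?_⟩
    · have := h2 x t hx
      simp only [_root_.neg_apply, _root_.smul_apply, smul_eq_mul]
      have h3 : -(s⁻¹ * f x) + s⁻¹ * c = s⁻¹ * (c - f x) := by ring
      rw [h3, inv_mul_le_iff₀ hs]
      linarith
    · simp only [_root_.neg_apply, _root_.smul_apply, smul_eq_mul]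
      have h3 : -(s⁻¹ * f u) + s⁻¹ * c = s⁻¹ * (c - f u) := by ring
      rw [h3, lt_inv_mul_iff₀ hs]
      linarith
  obtain ⟨u₀, hu₀⟩ := hh.1.2
  have hu₀b := (hh.1.1 u₀).ne'
  have hu₀t : h u₀ ≠ ⊤ := ne_of_lt hu₀
  have hu₀r := EReal.coe_toReal hu₀t hu₀b
  set r₀ := (h u₀).toReal
  obtain ⟨f₀, b₀, hm₀⟩ : ∃ (f : V →L[ℝ] ℝ) (b : ℝ), ∀ x (t : ℝ), h x ≤ t → f x + b ≤ t := by
    obtain ⟨f, s, c, h1, h2⟩ := sep u₀ (r₀ - 1) (by rw [← hu₀r]; norm_cast; linarith)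
    have h3 := h2 u₀ r₀ hu₀r.ge
    obtain ⟨f, b, h, -⟩ := norm_sep u₀ (r₀ - 1) f s c (by nlinarith) h1 h2
    exact ⟨f, b, h⟩
  obtain ⟨f, s, c, h1, h2⟩ := sep u r hr
  have hs : 0 ≤ s := by
    by_contra! hs
    have h3 := h2 u₀ (max r₀ ((c - f u₀) / s))
      (by rw [← hu₀r]; exact_mod_cast le_max_left _ _)
    have h4 := mul_le_mul_of_nonpos_left (le_max_right r₀ ((c - f u₀) / s)) hs.le
    rw [mul_div_cancel₀ _ hs.ne] at h4
    linarith
  rcases hs.lt_or_eq with hs | rfl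
  · exact norm_sep u r f s c hs h1 h2
  · simp only [zero_mul, add_zero] at h1 h2
    set K := max 0 ((r + 1 - f₀ u - b₀) / (c - f u)) with hK
    have hK0 : 0 ≤ K := le_max_left _ _
    have hcu : 0 < c - f u := by linarith
    have hK1 : r + 1 - f₀ u - b₀ ≤ K * (c - f u) := by
      rw [← div_le_iff₀ hcu]
      exact le_max_right _ _
    refine ⟨f₀ - K • f, b₀ + K * c, fun x t hx => ?_, ?_⟩
    · have h3 := hm₀ x t hx
      have h4 := mul_nonneg hK0 (sub_pos.2 (h2 x t hx)).le
      simp only [_root_.sub_apply, _root_.smul_apply, smul_eq_mul]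
      linarith
    · simp only [_root_.sub_apply, _root_.smul_apply, smul_eq_mul]
      linarith

theorem IsProperFn.bot_lt_conjugate {h : V → EReal} (hh : IsProperFn h) (y : V) :
    ⊥ < conjugate h y := by
  obtain ⟨x, hx⟩ := hh.2
  refine lt_of_lt_of_le ?_ (inner_sub_le_conjugate h y x)
  rw [← EReal.coe_toReal (ne_of_lt hx) (hh.1 x).ne']
  exact EReal.bot_lt_coe _

theorem IsProperFn.coe_toReal_conjugate {h : V → EReal} (hh : IsProperFn h) {y : V}
    (hy : y ∈ effDom (conjugate h)) : ((conjugate h y).toReal : EReal) = conjugate h y :=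
  EReal.coe_toReal (ne_of_lt hy) (hh.bot_lt_conjugate y).ne'

theorem IsClosedConvexFn.effDom_conjugate_nonempty [CompleteSpace V] {h : V → EReal}
    (hh : IsClosedConvexFn h) : (effDom (conjugate h)).Nonempty := by
  obtain ⟨u, _⟩ := hh.1.2
  obtain ⟨r, hr⟩ := EReal.lt_iff_exists_real_btwn.1 (hh.1.1 u)
  obtain ⟨y, s, hs, -⟩ := hh.exists_affine_minorant u hr.2
  exact ⟨y, lt_of_le_of_lt hs (EReal.coe_lt_top _)⟩

/-- The dual representation of the perspective function of a closed convex function. -/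
theorem IsClosedConvexFn.perspective_eq [CompleteSpace V] {h : V → EReal}
    (hh : IsClosedConvexFn h) (x : V) {q : ℝ} (hq : 0 ≤ q) :
    perspective h x q = ⨆ y ∈ effDom (conjugate h),
      ((inner ℝ y x - q * (conjugate h y).toReal : ℝ) : EReal) := by
  rcases hq.lt_or_eq with hq | rfl
  swap
  · simp [perspective, supportFn]
  rw [perspective, if_pos hq]
  apply le_antisymm
  · rw [← EReal.ge_of_forall_gt_iff_ge]
    intro r hr
    have h1 : ((q⁻¹ * r : ℝ) : EReal) < h (q⁻¹ • x) := by
      by_contra! hcon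
      have h2 : (q : EReal) * h (q⁻¹ • x) ≤ (q : EReal) * ((q⁻¹ * r : ℝ) : EReal) :=
        mul_le_mul_of_nonneg_left hcon (by exact_mod_cast hq.le)
      rw [← EReal.coe_mul, mul_inv_cancel_left₀ hq.ne'] at h2
      exact absurd hr (not_lt.2 h2)
    obtain ⟨y, s, hs, hys⟩ := hh.exists_affine_minorant _ h1
    have hy : y ∈ effDom (conjugate h) := lt_of_le_of_lt hs (EReal.coe_lt_top _)
    refine le_trans ?_ (le_iSup₂ (f := fun (y : V) (_ : y ∈ effDom (conjugate h)) =>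
      ((inner ℝ y x - q * (conjugate h y).toReal : ℝ) : EReal)) y hy)
    rw [EReal.coe_le_coe_iff]
    rw [← hh.1.coe_toReal_conjugate hy, EReal.coe_le_coe_iff] at hs
    rw [inner_smul_right] at hys
    have h3 := mul_le_mul_of_nonneg_left hs hq.le
    have h4 := mul_lt_mul_of_pos_left hys hq
    rw [mul_sub, mul_inv_cancel_left₀ hq.ne', mul_inv_cancel_left₀ hq.ne'] at h4
    linarith
  · refine iSup₂_le fun y hy => ?_
    have h1 := inner_sub_le_conjugate h y (q⁻¹ • x)
    rcases eq_or_ne (h (q⁻¹ • x)) ⊤ with ht | ht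
    · rw [ht, EReal.coe_mul_top_of_pos hq]
      exact le_top
    · rw [← EReal.coe_toReal ht (hh.1.1 _).ne'] at h1 ⊢
      rw [← hh.1.coe_toReal_conjugate hy] at h1
      norm_cast at h1 ⊢
      rw [inner_smul_right] at h1
      have h4 := mul_le_mul_of_nonneg_left h1 hq.le
      rw [mul_sub, mul_inv_cancel_left₀ hq.ne'] at h4
      linarith

theorem IsClosedConvexFn.isSupAffineOn_perspective [CompleteSpace V] {h : V → EReal}
    (hh : IsClosedConvexFn h) :
    IsSupAffineOn {w : V × ℝ | 0 ≤ w.2} (fun w => perspective h w.1 w.2) := by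
  refine ⟨(fun y => ((innerSL ℝ y).comp (ContinuousLinearMap.fst ℝ V ℝ) -
    (conjugate h y).toReal • ContinuousLinearMap.snd ℝ V ℝ, 0)) '' effDom (conjugate h),
    hh.effDom_conjugate_nonempty.image _, fun w hw => ?_⟩
  simp only [iSup_image, hh.perspective_eq w.1 hw]
  refine iSup_congr fun y => iSup_congr fun _ => ?_
  simp [mul_comm]

theorem perspective_one (h : V → EReal) (x : V) : perspective h x 1 = h x := by
  simp [perspective]

theorem IsClosedConvexFn.le_biconjugate [CompleteSpace V] {h : V → EReal}
    (hh : IsClosedConvexFn h) (x : V) : h x ≤ conjugate (conjugate h) x := by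
  rw [← perspective_one h x, hh.perspective_eq x zero_le_one]
  refine iSup₂_le fun y hy => le_trans (le_of_eq ?_) (inner_sub_le_conjugate _ x y)
  rw [← hh.1.coe_toReal_conjugate hy, one_mul, real_inner_comm]
  norm_cast

theorem biconjugate_le (h : V → EReal) (hb : ∀ x, ⊥ < h x) (x : V) :
    conjugate (conjugate h) x ≤ h x := by
  refine iSup_le fun y => ?_
  rcases eq_or_ne (h x) ⊤ with ht | ht
  · simp [ht]
  · have h1 := inner_sub_le_conjugate h y x
    rw [← EReal.coe_toReal ht (hb x).ne'] at h1 ⊢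
    rw [real_inner_comm y x]
    rcases eq_or_ne (conjugate h y) ⊤ with hy | hy
    · simp [hy]
    · have hyb : conjugate h y ≠ ⊥ := fun h0 => by
        rw [h0] at h1
        exact absurd (lt_of_lt_of_le (EReal.bot_lt_coe _)
          ((EReal.coe_sub _ _).le.trans h1)) (lt_irrefl _)
      rw [← EReal.coe_toReal hy hyb] at h1 ⊢
      norm_cast at h1 ⊢
      linarith

theorem IsClosedConvexFn.biconjugate_eq [CompleteSpace V] {h : V → EReal}
    (hh : IsClosedConvexFn h) : conjugate (conjugate h) = h :=
  funext fun x => le_antisymm (biconjugate_le h hh.1.1 x) (hh.le_biconjugate x)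

/-- A function bounded below by the positive multiples of a recession bound. -/
theorem IsClosedConvexFn.le_add_smul [CompleteSpace V] {h : V → EReal}
    (hh : IsClosedConvexFn h) (u x : V) {t : ℝ} (ht : 0 ≤ t) {a b : ℝ} (ha : h u ≤ a)
    (hb : perspective h x 0 ≤ b) : h (u + t • x) ≤ ((a + t * b : ℝ) : EReal) := by
  rw [← perspective_one h, hh.perspective_eq _ zero_le_one]
  rw [← perspective_one h, hh.perspective_eq _ zero_le_one, iSup₂_le_iff] at ha
  rw [hh.perspective_eq _ le_rfl, iSup₂_le_iff] at hb
  refine iSup₂_le fun y hy => ?_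
  have h1 := ha y hy
  have h2 := hb y hy
  rw [EReal.coe_le_coe_iff] at *
  rw [inner_add_right, inner_smul_right]
  have := mul_le_mul_of_nonneg_left h2 ht
  linarith

theorem IsClosedConvexFn.perspective_zero_zero [CompleteSpace V] {h : V → EReal}
    (hh : IsClosedConvexFn h) : perspective h 0 0 = 0 := by
  rw [hh.perspective_eq _ le_rfl]
  simp [biSup_const hh.effDom_conjugate_nonempty]

theorem IsClosedConvexFn.bot_lt_perspective [CompleteSpace V] {h : V → EReal}
    (hh : IsClosedConvexFn h) (x : V) {q : ℝ} (hq : 0 ≤ q) : ⊥ < perspective h x q :=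
  hh.isSupAffineOn_perspective.bot_lt (x := (x, q)) hq

theorem isConvexFn_of_isSupAffineOn {h : V → EReal} (hh : IsSupAffineOn univ h) :
    IsConvexFn h := by
  have := hh.convex_epi convex_univ
  simpa [IsConvexFn] using this

theorem lowerSemicontinuous_of_isSupAffineOn {h : V → EReal} (hh : IsSupAffineOn univ h) :
    LowerSemicontinuous h := by
  obtain ⟨A, _, hA⟩ := hh
  have : h = fun x => ⨆ a ∈ A, ((a.1 x + a.2 : ℝ) : EReal) := funext fun x => hA x (mem_univ _)
  rw [this]
  refine lowerSemicontinuous_biSup fun a _ => Continuous.lowerSemicontinuous ?_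
  exact continuous_coe_real_ereal.comp (by fun_prop)

theorem IsClosedConvexFn.of_isSupAffineOn {h : V → EReal} (hh : IsSupAffineOn univ h)
    (hd : (effDom h).Nonempty) : IsClosedConvexFn h :=
  ⟨⟨fun _ => hh.bot_lt (mem_univ _), hd⟩, isConvexFn_of_isSupAffineOn hh,
    lowerSemicontinuous_of_isSupAffineOn hh⟩

theorem IsClosedConvexFn.isSupAffineOn [CompleteSpace V] {h : V → EReal}
    (hh : IsClosedConvexFn h) : IsSupAffineOn univ h := by
  refine ⟨(fun y => (innerSL ℝ y, -(conjugate h y).toReal)) '' effDom (conjugate h),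
    hh.effDom_conjugate_nonempty.image _, fun x _ => ?_⟩
  rw [iSup_image]
  conv_lhs => rw [← perspective_one h, hh.perspective_eq x zero_le_one]
  refine iSup_congr fun y => iSup_congr fun _ => ?_
  simp [sub_eq_add_neg]

theorem IsClosedConvexFn.conjugate [CompleteSpace V] {h : V → EReal}
    (hh : IsClosedConvexFn h) : IsClosedConvexFn (conjugate h) := by
  refine .of_isSupAffineOn ⟨(fun x => (innerSL ℝ x, -(h x).toReal)) '' effDom h,
    hh.1.2.image _, fun y _ => ?_⟩ hh.effDom_conjugate_nonempty
  rw [iSup_image]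
  apply le_antisymm
  · refine iSup_le fun x => ?_
    rcases eq_or_ne (h x) ⊤ with ht | ht
    · simp [ht]
    · refine le_trans (le_of_eq ?_) (le_iSup₂ (f := fun (x : V) (_ : x ∈ effDom h) =>
        (((innerSL ℝ x) y + -(h x).toReal : ℝ) : EReal)) x ht.lt_top)
      conv_lhs => rw [← EReal.coe_toReal ht (hh.1.1 x).ne']
      rw [real_inner_comm, innerSL_apply_apply, ← sub_eq_add_neg]
      norm_cast
  · refine iSup₂_le fun x hx => le_trans (le_of_eq ?_) (inner_sub_le_conjugate h y x)
    conv_rhs => rw [← EReal.coe_toReal (ne_of_lt hx) (hh.1.1 x).ne']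
    rw [real_inner_comm, innerSL_apply_apply, ← sub_eq_add_neg]
    norm_cast

theorem IsClosedConvexFn.translate {h : V → EReal} (hh : IsClosedConvexFn h) (z : V) :
    IsClosedConvexFn (fun u => h (z + u)) := by
  refine ⟨⟨fun u => hh.1.1 _, ?_⟩, ?_, ?_⟩
  · obtain ⟨x, hx⟩ := hh.1.2
    exact ⟨x - z, by simpa [effDom] using hx⟩
  · have := hh.2.1.translate_preimage_right (z, (0 : ℝ))
    simpa [IsConvexFn, preimage, add_comm] using this
  · exact hh.2.2.comp (continuous_const.add continuous_id)

theorem isClosedConvexFn_coe [FiniteDimensional ℝ V] {f : V → ℝ} (hf : ConvexOn ℝ univ f) :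
    IsClosedConvexFn (fun x => (f x : EReal)) := by
  refine ⟨⟨fun x => EReal.bot_lt_coe _, 0, EReal.coe_lt_top _⟩, ?_, ?_⟩
  · have := hf.convex_epigraph
    simpa [IsConvexFn] using this
  · have hc : Continuous f := by
      rw [← continuousOn_univ]
      exact hf.continuousOn isOpen_univ
    exact (continuous_coe_real_ereal.comp hc).lowerSemicontinuous

end FenchelMoreau

/-! ### Theorems of the alternative and Lagrange multipliers -/

theorem sum_insert_update_mul {ι : Type*} [DecidableEq ι] {s : Finset ι} {i : ι} (hi : i ∉ s)
    (κ : ι → ℝ) (r : ℝ) (a : ι → ℝ) :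
    ∑ l ∈ insert i s, Function.update κ i r l * a l = r * a i + ∑ l ∈ s, κ l * a l := by
  rw [Finset.sum_insert hi, Function.update_self]
  congr 1
  refine Finset.sum_congr rfl fun l hl => ?_
  rw [Function.update_of_ne]
  rintro rfl
  exact hi hl

section Alternatives

variable {E : Type*} [AddCommGroup E] [Module ℝ E]

/-- If at each point of a convex set one of finitely many convex functions is nonnegative, then
some convex combination of these functions is nonnegative. -/
theorem exists_weights_of_forall_exists_nonneg {ι : Type*} [Fintype ι] {C : Set E}
    (hne : C.Nonempty) {f : ι → E → ℝ} (hf : ∀ k, ConvexOn ℝ C (f k))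
    (h : ∀ x ∈ C, ∃ k, 0 ≤ f k x) :
    ∃ μ : ι → ℝ, (∀ k, 0 ≤ μ k) ∧ ∑ k, μ k = 1 ∧ ∀ x ∈ C, 0 ≤ ∑ k, μ k * f k x := by
  classical
  set S : Set (ι → ℝ) := univ.pi fun _ => Iio 0 with hS
  set T : Set (ι → ℝ) := {v | ∃ x ∈ C, ∀ k, f k x ≤ v k} with hT
  have hTc : Convex ℝ T := by
    rintro v ⟨x, hx, hv⟩ w ⟨y, hy, hw⟩ a b ha hb hab
    refine ⟨a • x + b • y, (hf (h x hx).choose).1 hx hy ha hb hab, fun k => ?_⟩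
    refine ((hf k).2 hx hy ha hb hab).trans ?_
    simp only [smul_eq_mul, Pi.add_apply, Pi.smul_apply]
    gcongr
    exacts [hv k, hw k]
  have hdisj : Disjoint S T := by
    rw [Set.disjoint_left]
    rintro v hv ⟨x, hx, hw⟩
    obtain ⟨k, hk⟩ := h x hx
    have h1 : v k < 0 := hv k (mem_univ _)
    linarith [hw k]
  obtain ⟨F, u, hF1, hF2⟩ := geometric_hahn_banach_open
    (convex_pi fun k _ => convex_Iio (0 : ℝ))
    (isOpen_set_pi finite_univ fun _ _ => isOpen_Iio) hTc hdisj
  have hFsum : ∀ v : ι → ℝ, F v = ∑ k, F (Pi.single k 1) * v k := by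
    intro v
    conv_lhs => rw [pi_eq_sum_univ' v, map_sum]
    refine Finset.sum_congr rfl fun k _ => ?_
    rw [map_smul, smul_eq_mul, mul_comm]
  have hu : 0 ≤ u := by
    by_contra! hu
    have h1 : ∀ t : ℝ, 0 < t → -t * F 1 < u := fun t ht => by
      have := hF1 (-t • (1 : ι → ℝ)) fun k _ => by simp [ht]
      rwa [map_smul, smul_eq_mul] at this
    have h2 := h1 1 one_pos
    have h3 : 0 < F 1 := by linarith
    have h4 := h1 (-u / (2 * F 1)) (by apply div_pos <;> linarith)
    have h5 : -(-u / (2 * F 1)) * F 1 = u / 2 := by field_simp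
    linarith
  have hc : ∀ k, 0 ≤ F (Pi.single k 1) := by
    intro k
    by_contra! hk
    set M := (|u + F 1| + 1) / (-F (Pi.single k 1)) with hM
    have hM0 : 0 < M := div_pos (by positivity) (by linarith)
    have := hF1 (-M • Pi.single k 1 - 1) fun j _ => by
      simp only [neg_smul, Pi.sub_apply, Pi.neg_apply, Pi.smul_apply, smul_eq_mul, Pi.one_apply,
        mem_Iio]
      have : 0 ≤ M * (Pi.single k (1 : ℝ) : ι → ℝ) j :=
        mul_nonneg hM0.le (by rw [Pi.single_apply]; split_ifs <;> simp)
      linarith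
    rw [map_sub, map_smul, smul_eq_mul] at this
    have h3 : -M * F (Pi.single k 1) = |u + F 1| + 1 := by
      rw [hM]
      field_simp
      exact div_self hk.ne
    linarith [le_abs_self (u + F 1)]
  have hT' : ∀ x ∈ C, u ≤ ∑ k, F (Pi.single k 1) * f k x := fun x hx => by
    rw [← hFsum fun k => f k x]
    exact hF2 _ ⟨x, hx, fun k => le_rfl⟩
  set σ := ∑ k, F (Pi.single k 1) with hσ
  have hσ0 : 0 < σ := by
    refine (Finset.sum_nonneg fun k _ => hc k).lt_of_ne fun h0 => ?_
    have hz := (Finset.sum_eq_zero_iff_of_nonneg fun k _ => hc k).1 h0.symm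
    obtain ⟨x, hx⟩ := hne
    have h1 := hT' x hx
    rw [Finset.sum_eq_zero fun k hk => by rw [hz k hk, zero_mul]] at h1
    have h2 := hF1 (fun _ => -1) fun k _ => by simp
    rw [hFsum, Finset.sum_eq_zero fun k hk => by rw [hz k hk, zero_mul]] at h2
    linarith
  refine ⟨fun k => σ⁻¹ * F (Pi.single k 1), fun k => mul_nonneg (inv_nonneg.2 hσ0.le) (hc k), ?_,
    fun x hx => ?_⟩
  · rw [← Finset.mul_sum, inv_mul_cancel₀ hσ0.ne']
  · simp only [mul_assoc, ← Finset.mul_sum]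
    exact mul_nonneg (inv_nonneg.2 hσ0.le) (hu.trans (hT' x hx))

theorem exists_pair_weights_of_forall_nonneg_or {C : Set E} (hne : C.Nonempty) {f g : E → ℝ}
    (hf : ConvexOn ℝ C f) (hg : ConvexOn ℝ C g) (h : ∀ x ∈ C, 0 ≤ f x ∨ 0 ≤ g x) :
    ∃ a b : ℝ, 0 ≤ a ∧ 0 ≤ b ∧ a + b = 1 ∧ ∀ x ∈ C, 0 ≤ a * f x + b * g x := by
  obtain ⟨μ, h1, h2, h3⟩ := exists_weights_of_forall_exists_nonneg hne (f := ![f, g])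
    (fun k => by fin_cases k <;> assumption)
    (fun x hx => (h x hx).elim (fun h => ⟨0, h⟩) fun h => ⟨1, h⟩)
  simp only [Fin.sum_univ_two] at h2 h3
  exact ⟨μ 0, μ 1, h1 0, h1 1, h2, h3⟩

/-- Every line segment in `C` that ends at `x` can be prolonged beyond `x`. For convex sets in
finite dimensions these are the points of the relative interior. -/
def IsRelCore (C : Set E) (x : E) : Prop :=
  x ∈ C ∧ ∀ y ∈ C, ∃ t : ℝ, 0 < t ∧ x + t • (x - y) ∈ C

theorem AffineMap.convexOn (a : E →ᵃ[ℝ] ℝ) {C : Set E} (hC : Convex ℝ C) : ConvexOn ℝ C a :=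
  ⟨hC, fun x _ y _ s t _ _ hst => by rw [Convex.combo_affine_apply hst]⟩

theorem AffineMap.apply_add_smul_sub (a : E →ᵃ[ℝ] ℝ) (x y : E) (t : ℝ) :
    a (x + t • (x - y)) = a x + t * (a x - a y) := by
  have h1 := a.map_vadd x (t • (x - y))
  have h2 := a.linearMap_vsub x y
  simp only [vadd_eq_add, vsub_eq_sub, map_smul, smul_eq_mul] at h1 h2
  rw [add_comm x, h1, h2]
  ring

theorem IsRelCore.eq_zero_of_nonneg {C : Set E} {x₀ : E} (hx : IsRelCore C x₀)
    {a : E →ᵃ[ℝ] ℝ} (ha : ∀ x ∈ C, 0 ≤ a x) (h0 : a x₀ = 0) : ∀ x ∈ C, a x = 0 := by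
  intro x hxC
  obtain ⟨t, ht, hm⟩ := hx.2 x hxC
  have h1 := ha _ hm
  rw [a.apply_add_smul_sub, h0] at h1
  nlinarith [ha x hxC]

theorem IsRelCore.inter_zero {C : Set E} {x₀ : E} (hx : IsRelCore C x₀)
    {a : E →ᵃ[ℝ] ℝ} (h0 : a x₀ = 0) : IsRelCore {x ∈ C | a x = 0} x₀ := by
  refine ⟨⟨hx.1, h0⟩, fun y hy => ?_⟩
  obtain ⟨t, ht, hm⟩ := hx.2 y hy.1
  refine ⟨t, ht, hm, ?_⟩
  rw [a.apply_add_smul_sub, h0, hy.2]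
  simp

theorem Convex.inter_zero {C : Set E} (hC : Convex ℝ C) (a : E →ᵃ[ℝ] ℝ) :
    Convex ℝ {x ∈ C | a x = 0} := fun x hx y hy s t hs ht hst => by
  refine ⟨hC hx.1 hy.1 hs ht hst, ?_⟩
  rw [Convex.combo_affine_apply hst, hx.2, hy.2]
  simp

theorem exists_multiplier_of_eq {C : Set E} {x₀ : E} (hx : IsRelCore C x₀)
    {f : E → ℝ} (hf : ConvexOn ℝ C f) {a : E →ᵃ[ℝ] ℝ} (h0 : a x₀ = 0)
    (h : ∀ x ∈ C, a x = 0 → 0 ≤ f x) : ∃ κ : ℝ, ∀ x ∈ C, 0 ≤ f x + κ * a x := by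
  have key : ∀ x ∈ C, ∀ y ∈ C, 0 < a x → a y < 0 → -f x / a x ≤ f y / (-a y) := by
    intro x hx y hy hax hay
    have hs : 0 < a x - a y := by linarith
    have h1 : 0 ≤ -a y / (a x - a y) := div_nonneg (by linarith) hs.le
    have h2 : 0 ≤ a x / (a x - a y) := div_nonneg hax.le hs.le
    have h3 : -a y / (a x - a y) + a x / (a x - a y) = 1 := by field_simp; ring
    have h4 := h _ (hf.1 hx hy h1 h2 h3) (by
      rw [Convex.combo_affine_apply h3]
      simp only [smul_eq_mul]
      field_simp
      ring)
    have h5 := h4.trans (hf.2 hx hy h1 h2 h3)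
    simp only [smul_eq_mul] at h5
    have h6 : 0 ≤ (-a y / (a x - a y) * f x + a x / (a x - a y) * f y) * (a x - a y) :=
      mul_nonneg h5 hs.le
    have h7 : (-a y / (a x - a y) * f x + a x / (a x - a y) * f y) * (a x - a y) =
      -a y * f x + a x * f y := by field_simp
    rw [div_le_div_iff₀ hax (by linarith)]
    linarith
  by_cases hpos : ∃ x ∈ C, 0 < a x
  · obtain ⟨x₁, hx₁, hax₁⟩ := hpos
    obtain ⟨y₁, hy₁, hay₁⟩ : ∃ y ∈ C, a y < 0 := by
      obtain ⟨t, ht, hm⟩ := hx.2 x₁ hx₁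
      refine ⟨_, hm, ?_⟩
      rw [a.apply_add_smul_sub, h0]
      nlinarith
    set A := (fun x => -f x / a x) '' {x ∈ C | 0 < a x} with hA
    have hbdd : ∀ y ∈ C, a y < 0 → f y / (-a y) ∈ upperBounds A := by
      rintro y hy hay _ ⟨x, hx, rfl⟩
      exact key x hx.1 y hy hx.2 hay
    have hAne : A.Nonempty := ⟨_, x₁, ⟨hx₁, hax₁⟩, rfl⟩
    refine ⟨sSup A, fun x hx => ?_⟩
    rcases lt_trichotomy (a x) 0 with hax | hax | hax
    · have h1 := csSup_le hAne (hbdd x hx hax)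
      rw [le_div_iff₀ (by linarith)] at h1
      linarith
    · rw [hax, mul_zero, add_zero]
      exact h x hx hax
    · have h1 := le_csSup ⟨_, hbdd y₁ hy₁ hay₁⟩ ⟨x, ⟨hx, hax⟩, rfl⟩
      simp only at h1
      rw [div_le_iff₀ hax] at h1
      linarith
  · push Not at hpos
    refine ⟨0, fun x hxC => ?_⟩
    rw [zero_mul, add_zero]
    refine h x hxC ?_
    have := hx.eq_zero_of_nonneg (a := -a) (fun y hy => by simpa using hpos y hy)
      (by simp [h0]) x hxC
    simpa using this

theorem convexOn_add_sum_mul_affine {ι : Type*} {C : Set E} {f : E → ℝ} (hf : ConvexOn ℝ C f)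
    (s : Finset ι) (a : ι → E →ᵃ[ℝ] ℝ) (ν : ι → ℝ) :
    ConvexOn ℝ C fun x => f x + ∑ l ∈ s, ν l * a l x := by
  classical
  induction s using Finset.induction_on with
  | empty => simpa using hf
  | insert l s hl ih =>
    have h := ih.add ((ν l • a l).convexOn hf.1)
    refine h.congr fun x _ => ?_
    rw [Finset.sum_insert hl]
    simp only [Pi.add_apply, AffineMap.coe_smul, Pi.smul_apply, smul_eq_mul]
    ring

theorem exists_multipliers_of_eq {ι : Type*} {x₀ : E} (a : ι → E →ᵃ[ℝ] ℝ) (s : Finset ι)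
    (h0 : ∀ l ∈ s, a l x₀ = 0) {C : Set E} (hx : IsRelCore C x₀) {f : E → ℝ}
    (hf : ConvexOn ℝ C f) (h : ∀ x ∈ C, (∀ l ∈ s, a l x = 0) → 0 ≤ f x) :
    ∃ κ : ι → ℝ, ∀ x ∈ C, 0 ≤ f x + ∑ l ∈ s, κ l * a l x := by
  classical
  induction s using Finset.induction_on generalizing C with
  | empty => exact ⟨0, fun x hx => by simpa using h x hx (by simp)⟩
  | insert i s hi ih =>
    have hi0 := h0 i (by simp)
    obtain ⟨κ, hκ⟩ := ih (fun l hl => h0 l (by simp [hl])) (hx.inter_zero hi0)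
      (hf.subset (fun x hx => hx.1) (hf.1.inter_zero _)) fun x hx hxs =>
        h x hx.1 (by simpa [hx.2] using hxs)
    obtain ⟨r, hr⟩ := exists_multiplier_of_eq hx (convexOn_add_sum_mul_affine hf s a κ) hi0
      fun x hx hx0 => hκ x ⟨hx, hx0⟩
    refine ⟨Function.update κ i r, fun x hx => ?_⟩
    rw [sum_insert_update_mul hi]
    linarith [hr x hx]

/-- Lagrange multipliers for affine constraints that hold at a point of the relative core. -/
theorem exists_multipliers_of_affine_le {ι : Type*} {x₀ : E} (a : ι → E →ᵃ[ℝ] ℝ) (s : Finset ι)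
    (h0 : ∀ l ∈ s, a l x₀ ≤ 0) {C : Set E} (hx : IsRelCore C x₀) {f : E → ℝ}
    (hf : ConvexOn ℝ C f) (h : ∀ x ∈ C, (∀ l ∈ s, a l x ≤ 0) → 0 ≤ f x) :
    ∃ ν : ι → ℝ, (∀ l, 0 ≤ ν l) ∧ ∀ x ∈ C, 0 ≤ f x + ∑ l ∈ s, ν l * a l x := by
  classical
  induction s using Finset.induction_on generalizing C f with
  | empty => exact ⟨0, fun _ => le_rfl, fun x hx => by simpa using h x hx (by simp)⟩
  | insert i s hi ih =>
    have h0s : ∀ l ∈ s, a l x₀ ≤ 0 := fun l hl => h0 l (by simp [hl])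
    have hi0 := h0 i (by simp)
    set C' : Set E := {x ∈ C | ∀ l ∈ s, a l x ≤ 0} with hC'
    have hC'c : Convex ℝ C' := fun x hx y hy p q hp hq hpq =>
      ⟨hf.1 hx.1 hy.1 hp hq hpq, fun l hl => by
        rw [Convex.combo_affine_apply hpq]
        have h1 := mul_nonneg hp (neg_nonneg.2 (hx.2 l hl))
        have h2 := mul_nonneg hq (neg_nonneg.2 (hy.2 l hl))
        simp only [smul_eq_mul]
        linarith⟩
    have hx₀' : x₀ ∈ C' := ⟨hx.1, h0s⟩
    obtain ⟨p, q, hp, hq, hpq, hpos⟩ := exists_pair_weights_of_forall_nonneg_or ⟨x₀, hx₀'⟩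
      (hf.subset (fun x hx => hx.1) hC'c) ((a i).convexOn hC'c) fun x hxC => by
        by_cases hax : a i x ≤ 0
        · exact Or.inl (h x hxC.1 (by simpa [hax] using hxC.2))
        · exact Or.inr (not_le.1 hax).le
    rcases hp.lt_or_eq with hp | rfl
    · obtain ⟨ν, hν0, hν⟩ := ih h0s hx (hf.add ((a i).convexOn hf.1 |>.smul (div_nonneg hq hp.le)))
        fun x hxC hxs => by
          have h1 := hpos x ⟨hxC, hxs⟩
          have h2 : 0 ≤ (p * f x + q * a i x) / p := div_nonneg h1 hp.le
          have h3 : (p * f x + q * a i x) / p = f x + q / p * a i x := by field_simp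
          rw [h3] at h2
          simpa using h2
      refine ⟨Function.update ν i (q / p), fun l => ?_, fun x hx => ?_⟩
      · rcases eq_or_ne l i with rfl | hl
        · rw [Function.update_self]
          exact div_nonneg hq hp.le
        · rw [Function.update_of_ne hl]
          exact hν0 l
      · rw [sum_insert_update_mul hi]
        have := hν x hx
        simp only [Pi.add_apply, smul_eq_mul] at this
        linarith
    · rw [zero_add] at hpq
      subst hpq
      simp only [zero_mul, one_mul, zero_add] at hpos
      have hi0' : a i x₀ = 0 := le_antisymm hi0 (hpos x₀ hx₀')
      obtain ⟨ν, hν0, hν⟩ := ih h0s hx ((a i).convexOn hf.1) fun x hxC hxs => hpos x ⟨hxC, hxs⟩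
      have hν₀ : ∀ l ∈ s, ν l * a l x₀ = 0 := by
        have h1 := hν x₀ hx.1
        rw [hi0', zero_add] at h1
        have h2 : ∀ l ∈ s, ν l * a l x₀ ≤ 0 := fun l hl =>
          mul_nonpos_of_nonneg_of_nonpos (hν0 l) (h0s l hl)
        exact (Finset.sum_eq_zero_iff_of_nonpos h2).1
          (le_antisymm (Finset.sum_nonpos h2) h1)
      have hident : ∀ x ∈ C, a i x + ∑ l ∈ s, ν l * a l x = 0 := by
        intro x hxC
        have hcv := convexOn_add_sum_mul_affine ((a i).convexOn hf.1) s a ν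
        obtain ⟨t, ht, hm⟩ := hx.2 x hxC
        have h1 := hν _ hm
        simp only [AffineMap.apply_add_smul_sub, mul_add, Finset.sum_add_distrib] at h1
        rw [Finset.sum_eq_zero hν₀, hi0'] at h1
        have h2 : ∑ l ∈ s, ν l * (t * (a l x₀ - a l x)) =
            t * (∑ l ∈ s, ν l * a l x₀ - ∑ l ∈ s, ν l * a l x) := by
          rw [← Finset.sum_sub_distrib, Finset.mul_sum]
          exact Finset.sum_congr rfl fun l _ => by ring
        rw [h2, Finset.sum_eq_zero hν₀] at h1
        have h3 := hν x hxC
        nlinarith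
      set S := s.filter fun l => 0 < ν l with hS
      set C₀ : Set E := {x ∈ C | ∀ l ∈ S, a l x = 0} with hC₀
      have hSz : ∀ l ∈ S, a l x₀ = 0 := fun l hl => by
        rw [hS, Finset.mem_filter] at hl
        exact (mul_eq_zero.1 (hν₀ l hl.1)).resolve_left hl.2.ne'
      have hC₀c : Convex ℝ C₀ := fun x hx y hy p q hp hq hpq =>
        ⟨hf.1 hx.1 hy.1 hp hq hpq, fun l hl => by
          rw [Convex.combo_affine_apply hpq, hx.2 l hl, hy.2 l hl]
          simp⟩
      have hC₀r : IsRelCore C₀ x₀ := by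
        refine ⟨⟨hx.1, hSz⟩, fun y hy => ?_⟩
        obtain ⟨t, ht, hm⟩ := hx.2 y hy.1
        refine ⟨t, ht, hm, fun l hl => ?_⟩
        rw [AffineMap.apply_add_smul_sub, hSz l hl, hy.2 l hl]
        simp
      obtain ⟨ν', hν'0, hν'⟩ := ih h0s hC₀r (hf.subset (fun x hx => hx.1) hC₀c)
        fun x hxC hxs => h x hxC.1 fun l hl => by
          rcases Finset.mem_insert.1 hl with rfl | hl
          · have h1 := hident x hxC.1
            have h2 : ∑ j ∈ s, ν j * a j x = 0 := Finset.sum_eq_zero fun j hj => by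
              rcases (hν0 j).lt_or_eq with hpos | hz
              · rw [hxC.2 j (by simp [hS, hj, hpos]), mul_zero]
              · rw [← hz, zero_mul]
            linarith
          · exact hxs l hl
      obtain ⟨κ, hκ⟩ := exists_multipliers_of_eq a S hSz hx
        (convexOn_add_sum_mul_affine hf s a ν') fun x hxC hxS => hν' x ⟨hxC, hxS⟩
      obtain ⟨t, ht⟩ : ∃ t : ℝ, 0 ≤ t ∧ ∀ l ∈ S, 0 ≤ κ l + t * ν l := by
        refine ⟨∑ l ∈ S, |κ l| / ν l, Finset.sum_nonneg fun l _ =>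
          div_nonneg (abs_nonneg _) (hν0 l), fun l hl => ?_⟩
        have h1 : |κ l| / ν l ≤ ∑ l ∈ S, |κ l| / ν l :=
          Finset.single_le_sum (f := fun l => |κ l| / ν l)
            (fun l _ => div_nonneg (abs_nonneg _) (hν0 l)) hl
        have h2 : 0 < ν l := by
          rw [hS, Finset.mem_filter] at hl
          exact hl.2
        rw [div_le_iff₀ h2] at h1
        linarith [neg_abs_le (κ l)]
      refine ⟨Function.update (fun l => ν' l + (if l ∈ S then κ l else 0) + t * ν l) i t,
        fun l => ?_, fun x hxC => ?_⟩
      · rcases eq_or_ne l i with rfl | hl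
        · rw [Function.update_self]
          exact ht.1
        · rw [Function.update_of_ne hl]
          split_ifs with hlS
          · linarith [hν'0 l, ht.2 l hlS]
          · linarith [hν'0 l, mul_nonneg ht.1 (hν0 l)]
      · rw [sum_insert_update_mul hi]
        have h1 := hκ x hxC
        have h2 := hident x hxC
        have h3 : ∑ l ∈ s, (ν' l + (if l ∈ S then κ l else 0) + t * ν l) * a l x =
            ∑ l ∈ s, ν' l * a l x + ∑ l ∈ S, κ l * a l x + t * ∑ l ∈ s, ν l * a l x := by
          simp only [add_mul, Finset.sum_add_distrib, Finset.mul_sum, mul_assoc]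
          congr 2
          rw [hS, Finset.sum_filter]
          refine Finset.sum_congr rfl fun l hl => ?_
          by_cases hl' : 0 < ν l <;> simp [hl, hl']
        rw [h3]
        have h4 : t * (a i x + ∑ l ∈ s, ν l * a l x) = 0 := by rw [h2, mul_zero]
        linarith

/-- Lagrange multipliers under a Slater condition with affine constraints. -/
theorem exists_lagrange_multipliers {ι κ : Type*} [Fintype κ] {x₀ : E} {C : Set E}
    (hx : IsRelCore C x₀) {f : E → ℝ} (hf : ConvexOn ℝ C f)
    (h : κ → E → ℝ) (hh : ∀ k, ConvexOn ℝ C (h k)) (hh0 : ∀ k, h k x₀ < 0)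
    (a : ι → E →ᵃ[ℝ] ℝ) (s : Finset ι) (h0 : ∀ l ∈ s, a l x₀ ≤ 0)
    (hpos : ∀ x ∈ C, (∀ k, h k x ≤ 0) → (∀ l ∈ s, a l x ≤ 0) → 0 ≤ f x) :
    ∃ (μ : κ → ℝ) (ν : ι → ℝ), (∀ k, 0 ≤ μ k) ∧ (∀ l, 0 ≤ ν l) ∧
      ∀ x ∈ C, 0 ≤ f x + ∑ k, μ k * h k x + ∑ l ∈ s, ν l * a l x := by
  classical
  set C' : Set E := {x ∈ C | ∀ l ∈ s, a l x ≤ 0} with hC'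
  have hC'c : Convex ℝ C' := fun x hx y hy p q hp hq hpq =>
    ⟨hf.1 hx.1 hy.1 hp hq hpq, fun l hl => by
      rw [Convex.combo_affine_apply hpq]
      have h1 := mul_nonneg hp (neg_nonneg.2 (hx.2 l hl))
      have h2 := mul_nonneg hq (neg_nonneg.2 (hy.2 l hl))
      simp only [smul_eq_mul]
      linarith⟩
  have hsub : C' ⊆ C := fun x hx => hx.1
  have hx₀' : x₀ ∈ C' := ⟨hx.1, h0⟩
  obtain ⟨w, hw0, hw1, hw⟩ := exists_weights_of_forall_exists_nonneg
    (ι := Option κ) ⟨x₀, hx₀'⟩ (f := fun o => o.elim f h)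
    (fun o => by
      cases o with
      | none => exact hf.subset hsub hC'c
      | some k => exact (hh k).subset hsub hC'c)
    (fun x hxC => by
      by_cases hk : ∃ k, 0 < h k x
      · obtain ⟨k, hk⟩ := hk
        exact ⟨some k, hk.le⟩
      · push Not at hk
        exact ⟨none, hpos x hxC.1 hk hxC.2⟩)
  simp only [Fintype.sum_option, Option.elim] at hw hw1
  have hwn : 0 < w none := by
    refine (hw0 none).lt_of_ne fun hz => ?_
    have h1 := hw x₀ hx₀'
    rw [← hz, zero_mul, zero_add] at h1
    have h2 : ∀ k ∈ Finset.univ, w (some k) * h k x₀ ≤ 0 := fun k _ =>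
      mul_nonpos_of_nonneg_of_nonpos (hw0 _) (hh0 k).le
    have h3 := (Finset.sum_eq_zero_iff_of_nonpos h2).1 (le_antisymm (Finset.sum_nonpos h2) h1)
    have h4 : ∑ k, w (some k) = 0 := Finset.sum_eq_zero fun k hk =>
      (mul_eq_zero.1 (h3 k hk)).resolve_right (hh0 k).ne
    rw [← hz, h4] at hw1
    norm_num at hw1
  have hcv : ConvexOn ℝ C fun x => f x + ∑ k, w (some k) / w none * h k x := by
    have : ∀ t : Finset κ, ConvexOn ℝ C fun x => f x + ∑ k ∈ t, w (some k) / w none * h k x := by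
      intro t
      induction t using Finset.induction_on with
      | empty => simpa using hf
      | insert k t hk ih =>
        refine (ih.add ((hh k).smul (div_nonneg (hw0 (some k)) hwn.le))).congr fun x _ => ?_
        rw [Finset.sum_insert hk]
        simp only [Pi.add_apply, smul_eq_mul]
        ring
    exact this _
  obtain ⟨ν, hν0, hν⟩ := exists_multipliers_of_affine_le a s h0 hx hcv fun x hxC hxs => by
    have h1 := div_nonneg (hw x ⟨hxC, hxs⟩) hwn.le
    have h2 : (w none * f x + ∑ k, w (some k) * h k x) / w none =
        f x + ∑ k, w (some k) / w none * h k x := by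
      rw [add_div, Finset.sum_div, mul_div_cancel_left₀ _ hwn.ne']
      congr 1
      exact Finset.sum_congr rfl fun k _ => by ring
    rwa [h2] at h1
  exact ⟨_, ν, fun k => div_nonneg (hw0 (some k)) hwn.le, hν0, hν⟩

end Alternatives

theorem isRelCore_of_mem_intrinsicInterior {V : Type*} [NormedAddCommGroup V]
    [NormedSpace ℝ V] {C : Set V} {x : V} (hx : x ∈ intrinsicInterior ℝ C) :
    IsRelCore C x := by
  refine ⟨intrinsicInterior_subset hx, fun y hy => ?_⟩
  obtain ⟨x', hx', rfl⟩ := hx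
  have hmem : ∀ t : ℝ, (x' : V) + t • ((x' : V) - y) ∈ affineSpan ℝ C := fun t => by
    have := AffineMap.lineMap_mem (-t) x'.2 (subset_affineSpan ℝ C hy)
    rw [AffineMap.lineMap_apply] at this
    simp only [vsub_eq_sub, vadd_eq_add] at this
    convert this using 1
    rw [add_comm, neg_smul, ← smul_neg, neg_sub]
  set φ : ℝ → affineSpan ℝ C := fun t => ⟨_, hmem t⟩ with hφ
  have hcont : Continuous φ := Continuous.subtype_mk (by fun_prop) _
  have h0 : φ 0 = x' := by ext; simp [hφ]
  have hnhds : φ ⁻¹' ((↑) ⁻¹' C) ∈ 𝓝 (0 : ℝ) :=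
    hcont.continuousAt (by rw [h0]; exact mem_interior_iff_mem_nhds.1 hx')
  obtain ⟨r, hr, hball⟩ := Metric.mem_nhds_iff.1 hnhds
  refine ⟨r / 2, by positivity, ?_⟩
  exact hball (by simp [abs_of_pos hr, hr])

section Splitting

theorem exists_lagrange_multipliers_with_eq {E : Type*} [AddCommGroup E] [Module ℝ E]
    {ι κ η : Type*} [Fintype κ] [Fintype ι] [Fintype η] {x₀ : E} {C : Set E}
    (hx : IsRelCore C x₀) {f : E → ℝ} (hf : ConvexOn ℝ C f)
    (h : κ → E → ℝ) (hh : ∀ k, ConvexOn ℝ C (h k)) (hh0 : ∀ k, h k x₀ < 0)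
    (a : ι → E →ᵃ[ℝ] ℝ) (h0 : ∀ l, a l x₀ ≤ 0) (e : η → E →ᵃ[ℝ] ℝ) (he : ∀ j, e j x₀ = 0)
    (hpos : ∀ x ∈ C, (∀ k, h k x ≤ 0) → (∀ l, a l x ≤ 0) → (∀ j, e j x = 0) → 0 ≤ f x) :
    ∃ (μ : κ → ℝ) (ν : ι → ℝ) (ρ : η → ℝ), (∀ k, 0 ≤ μ k) ∧ (∀ l, 0 ≤ ν l) ∧
      ∀ x ∈ C, 0 ≤ f x + ∑ k, μ k * h k x + ∑ l, ν l * a l x + ∑ j, ρ j * e j x := by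
  obtain ⟨μ, ν, hμ, hν, hpos'⟩ := exists_lagrange_multipliers hx hf h hh hh0
    (ι := ι ⊕ (η ⊕ η)) (Sum.elim a (Sum.elim e fun j => -e j)) Finset.univ
    (by
      rintro (l | j | j) -
      · exact h0 l
      · exact (he j).le
      · simp [he j])
    (fun x hxC hk hs => by
      refine hpos x hxC hk (fun l => hs (Sum.inl l) (Finset.mem_univ _)) fun j => ?_
      have h1 := hs (Sum.inr (Sum.inl j)) (Finset.mem_univ _)
      have h2 := hs (Sum.inr (Sum.inr j)) (Finset.mem_univ _)
      simp only [Sum.elim_inr, Sum.elim_inl, AffineMap.coe_neg, Pi.neg_apply] at h1 h2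
      linarith)
  refine ⟨μ, fun l => ν (Sum.inl l), fun j => ν (Sum.inr (Sum.inl j)) - ν (Sum.inr (Sum.inr j)),
    hμ, fun l => hν _, fun x hxC => ?_⟩
  have h1 := hpos' x hxC
  simp only [Fintype.sum_sum_type, Sum.elim_inl, Sum.elim_inr, AffineMap.coe_neg, Pi.neg_apply]
    at h1
  simp only [sub_mul, Finset.sum_sub_distrib]
  simp only [mul_neg, Finset.sum_neg_distrib] at h1
  linarith

theorem IsRelCore.eventually_mem {E : Type*} [AddCommGroup E] [Module ℝ E] {C : Set E} {x : E}
    (hx : IsRelCore C x) (hC : Convex ℝ C) {y : E} (hy : y ∈ C) :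
    ∀ᶠ t in 𝓝[>] (0 : ℝ), x + t • (x - y) ∈ C := by
  obtain ⟨r, hr, hm⟩ := hx.2 y hy
  filter_upwards [Ioo_mem_nhdsGT hr] with t ht
  have h1 : 0 ≤ t / r := div_nonneg ht.1.le hr.le
  have h2 : 0 ≤ 1 - t / r := by
    rw [sub_nonneg, div_le_one hr]
    exact ht.2.le
  convert hC hm hx.1 h1 h2 (by ring) using 1
  rw [smul_add, smul_smul, div_mul_cancel₀ _ hr.ne', sub_smul, one_smul]
  abel

variable {m : ℕ}

theorem IsConvexFn.convexOn_toReal {V : Type*} [NormedAddCommGroup V] [InnerProductSpace ℝ V]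
    {h : V → EReal} (hh : IsConvexFn h) (hb : ∀ x, ⊥ < h x) :
    ConvexOn ℝ (effDom h) (fun x => (h x).toReal) := by
  have key : ∀ x ∈ effDom h, ∀ y ∈ effDom h, ∀ a b : ℝ, 0 ≤ a → 0 ≤ b → a + b = 1 →
      h (a • x + b • y) ≤ ((a * (h x).toReal + b * (h y).toReal : ℝ) : EReal) := by
    intro x hx y hy a b ha hb' hab
    exact hh (x := (x, (h x).toReal)) (EReal.le_coe_toReal (ne_of_lt hx))
      (y := (y, (h y).toReal)) (EReal.le_coe_toReal (ne_of_lt hy)) ha hb' hab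
  refine ⟨fun x hx y hy a b ha hb' hab =>
    lt_of_le_of_lt (key x hx y hy a b ha hb' hab) (EReal.coe_lt_top _),
    fun x hx y hy a b ha hb' hab => ?_⟩
  have h1 := key x hx y hy a b ha hb' hab
  rw [← EReal.coe_toReal (lt_of_le_of_lt h1 (EReal.coe_lt_top _)).ne (hb _).ne'] at h1
  exact_mod_cast h1

/-- Under a Slater condition, the infimum of a sum of convex functions over a convex program is
attained in its Fenchel-Lagrange dual. -/
theorem exists_dual_solution {ι : Type*} [Fintype ι] {L : ℕ} (φ : ι → Euc m → ℝ)
    (hφ : ∀ n, ConvexOn ℝ univ (φ n)) (g : Fin L → Euc m → EReal)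
    (hg : ∀ l, IsClosedConvexFn (g l)) {θs : Euc m} (hs : IsSlaterPoint g θs) {P : ℝ}
    (hP : ∀ θ ∈ constraintSet g, P ≤ ∑ n, φ n θ) :
    ∃ (α : ι → Euc m) (β : Fin L → Euc m) (ν : Fin L → ℝ), (∀ l, 0 ≤ ν l) ∧
      ∑ n, α n + ∑ l, β l = 0 ∧
      ∑ n, (⨆ θ : Euc m, ((inner ℝ (α n) θ - φ n θ : ℝ) : EReal)) +
        ∑ l, perspective (conjugate (g l)) (β l) (ν l) ≤ ((-P : ℝ) : EReal) := by
  classical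
  set τ := ι ⊕ Fin L with hτ
  set dom : τ → Set (Euc m) := Sum.elim (fun _ => univ) fun l => effDom (g l) with hdom
  have hdomc : ∀ t, Convex ℝ (dom t) := by
    rintro (n | l)
    · exact convex_univ
    · exact ((hg l).2.1.convexOn_toReal (hg l).1.1).1
  have hdomr : ∀ t, IsRelCore (dom t) θs := by
    rintro (n | l)
    · exact ⟨mem_univ _, fun y _ => ⟨1, one_pos, mem_univ _⟩⟩
    · exact isRelCore_of_mem_intrinsicInterior (hs.2.1 l)
  set C : Set (Euc m × (τ → Euc m)) := {w | ∀ t, w.2 t ∈ dom t} with hC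
  have hCc : Convex ℝ C := fun x hx y hy a b ha hb hab t =>
    hdomc t (hx t) (hy t) ha hb hab
  set x₀ : Euc m × (τ → Euc m) := (θs, fun _ => θs) with hx₀
  have hcore : IsRelCore C x₀ := by
    refine ⟨fun t => (hdomr t).1, fun y hy => ?_⟩
    have h1 : ∀ᶠ r in 𝓝[>] (0 : ℝ), ∀ t, θs + r • (θs - y.2 t) ∈ dom t :=
      eventually_all.2 fun t => (hdomr t).eventually_mem (hdomc t) (hy t)
    obtain ⟨r, hr, hr0⟩ := (h1.and self_mem_nhdsWithin).exists
    exact ⟨r, hr0, fun t => hr t⟩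
  have hproj : ∀ t, ConvexOn ℝ C fun w => Sum.elim φ (fun l x => (g l x).toReal) t (w.2 t) := by
    intro t
    have h1 : ConvexOn ℝ (dom t) (Sum.elim φ (fun l x => (g l x).toReal) t) := by
      rcases t with n | l
      · exact hφ n
      · exact (hg l).2.1.convexOn_toReal (hg l).1.1
    refine ⟨hCc, fun x hx y hy a b ha hb hab => ?_⟩
    exact h1.2 (hx t) (hy t) ha hb hab
  have hf : ConvexOn ℝ C fun w => ∑ n, φ n (w.2 (Sum.inl n)) - P := by
    have : ∀ s : Finset ι, ConvexOn ℝ C fun w => ∑ n ∈ s, φ n (w.2 (Sum.inl n)) := by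
      intro s
      induction s using Finset.induction_on with
      | empty => simpa using convexOn_const (0 : ℝ) hCc
      | insert n s hn ih =>
        simp only [Finset.sum_insert hn]
        exact (hproj (Sum.inl n)).add ih
    exact (this _).sub (concaveOn_const P hCc)
  choose av bv hab using fun k : {l // IsAffineFn (g l)} => k.2
  set a : {l // IsAffineFn (g l)} → (Euc m × (τ → Euc m)) →ᵃ[ℝ] ℝ := fun k =>
    ((innerₗ (Euc m) (av k)).comp ((LinearMap.proj (Sum.inr k.1)).comp
      (LinearMap.snd ℝ (Euc m) (τ → Euc m)))).toAffineMap +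
      AffineMap.const ℝ (Euc m × (τ → Euc m)) (bv k) with ha
  have haval : ∀ k w, a k w = (g k.1 (w.2 (Sum.inr k.1))).toReal := fun k w => by
    rw [hab k, EReal.toReal_coe]
    simp [ha]
  set e : τ × Fin m → (Euc m × (τ → Euc m)) →ᵃ[ℝ] ℝ := fun j =>
    ((EuclideanSpace.projₗ j.2).comp ((LinearMap.proj j.1).comp
      (LinearMap.snd ℝ (Euc m) (τ → Euc m)) - LinearMap.fst ℝ (Euc m) (τ → Euc m))).toAffineMap
    with he
  have heval : ∀ j w, e j w = w.2 j.1 j.2 - w.1 j.2 := fun j w => by simp [he]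
  obtain ⟨μ, ν, ρ, hμ, hν, hpos⟩ := exists_lagrange_multipliers_with_eq hcore hf
    (fun (k : {l // ¬ IsAffineFn (g l)}) w => (g k.1 (w.2 (Sum.inr k.1))).toReal)
    (fun k => hproj (Sum.inr k.1))
    (fun k => by
      have h1 := hs.2.2 k.1 k.2
      have h2 := (hg k.1).1.1 θs
      rw [← EReal.coe_toReal (ne_of_lt (h1.trans (by simp))) h2.ne'] at h1
      exact_mod_cast h1)
    a (fun k => by
      rw [haval]
      exact EReal.toReal_nonpos (hs.1 k.1))
    e (fun j => by rw [heval]; simp [hx₀])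
    (fun w hw h1 h2 h3 => by
      have hwt : ∀ t, w.2 t = w.1 := fun t => by
        ext i
        have := h3 (t, i)
        rw [heval] at this
        linarith
      have hwΘ : w.1 ∈ constraintSet g := fun l => by
        have h4 : (g l w.1).toReal ≤ 0 := by
          by_cases hl : IsAffineFn (g l)
          · have := h2 ⟨l, hl⟩
            rwa [haval, hwt] at this
          · have := h1 ⟨l, hl⟩
            rwa [hwt] at this
        have h5 := hw (Sum.inr l)
        rw [hwt] at h5
        rw [← EReal.coe_toReal (ne_of_lt h5) ((hg l).1.1 _).ne']
        exact_mod_cast h4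
      have := hP _ hwΘ
      simp only [hwt]
      linarith)
  set N : Fin L → ℝ := fun l => if hl : IsAffineFn (g l) then ν ⟨l, hl⟩ else μ ⟨l, hl⟩ with hN
  have hN0 : ∀ l, 0 ≤ N l := fun l => by
    simp only [hN]
    split_ifs
    exacts [hν _, hμ _]
  set γ : τ → Euc m := fun t => WithLp.toLp 2 fun i => -ρ (t, i) with hγ
  have hinner : ∀ t (x : Euc m), inner ℝ (γ t) x = -∑ i, ρ (t, i) * x i := fun t x => by
    simp [hγ, PiLp.inner_apply, mul_comm]
  set w : τ → Euc m → ℝ := Sum.elim φ fun l x => N l * (g l x).toReal with hw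
  have main : ∀ (θ : Euc m) (x : τ → Euc m), (∀ t, x t ∈ dom t) →
      ∑ t, (inner ℝ (γ t) (x t) - w t (x t)) ≤ -P + inner ℝ (∑ t, γ t) θ := by
    intro θ x hx
    have h1 := hpos (θ, x) hx
    have h2 : ∑ k : {l // ¬ IsAffineFn (g l)}, μ k * (g k.1 (x (Sum.inr k.1))).toReal +
        ∑ k, ν k * a k (θ, x) = ∑ l, N l * (g l (x (Sum.inr l))).toReal := by
      rw [← Fintype.sum_subtype_add_sum_subtype (fun l => IsAffineFn (g l)), add_comm]
      congr 1
      · refine Finset.sum_congr rfl fun k _ => ?_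
        rw [haval]
        simp [hN, k.2]
      · refine Finset.sum_congr rfl fun k _ => ?_
        simp [hN, k.2]
    have h3 : ∑ j, ρ j * e j (θ, x) = -∑ t, inner ℝ (γ t) (x t) + inner ℝ (∑ t, γ t) θ := by
      rw [sum_inner, Fintype.sum_prod_type, ← Finset.sum_neg_distrib, ← Finset.sum_add_distrib]
      refine Finset.sum_congr rfl fun t _ => ?_
      rw [hinner, hinner, neg_neg, ← sub_eq_add_neg, ← Finset.sum_sub_distrib]
      refine Finset.sum_congr rfl fun i _ => ?_
      rw [heval]
      ring
    rw [add_assoc _ _ (∑ l, ν l * _), h2, h3] at h1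
    rw [Finset.sum_sub_distrib]
    have h4 : ∑ t, w t (x t) =
        ∑ n, φ n (x (Sum.inl n)) + ∑ l, N l * (g l (x (Sum.inr l))).toReal := by
      rw [Fintype.sum_sum_type]
      rfl
    rw [h4]
    simp only at h1
    linarith
  have hγ0 : ∑ t, γ t = 0 := by
    by_contra hne
    have hpos : 0 < ‖∑ t, γ t‖ ^ 2 := by
      have := norm_pos_iff.2 hne
      positivity
    set A := ∑ t, (inner ℝ (γ t) (x₀.2 t) - w t (x₀.2 t)) with hA
    have h1 := main (-((|A + P| + 1) / ‖∑ t, γ t‖ ^ 2) • ∑ t, γ t) x₀.2 hcore.1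
    rw [inner_smul_right, real_inner_self_eq_norm_sq, neg_mul, div_mul_cancel₀ _ hpos.ne'] at h1
    linarith [neg_abs_le (A + P)]
  refine ⟨fun n => γ (Sum.inl n), fun l => γ (Sum.inr l), N, hN0, ?_, ?_⟩
  · rw [← hγ0, Fintype.sum_sum_type]
  · have : ∀ t, Nonempty (dom t) := fun t => ⟨⟨θs, (hdomr t).1⟩⟩
    have h1 := EReal.sum_iSup_le (X := fun t => dom t) Finset.univ
      (fun t x => inner ℝ (γ t) (x : Euc m) - w t x) (-P) fun x => by
        have := main 0 (fun t => x t) fun t => (x t).2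
        simpa using this
    rw [Fintype.sum_sum_type] at h1
    refine le_trans (add_le_add (Finset.sum_le_sum fun n _ => ?_)
      (Finset.sum_le_sum fun l _ => ?_)) h1
    · exact iSup_le fun θ => le_iSup (fun x : dom (Sum.inl n) =>
        ((inner ℝ (γ (Sum.inl n)) (x : Euc m) - w (Sum.inl n) x : ℝ) : EReal)) ⟨θ, mem_univ _⟩
    · rw [(hg l).conjugate.perspective_eq _ (hN0 l), (hg l).biconjugate_eq]
      refine iSup₂_le fun y hy => le_trans (le_of_eq ?_) (le_iSup (fun x : dom (Sum.inr l) =>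
        ((inner ℝ (γ (Sum.inr l)) (x : Euc m) - w (Sum.inr l) x : ℝ) : EReal)) ⟨y, hy⟩)
      rw [real_inner_comm]
      rfl

end Splitting

/-! ### The finite program as a saddle point problem -/

theorem EReal.coe_finsetSum_real {ι : Type*} (s : Finset ι) (f : ι → ℝ) :
    ((∑ i ∈ s, f i : ℝ) : EReal) = ∑ i ∈ s, (f i : EReal) := by
  classical
  induction s using Finset.induction_on with
  | empty => simp
  | insert i s hi ih => rw [Finset.sum_insert hi, Finset.sum_insert hi, EReal.coe_add, ih]

theorem IsSupAffineOn.iSup {E : Type*} [NormedAddCommGroup E] [NormedSpace ℝ E] {ι : Type*}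
    [Nonempty ι] {S : Set E} {F : ι → E → EReal} (h : ∀ i, IsSupAffineOn S (F i)) :
    IsSupAffineOn S (fun x => ⨆ i, F i x) := by
  choose A hne hA using h
  refine ⟨⋃ i, A i, ?_, fun x hx => ?_⟩
  · obtain ⟨a, ha⟩ := hne (Classical.arbitrary ι)
    exact ⟨a, mem_iUnion.2 ⟨_, ha⟩⟩
  · simp only [hA _ x hx, iSup_iUnion]

/-- The perspective of a finite convex function at `0` is its recession function. -/
theorem tendsto_inv_mul_apply_smul {V : Type*} [NormedAddCommGroup V] [InnerProductSpace ℝ V]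
    [CompleteSpace V] {f : V → ℝ} (hf : IsClosedConvexFn fun x => (f x : EReal)) (x : V) :
    Tendsto (fun t : ℝ => ((t⁻¹ * f (t • x) : ℝ) : EReal)) atTop
      (𝓝 (perspective (fun x => (f x : EReal)) x 0)) := by
  refine tendsto_order.2 ⟨fun a ha => ?_, fun b hb => ?_⟩
  · rw [hf.perspective_eq _ le_rfl, lt_biSup_iff] at ha
    obtain ⟨y, hy, hay⟩ := ha
    obtain ⟨r, hr1, hr2⟩ := EReal.lt_iff_exists_real_btwn.1 hay
    rw [EReal.coe_lt_coe_iff, zero_mul, sub_zero] at hr2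
    have h1 : Tendsto (fun t : ℝ => inner ℝ y x -
        t⁻¹ * (conjugate (fun x => (f x : EReal)) y).toReal) atTop (𝓝 (inner ℝ y x)) := by
      simpa using tendsto_const_nhds.sub (tendsto_inv_atTop_zero.mul_const
        ((conjugate (fun x => (f x : EReal)) y).toReal))
    filter_upwards [h1.eventually (lt_mem_nhds hr2), eventually_gt_atTop 0] with t ht ht0
    refine hr1.trans (EReal.coe_lt_coe_iff.2 (ht.trans_le ?_))
    have h2 := inner_sub_le_conjugate (fun x => (f x : EReal)) y (t • x)
    rw [← hf.1.coe_toReal_conjugate hy] at h2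
    norm_cast at h2
    rw [inner_smul_right] at h2
    have h3 := mul_le_mul_of_nonneg_left h2 (inv_nonneg.2 ht0.le)
    rw [mul_sub, inv_mul_cancel_left₀ ht0.ne'] at h3
    linarith
  · obtain ⟨r, hr1, hr2⟩ := EReal.lt_iff_exists_real_btwn.1 hb
    obtain ⟨s, hs1, hs2⟩ := EReal.lt_iff_exists_real_btwn.1 hr2
    rw [EReal.coe_lt_coe_iff] at hs1
    have h1 : Tendsto (fun t : ℝ => t⁻¹ * f 0 + r) atTop (𝓝 r) := by
      simpa using (tendsto_inv_atTop_zero.mul_const (f 0)).add_const r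
    filter_upwards [h1.eventually (gt_mem_nhds hs1), eventually_gt_atTop 0] with t ht ht0
    refine lt_trans (EReal.coe_lt_coe_iff.2 (lt_of_le_of_lt ?_ ht)) hs2
    have h2 := hf.le_add_smul 0 x ht0.le (le_refl (f 0 : EReal)) hr1.le
    rw [zero_add, EReal.coe_le_coe_iff] at h2
    have h3 := mul_le_mul_of_nonneg_left h2 (inv_nonneg.2 ht0.le)
    rw [mul_add, inv_mul_cancel_left₀ ht0.ne'] at h3
    linarith

namespace DROData

variable {m d I J K L : ℕ} (D : DROData m d I J K L)

/-- The assumptions on the data that concern neither integrability nor compactness. -/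
structure StandingAssumptions : Prop where
  indisc : D.IdentityOfIndiscernibles
  ref : D.DiscreteReference
  convex : D.ConvexityConditions
  slater : ∃ θ, IsSlaterPoint D.g θ
  eps_pos : 0 < D.eps

/-- The variables `(q, ξ)`. -/
abbrev PrimVar (d I J : ℕ) := (Fin I → Fin J → ℝ) × (Fin I → Fin J → Euc d)

/-- The function `ξ ↦ -ℓ_i(θ, ẑ_j + ξ)`. -/
noncomputable def negSaddle (i : Fin I) (j : Fin J) (θ : Euc m) (u : Euc d) : ℝ :=
  -D.saddle i θ (D.zhat j + u)

/-- The perspective of `ξ ↦ -ℓ_i(θ, ẑ_j + ξ)`. -/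
noncomputable def lossTerm (i : Fin I) (j : Fin J) (θ : Euc m) (q : ℝ) (ξ : Euc d) : EReal :=
  perspective (fun u => (D.negSaddle i j θ u : EReal)) ξ q

/-- The sum of the perspectives of `ξ ↦ -ℓ_i(θ, ẑ_j + ξ)`. -/
noncomputable def negLoss (θ : Euc m) (x : PrimVar d I J) : EReal :=
  ∑ i, ∑ j, D.lossTerm i j θ (x.1 i j) (x.2 i j)

/-- The pairs `(q, ξ)` that satisfy all constraints of the finite program except for the
transportation budget. -/
def baseSet : Set (PrimVar d I J) :=
  {x | (∀ i j, 0 ≤ x.1 i j) ∧ (∀ i j k, D.supportTerm k j (x.1 i j) (x.2 i j) ≤ 0) ∧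
    ∀ j, ∑ i, x.1 i j = D.p j}

/-- The total transportation cost of `(q, ξ)`. -/
noncomputable def totalCost (x : PrimVar d I J) : EReal :=
  ∑ i, ∑ j, D.costTerm j (x.1 i j) (x.2 i j)

/-- The pairs `(q, ξ)` that are feasible in the finite program. -/
def primSet : Set (PrimVar d I J) := {x ∈ D.baseSet | D.totalCost x ≤ (D.eps : EReal)}

/-- The pairs `(q, ξ)` without mass at infinity. -/
def finiteSet (d I J : ℕ) : Set (PrimVar d I J) := {x | ∀ i j, x.1 i j = 0 → x.2 i j = 0}

/-- The expectation of the saddle functions at the distribution defined by `(q, ξ)`. -/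
noncomputable def phi (θ : Euc m) (x : PrimVar d I J) : ℝ :=
  ∑ i, ∑ j, x.1 i j * D.saddle i θ (D.zhat j + (x.1 i j)⁻¹ • x.2 i j)

/-- The worst case of `phi` over the feasible pairs without mass at infinity. -/
noncomputable def worstCase (θ : Euc m) : EReal :=
  ⨆ x ∈ D.primSet ∩ finiteSet d I J, (D.phi θ x : EReal)

/-- The optimal value of the primal problem. -/
noncomputable def primValue : EReal := ⨅ θ ∈ D.feasSet, D.worstCase θ

/-- The pair in which the atoms are split evenly and nothing is transported. -/
noncomputable def center : PrimVar d I J := (fun _ j => D.p j / I, fun _ _ => 0)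

variable {D}

namespace StandingAssumptions

variable (hD : D.StandingAssumptions)
include hD

theorem isClosedConvexFn_negSaddle (i : Fin I) (j : Fin J) (θ : Euc m) :
    IsClosedConvexFn fun u => (D.negSaddle i j θ u : EReal) := by
  have h1 : IsClosedConvexFn fun z : Euc d => ((-D.saddle i θ z : ℝ) : EReal) :=
    isClosedConvexFn_coe (hD.convex.saddle_concave i θ).neg
  exact h1.translate (D.zhat j)

theorem isClosedConvexFn_support (k : Fin K) (j : Fin J) :
    IsClosedConvexFn fun u => D.f k (D.zhat j + u) :=
  (hD.convex.f_closedConvex k).translate _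

theorem cost_self (j : Fin J) : D.cost (D.zhat j) (D.zhat j) = 0 :=
  (hD.indisc _ (hD.ref.zhat_mem j) _ (hD.ref.zhat_mem j)).2 rfl

theorem isClosedConvexFn_cost (j : Fin J) :
    IsClosedConvexFn fun u => (D.cost (D.zhat j + u) (D.zhat j) : EReal) := by
  have h1 : IsClosedConvexFn fun z => (D.cost z (D.zhat j) : EReal) := by
    refine ⟨⟨fun z => lt_of_lt_of_le EReal.bot_lt_zero (EReal.coe_ennreal_nonneg _), D.zhat j, ?_⟩,
      hD.convex.cost_convex _, ?_⟩
    · simp [effDom, hD.cost_self j]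
    · have h2 : LowerSemicontinuous fun z => D.cost z (D.zhat j) :=
        hD.convex.cost_lsc.comp (g := fun z => (z, D.zhat j)) (by fun_prop)
      exact continuous_coe_ennreal_ereal.comp_lowerSemicontinuous h2
        fun a b h => EReal.coe_ennreal_le_coe_ennreal_iff.2 h
  exact h1.translate (D.zhat j)

theorem conjugate_saddleConj (i : Fin I) (j : Fin J) (v : WithLp 2 (Euc m × Euc d)) :
    conjugate (fun w : WithLp 2 (Euc m × Euc d) => D.saddleConj i w.fst (D.zhat j + w.snd)) v =
      conjugate (fun u => (D.negSaddle i j v.fst u : EReal)) v.snd := by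
  apply le_antisymm
  · refine iSup_le fun w => ?_
    refine le_trans ?_ (inner_sub_le_conjugate _ v.snd w.snd)
    have h1 : ((inner ℝ w.fst v.fst : ℝ) : EReal) - D.saddle i v.fst (D.zhat j + w.snd) ≤
        D.saddleConj i w.fst (D.zhat j + w.snd) :=
      inner_sub_le_conjugate (fun θ => (D.saddle i θ (D.zhat j + w.snd) : EReal)) w.fst v.fst
    refine (EReal.sub_le_sub le_rfl h1).trans (le_of_eq ?_)
    rw [WithLp.prod_inner_apply, negSaddle]
    norm_cast
    rw [real_inner_comm v.fst w.fst]
    change inner ℝ v.fst w.fst + inner ℝ v.snd w.snd - _ = _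
    ring
  · refine iSup_le fun u => ?_
    have hc : IsClosedConvexFn fun θ => (D.saddle i θ (D.zhat j + u) : EReal) :=
      isClosedConvexFn_coe (hD.convex.saddle_convex i _)
    have h1 : (D.saddle i v.fst (D.zhat j + u) : EReal) =
        ⨆ α, ((inner ℝ v.fst α : ℝ) : EReal) - D.saddleConj i α (D.zhat j + u) :=
      (congrFun hc.biconjugate_eq v.fst).symm
    have h2 : ((inner ℝ v.snd u : ℝ) : EReal) - (D.negSaddle i j v.fst u : EReal) =
        ((inner ℝ v.snd u : ℝ) : EReal) + D.saddle i v.fst (D.zhat j + u) := by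
      rw [negSaddle]
      norm_cast
      ring
    rw [h2, h1]
    apply EReal.add_le_of_forall_lt
    intro a ha b hb
    obtain ⟨α, hα⟩ := lt_iSup_iff.1 hb
    refine (add_le_add ha.le hα.le).trans (le_trans (le_of_eq ?_)
      (inner_sub_le_conjugate _ v (WithLp.toLp 2 (α, u))))
    rw [WithLp.prod_inner_apply]
    change _ = ((inner ℝ v.fst α + inner ℝ v.snd u : ℝ) : EReal) - D.saddleConj i α (D.zhat j + u)
    rw [EReal.coe_add, sub_eq_add_neg, sub_eq_add_neg, ← add_assoc,
      add_comm ((inner ℝ v.snd u : ℝ) : EReal)]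

theorem isClosedConvexFn_saddleConj (i : Fin I) (j : Fin J) :
    IsClosedConvexFn
      (fun w : WithLp 2 (Euc m × Euc d) => D.saddleConj i w.fst (D.zhat j + w.snd)) := by
  refine .of_isSupAffineOn ?_ ?_
  · have h1 : ∀ θ : Euc m, IsSupAffineOn univ fun w : WithLp 2 (Euc m × Euc d) =>
        ((innerSL ℝ θ w.fst : ℝ) : EReal) + (D.negSaddle i j θ w.snd : EReal) := fun θ => by
      refine IsSupAffineOn.add ⟨{((innerSL ℝ θ).comp (WithLp.fstL 2 ℝ (Euc m) (Euc d)), 0)},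
        singleton_nonempty _, fun w _ => ?_⟩
        ((hD.isClosedConvexFn_negSaddle i j θ).isSupAffineOn.comp
          (WithLp.sndL 2 ℝ (Euc m) (Euc d)) fun _ _ => mem_univ _)
      simp
    refine (congrArg (IsSupAffineOn univ) (funext fun w => ?_)).mp (IsSupAffineOn.iSup h1)
    refine iSup_congr fun θ => ?_
    simp only [innerSL_apply_apply, negSaddle]
    rw [real_inner_comm]
    norm_cast
  · have hc : IsClosedConvexFn fun θ => (D.saddle i θ (D.zhat j) : EReal) :=
      isClosedConvexFn_coe (hD.convex.saddle_convex i _)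
    obtain ⟨α, hα⟩ := hc.effDom_conjugate_nonempty
    refine ⟨WithLp.toLp 2 (α, 0), ?_⟩
    simpa [effDom, saddleConj] using hα

theorem saddleTerm_eq (i : Fin I) (j : Fin J) {q : ℝ} (hq : 0 ≤ q) (α : Euc m) (ξ : Euc d) :
    D.saddleTerm i j q α ξ =
      ⨆ θ : Euc m, ((inner ℝ α θ : ℝ) : EReal) + D.lossTerm i j θ q ξ := by
  rw [saddleTerm, (hD.isClosedConvexFn_saddleConj i j).perspective_eq _ hq]
  simp only [lossTerm, (hD.isClosedConvexFn_negSaddle i j _).perspective_eq _ hq]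
  apply le_antisymm
  · refine iSup₂_le fun v hv => ?_
    rw [effDom, mem_ofPred_eq, hD.conjugate_saddleConj] at hv
    rw [hD.conjugate_saddleConj, WithLp.prod_inner_apply]
    refine le_trans ?_ (le_iSup _ v.fst)
    have h1 := le_iSup₂ (f := fun (y : Euc d)
      (_ : y ∈ effDom (conjugate fun u => (D.negSaddle i j v.fst u : EReal))) =>
      ((inner ℝ y ξ - q * (conjugate (fun u => (D.negSaddle i j v.fst u : EReal)) y).toReal : ℝ) :
        EReal)) v.snd hv
    refine le_trans (le_of_eq ?_) (add_le_add le_rfl h1)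
    norm_cast
    rw [real_inner_comm v.fst α, add_sub_assoc]
    rfl
  · refine iSup_le fun θ => EReal.add_le_of_forall_lt fun a ha b hb => ?_
    obtain ⟨y, hy, hby⟩ := lt_biSup_iff.1 hb
    have h2 : (WithLp.toLp 2 (θ, y) : WithLp 2 (Euc m × Euc d)) ∈ effDom (conjugate
        fun w : WithLp 2 (Euc m × Euc d) => D.saddleConj i w.fst (D.zhat j + w.snd)) := by
      rw [effDom, mem_ofPred_eq, hD.conjugate_saddleConj]
      exact hy
    refine (add_le_add ha.le hby.le).trans (le_trans (le_of_eq ?_)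
      (le_iSup₂ (WithLp.toLp 2 (θ, y) : WithLp 2 (Euc m × Euc d)) h2))
    rw [hD.conjugate_saddleConj, WithLp.prod_inner_apply]
    norm_cast
    change inner ℝ α θ + (inner ℝ y ξ - _) = inner ℝ θ α + inner ℝ y ξ - _
    rw [real_inner_comm, add_sub_assoc]
    rfl

theorem bot_lt_lossTerm (i : Fin I) (j : Fin J) (θ : Euc m) {q : ℝ} (hq : 0 ≤ q) (ξ : Euc d) :
    ⊥ < D.lossTerm i j θ q ξ :=
  (hD.isClosedConvexFn_negSaddle i j θ).bot_lt_perspective ξ hq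

theorem bot_lt_saddleTerm (i : Fin I) (j : Fin J) {q : ℝ} (hq : 0 ≤ q) (α : Euc m) (ξ : Euc d) :
    ⊥ < D.saddleTerm i j q α ξ :=
  (hD.isClosedConvexFn_saddleConj i j).bot_lt_perspective _ hq

theorem bot_lt_feasTerm (l : Fin L) {ν : ℝ} (hν : 0 ≤ ν) (β : Euc m) :
    ⊥ < D.feasTerm l ν β :=
  (hD.convex.g_closedConvex l).conjugate.bot_lt_perspective _ hν

theorem inner_le_feasTerm (l : Fin L) {ν : ℝ} (hν : 0 ≤ ν) (β : Euc m) {θ : Euc m}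
    (hθ : θ ∈ D.feasSet) : ((inner ℝ β θ : ℝ) : EReal) ≤ D.feasTerm l ν β := by
  have hg := hD.convex.g_closedConvex l
  rw [feasTerm, hg.conjugate.perspective_eq _ hν, hg.biconjugate_eq]
  have h1 : D.g l θ ≤ 0 := hθ l
  refine le_trans ?_ (le_iSup₂ (f := fun (y : Euc m) (_ : y ∈ effDom (D.g l)) =>
    ((inner ℝ y β - ν * (D.g l y).toReal : ℝ) : EReal)) θ (lt_of_le_of_lt h1 (by simp)))
  rw [EReal.coe_le_coe_iff, real_inner_comm]
  have h2 := mul_nonneg hν (neg_nonneg.2 (EReal.toReal_nonpos h1))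
  linarith

theorem lossTerm_eq_coe (i : Fin I) (j : Fin J) (θ : Euc m) {q : ℝ} (hq : 0 ≤ q) {ξ : Euc d}
    (h : q = 0 → ξ = 0) :
    D.lossTerm i j θ q ξ = ((-(q * D.saddle i θ (D.zhat j + q⁻¹ • ξ)) : ℝ) : EReal) := by
  rcases hq.lt_or_eq with hq | rfl
  · rw [lossTerm, perspective, if_pos hq, negSaddle]
    norm_cast
    ring
  · rw [h rfl, lossTerm, (hD.isClosedConvexFn_negSaddle i j θ).perspective_zero_zero]
    simp

theorem negLoss_eq_coe (θ : Euc m) {x : PrimVar d I J} (hx : ∀ i j, 0 ≤ x.1 i j)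
    (hx' : x ∈ finiteSet d I J) : D.negLoss θ x = ((-D.phi θ x : ℝ) : EReal) := by
  have : D.negLoss θ x = ∑ i, ∑ j, ((-(x.1 i j * D.saddle i θ (D.zhat j +
      (x.1 i j)⁻¹ • x.2 i j)) : ℝ) : EReal) :=
    Finset.sum_congr rfl fun i _ => Finset.sum_congr rfl fun j _ =>
      hD.lossTerm_eq_coe i j θ (hx i j) (hx' i j)
  rw [this, phi]
  simp only [← Finset.sum_neg_distrib, EReal.coe_finsetSum_real]

end StandingAssumptions

end DROData

namespace DROData

variable {m d I J K L : ℕ} {D : DROData m d I J K L}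

/-- The pairs `(q, ξ)` with `q ≥ 0`. -/
def nonnegSet (d I J : ℕ) : Set (PrimVar d I J) := {x | ∀ i j, 0 ≤ x.1 i j}

theorem convex_nonnegSet : Convex ℝ (nonnegSet d I J) := fun _ hx _ hy _ _ ha hb _ i j =>
  add_nonneg (mul_nonneg ha (hx i j)) (mul_nonneg hb (hy i j))

theorem isClosed_nonnegSet : IsClosed (nonnegSet d I J) := by
  simp only [nonnegSet, ofPred_forall]
  exact isClosed_iInter fun i => isClosed_iInter fun j =>
    isClosed_le continuous_const (by fun_prop)

/-- The coordinate map `(q, ξ) ↦ (ξ_ij, q_ij)`. -/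
noncomputable def coordMap (i : Fin I) (j : Fin J) : PrimVar d I J →L[ℝ] Euc d × ℝ :=
  (((ContinuousLinearMap.proj j).comp (ContinuousLinearMap.proj i)).comp
    (ContinuousLinearMap.snd ℝ (Fin I → Fin J → ℝ) (Fin I → Fin J → Euc d))).prod
  (((ContinuousLinearMap.proj j).comp (ContinuousLinearMap.proj i)).comp
    (ContinuousLinearMap.fst ℝ (Fin I → Fin J → ℝ) (Fin I → Fin J → Euc d)))

theorem isSupAffineOn_perspective_coord {h : Euc d → EReal} (hh : IsClosedConvexFn h)
    (i : Fin I) (j : Fin J) :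
    IsSupAffineOn (nonnegSet d I J) fun x => perspective h (x.2 i j) (x.1 i j) :=
  hh.isSupAffineOn_perspective.comp (coordMap i j) fun _ hx => hx i j

theorem convex_finiteSet : Convex ℝ (finiteSet d I J ∩ nonnegSet d I J) := by
  rintro x ⟨hx, hx0⟩ y ⟨hy, hy0⟩ a b ha hb hab
  refine ⟨fun i j h => ?_, convex_nonnegSet hx0 hy0 ha hb hab⟩
  have h1 : a * x.1 i j + b * y.1 i j = 0 := h
  have h2 := mul_nonneg ha (hx0 i j)
  have h3 := mul_nonneg hb (hy0 i j)
  have h4 : a • x.2 i j = 0 := by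
    rcases mul_eq_zero.1 (show a * x.1 i j = 0 by linarith) with h | h
    · rw [h, zero_smul]
    · rw [hx i j h, smul_zero]
  have h5 : b • y.2 i j = 0 := by
    rcases mul_eq_zero.1 (show b * y.1 i j = 0 by linarith) with h | h
    · rw [h, zero_smul]
    · rw [hy i j h, smul_zero]
  change a • x.2 i j + b • y.2 i j = 0
  rw [h4, h5, add_zero]

namespace StandingAssumptions

variable (hD : D.StandingAssumptions)
include hD

theorem isSupAffineOn_supportTerm (i : Fin I) (j : Fin J) (k : Fin K) :
    IsSupAffineOn (nonnegSet d I J) fun x => D.supportTerm k j (x.1 i j) (x.2 i j) :=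
  isSupAffineOn_perspective_coord (hD.isClosedConvexFn_support k j) i j

theorem isSupAffineOn_totalCost : IsSupAffineOn (nonnegSet d I J) D.totalCost :=
  .sum _ fun i _ => .sum _ fun j _ =>
    isSupAffineOn_perspective_coord (hD.isClosedConvexFn_cost j) i j

theorem isSupAffineOn_negLoss (θ : Euc m) : IsSupAffineOn (nonnegSet d I J) (D.negLoss θ) :=
  .sum _ fun i _ => .sum _ fun j _ =>
    isSupAffineOn_perspective_coord (hD.isClosedConvexFn_negSaddle i j θ) i j

omit hD in
theorem baseSet_eq : D.baseSet = nonnegSet d I J ∩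
    ((⋂ i, ⋂ j, ⋂ k, {x | x ∈ nonnegSet d I J ∧
      D.supportTerm k j (x.1 i j) (x.2 i j) ≤ ((0 : ℝ) : EReal)}) ∩
    ⋂ j, {x | ∑ i, x.1 i j = D.p j}) := by
  ext x
  simp only [baseSet, nonnegSet, mem_ofPred_eq, mem_inter_iff, mem_iInter, EReal.coe_zero]
  constructor
  · rintro ⟨h1, h2, h3⟩
    exact ⟨h1, fun i j k => ⟨h1, h2 i j k⟩, h3⟩
  · rintro ⟨h1, h2, h3⟩
    exact ⟨h1, fun i j k => (h2 i j k).2, h3⟩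

theorem convex_baseSet : Convex ℝ D.baseSet := by
  rw [baseSet_eq]
  refine convex_nonnegSet.inter (.inter ?_ ?_)
  · exact convex_iInter fun i => convex_iInter fun j => convex_iInter fun k =>
      (hD.isSupAffineOn_supportTerm i j k).convex_le convex_nonnegSet 0
  · refine convex_iInter fun j x hx y hy a b ha hb hab => ?_
    have h1 : ∑ i, x.1 i j = D.p j := hx
    have h2 : ∑ i, y.1 i j = D.p j := hy
    change ∑ i, (a * x.1 i j + b * y.1 i j) = D.p j
    rw [Finset.sum_add_distrib, ← Finset.mul_sum, ← Finset.mul_sum, h1, h2, ← add_mul, hab, one_mul]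

theorem isClosed_baseSet : IsClosed D.baseSet := by
  rw [baseSet_eq]
  refine isClosed_nonnegSet.inter (.inter ?_ ?_)
  · exact isClosed_iInter fun i => isClosed_iInter fun j => isClosed_iInter fun k =>
      (hD.isSupAffineOn_supportTerm i j k).isClosed_le isClosed_nonnegSet 0
  · exact isClosed_iInter fun j => isClosed_eq (by fun_prop) continuous_const

omit hD in
theorem primSet_eq : D.primSet = D.baseSet ∩
    {x | x ∈ nonnegSet d I J ∧ D.totalCost x ≤ (D.eps : EReal)} := by
  ext x
  exact ⟨fun h => ⟨h.1, h.1.1, h.2⟩, fun h => ⟨h.1, h.2.2⟩⟩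

theorem convex_primSet : Convex ℝ D.primSet := by
  rw [primSet_eq]
  exact hD.convex_baseSet.inter (hD.isSupAffineOn_totalCost.convex_le convex_nonnegSet _)

theorem isClosed_primSet : IsClosed D.primSet := by
  rw [primSet_eq]
  exact hD.isClosed_baseSet.inter (hD.isSupAffineOn_totalCost.isClosed_le isClosed_nonnegSet _)

theorem convex_primSet_inter : Convex ℝ (D.primSet ∩ finiteSet d I J) := by
  have : D.primSet ∩ finiteSet d I J = D.primSet ∩ (finiteSet d I J ∩ nonnegSet d I J) := by
    ext x
    exact ⟨fun h => ⟨h.1, h.2, h.1.1.1⟩, fun h => ⟨h.1, h.2.1⟩⟩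
  rw [this]
  exact hD.convex_primSet.inter convex_finiteSet

theorem convex_baseSet_inter : Convex ℝ (D.baseSet ∩ finiteSet d I J) := by
  have : D.baseSet ∩ finiteSet d I J = D.baseSet ∩ (finiteSet d I J ∩ nonnegSet d I J) := by
    ext x
    exact ⟨fun h => ⟨h.1, h.2, h.1.1⟩, fun h => ⟨h.1, h.2.1⟩⟩
  rw [this]
  exact hD.convex_baseSet.inter convex_finiteSet

theorem concaveOn_phi (θ : Euc m) : ConcaveOn ℝ (D.baseSet ∩ finiteSet d I J) (D.phi θ) := by
  rw [← neg_convexOn_iff]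
  exact (hD.isSupAffineOn_negLoss θ).convexOn hD.convex_baseSet_inter
    (fun x hx => hx.1.1) fun x hx => hD.negLoss_eq_coe θ hx.1.1 hx.2

theorem convexOn_phi (x : PrimVar d I J) (hx : ∀ i j, 0 ≤ x.1 i j) :
    ConvexOn ℝ univ fun θ => D.phi θ x := by
  refine ⟨convex_univ, fun θ _ θ' _ a b ha hb hab => ?_⟩
  simp only [phi, smul_eq_mul, Finset.mul_sum, ← Finset.sum_add_distrib]
  refine Finset.sum_le_sum fun i _ => Finset.sum_le_sum fun j _ => ?_
  have := (hD.convex.saddle_convex i (D.zhat j + (x.1 i j)⁻¹ • x.2 i j)).2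
    (mem_univ θ) (mem_univ θ') ha hb hab
  refine (mul_le_mul_of_nonneg_left this (hx i j)).trans (le_of_eq ?_)
  simp only [smul_eq_mul]
  ring

theorem costTerm_nonneg (j : Fin J) {q : ℝ} (hq : 0 ≤ q) (ξ : Euc d) : 0 ≤ D.costTerm j q ξ := by
  rcases hq.lt_or_eq with hq | rfl
  · rw [costTerm, perspective, if_pos hq]
    exact EReal.mul_nonneg (by exact_mod_cast hq.le) (EReal.coe_ennreal_nonneg _)
  · rw [costTerm, (hD.isClosedConvexFn_cost j).perspective_eq _ le_rfl]
    refine le_trans ?_ (le_iSup₂ (0 : Euc d) ?_)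
    · simp
    · refine lt_of_le_of_lt (iSup_le fun u => ?_) (EReal.coe_lt_top 0)
      rw [inner_zero_left, EReal.coe_zero, zero_sub, EReal.neg_le_zero]
      exact EReal.coe_ennreal_nonneg _

theorem costTerm_zero_right (j : Fin J) {q : ℝ} (hq : 0 ≤ q) : D.costTerm j q 0 = 0 := by
  rcases hq.lt_or_eq with hq | rfl
  · rw [costTerm, perspective, if_pos hq]
    simp [hD.cost_self j]
  · exact (hD.isClosedConvexFn_cost j).perspective_zero_zero

theorem supportTerm_zero_right (k : Fin K) (j : Fin J) {q : ℝ} (hq : 0 ≤ q) :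
    D.supportTerm k j q 0 ≤ 0 := by
  rcases hq.lt_or_eq with hq | rfl
  · rw [supportTerm, perspective, if_pos hq, smul_zero, add_zero]
    exact EReal.mul_nonpos_iff.2 (Or.inl ⟨by exact_mod_cast hq.le, hD.ref.zhat_mem j k⟩)
  · exact (hD.isClosedConvexFn_support k j).perspective_zero_zero.le

theorem center_mem_baseSet : D.center ∈ D.baseSet := by
  have hI : (0 : ℝ) < I := by exact_mod_cast hD.convex.saddle_nonempty
  have h0 : ∀ j, 0 ≤ D.p j / I := fun j => div_nonneg (hD.ref.p_pos j).le hI.le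
  refine ⟨fun i j => h0 j, fun i j k => hD.supportTerm_zero_right k j (h0 j), fun j => ?_⟩
  simp only [center, Finset.sum_const, Finset.card_univ, Fintype.card_fin, nsmul_eq_mul]
  field_simp

theorem totalCost_center : D.totalCost D.center = 0 := by
  have hI : (0 : ℝ) < I := by exact_mod_cast hD.convex.saddle_nonempty
  exact Finset.sum_eq_zero fun i _ => Finset.sum_eq_zero fun j _ =>
    hD.costTerm_zero_right j (div_nonneg (hD.ref.p_pos j).le hI.le)

omit hD in
theorem center_mem_finiteSet : D.center ∈ finiteSet d I J := fun _ _ _ => rfl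

theorem center_mem_primSet : D.center ∈ D.primSet :=
  ⟨hD.center_mem_baseSet, by rw [hD.totalCost_center]; exact_mod_cast hD.eps_pos.le⟩

omit hD in
theorem mem_suppSet_add_smul {j : Fin J} {q : ℝ} (hq : 0 < q) {ξ : Euc d}
    (h : ∀ k, D.supportTerm k j q ξ ≤ 0) : D.zhat j + q⁻¹ • ξ ∈ D.suppSet := by
  intro k
  have h1 := h k
  rw [supportTerm, perspective, if_pos hq] at h1
  by_contra! hcon
  exact absurd h1 (not_le.2 (EReal.mul_pos (by exact_mod_cast hq) hcon))

theorem mem_suppSet_add_smul_of_zero {j : Fin J} {t : ℝ} (ht : 0 ≤ t) {ξ : Euc d}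
    (h : ∀ k, D.supportTerm k j 0 ξ ≤ 0) : D.zhat j + t • ξ ∈ D.suppSet := by
  intro k
  have h1 := (hD.isClosedConvexFn_support k j).le_add_smul 0 ξ ht (a := 0) (b := 0)
    (by simpa using hD.ref.zhat_mem j k) (h k)
  simpa using h1

theorem cost_add_smul_le {j : Fin J} {t b : ℝ} (ht : 0 ≤ t) {ξ : Euc d}
    (h : D.costTerm j 0 ξ ≤ b) :
    (D.cost (D.zhat j + t • ξ) (D.zhat j) : EReal) ≤ ((t * b : ℝ) : EReal) := by
  have h1 := (hD.isClosedConvexFn_cost j).le_add_smul 0 ξ ht (a := 0) (b := b)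
    (by simp [hD.cost_self j]) h
  simpa using h1

theorem convex_suppSet : Convex ℝ D.suppSet := by
  intro x hx y hy a b ha hb hab k
  have := (hD.convex.f_closedConvex k).2.1 (x := (x, 0)) (by simpa using hx k)
    (y := (y, 0)) (by simpa using hy k) ha hb hab
  simpa using this

theorem isClosed_suppSet : IsClosed D.suppSet := by
  simp only [suppSet, constraintSet, ofPred_forall]
  exact isClosed_iInter fun k => (hD.convex.f_closedConvex k).2.2.isClosed_preimage 0

theorem convex_feasSet : Convex ℝ D.feasSet := by
  intro x hx y hy a b ha hb hab k
  have := (hD.convex.g_closedConvex k).2.1 (x := (x, 0)) (by simpa using hx k)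
    (y := (y, 0)) (by simpa using hy k) ha hb hab
  simpa using this

theorem isClosed_feasSet : IsClosed D.feasSet := by
  simp only [feasSet, constraintSet, ofPred_forall]
  exact isClosed_iInter fun k => (hD.convex.g_closedConvex k).2.2.isClosed_preimage 0

/-- The transportation cost grows at least linearly on the support set. -/
theorem exists_linear_le_cost (j : Fin J) : ∃ κ : ℝ, 0 < κ ∧ ∀ u : Euc d,
    D.zhat j + u ∈ D.suppSet →
      ((κ * (‖u‖ - 1) : ℝ) : EReal) ≤ (D.cost (D.zhat j + u) (D.zhat j) : EReal) := by
  set T : Set (Euc d) := Metric.sphere 0 1 ∩ {u | D.zhat j + u ∈ D.suppSet} with hT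
  have hTc : IsCompact T := (isCompact_sphere 0 1).inter_right
    (hD.isClosed_suppSet.preimage (continuous_const.add continuous_id))
  obtain ⟨κ, hκ0, hκ⟩ : ∃ κ : ℝ, 0 < κ ∧ ∀ u ∈ T,
      (κ : EReal) ≤ (D.cost (D.zhat j + u) (D.zhat j) : EReal) := by
    rcases T.eq_empty_or_nonempty with h | h
    · exact ⟨1, one_pos, by simp [h]⟩
    obtain ⟨u₀, hu₀, hmin⟩ := (hD.isClosedConvexFn_cost j).2.2.lowerSemicontinuousOn T
      |>.exists_isMinOn h hTc
    have hpos : (0 : EReal) < (D.cost (D.zhat j + u₀) (D.zhat j) : EReal) := by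
      refine (EReal.coe_ennreal_nonneg _).lt_of_ne fun h0 => ?_
      have h1 : D.cost (D.zhat j + u₀) (D.zhat j) = 0 := by exact_mod_cast h0.symm
      have h2 := (hD.indisc _ hu₀.2 _ (hD.ref.zhat_mem j)).1 h1
      have h3 := hu₀.1
      rw [add_eq_left.1 h2] at h3
      simp at h3
    obtain ⟨κ, h1, h2⟩ := EReal.lt_iff_exists_real_btwn.1 hpos
    exact ⟨κ, by exact_mod_cast h1, fun u hu => h2.le.trans (hmin hu)⟩
  refine ⟨κ, hκ0, fun u hu => ?_⟩
  rcases lt_or_ge ‖u‖ 1 with h | h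
  · refine le_trans ?_ (EReal.coe_ennreal_nonneg _)
    exact_mod_cast mul_nonpos_of_nonneg_of_nonpos hκ0.le (by linarith)
  have hu0 : 0 < ‖u‖ := by linarith
  have hinv : ‖u‖⁻¹ ≤ 1 := inv_le_one_of_one_le₀ h
  have hmem : ‖u‖⁻¹ • u ∈ T := by
    refine ⟨by simp [norm_smul, hu0.ne'], ?_⟩
    have := hD.convex_suppSet (hD.ref.zhat_mem j) hu (sub_nonneg.2 hinv)
      (inv_nonneg.2 hu0.le) (by ring)
    rw [smul_add, ← add_assoc, ← add_smul] at this
    simpa using this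
  have h1 := hκ _ hmem
  rcases eq_or_ne (D.cost (D.zhat j + u) (D.zhat j)) ⊤ with ht | ht
  · simp [ht]
  lift D.cost (D.zhat j + u) (D.zhat j) to NNReal using ht with c hc
  have h2 := (hD.isClosedConvexFn_cost j).2.1 (x := (0, 0)) (by simp [hD.cost_self j])
    (y := (u, (c : ℝ))) (by
      change (D.cost (D.zhat j + u) (D.zhat j) : EReal) ≤ _
      rw [← hc]
      exact le_rfl) (sub_nonneg.2 hinv) (inv_nonneg.2 hu0.le) (by ring)
  simp only [Prod.smul_mk, smul_zero, Prod.mk_add_mk, zero_add, mem_ofPred_eq, smul_eq_mul] at h2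
  have h3 := h1.trans h2
  rw [EReal.coe_le_coe_iff, mul_zero, zero_add, le_inv_mul_iff₀ hu0] at h3
  have h4 : ((c : ℝ≥0∞) : EReal) = ((c : ℝ) : EReal) := rfl
  rw [h4, EReal.coe_le_coe_iff]
  linarith

theorem exists_linear_le_costTerm (j : Fin J) : ∃ κ : ℝ, 0 < κ ∧ ∀ (q : ℝ) (ξ : Euc d), 0 ≤ q →
    (∀ k, D.supportTerm k j q ξ ≤ 0) →
      ((κ * (‖ξ‖ - q) : ℝ) : EReal) ≤ D.costTerm j q ξ := by
  obtain ⟨κ, hκ0, hκ⟩ := hD.exists_linear_le_cost j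
  refine ⟨κ, hκ0, fun q ξ hq hs => ?_⟩
  rcases hq.lt_or_eq with hq | rfl
  · have h1 := hκ _ (mem_suppSet_add_smul hq hs)
    rw [costTerm, perspective, if_pos hq]
    refine le_trans (le_of_eq ?_) (mul_le_mul_of_nonneg_left h1 (by exact_mod_cast hq.le))
    rw [← EReal.coe_mul, norm_smul, norm_inv, Real.norm_of_nonneg hq.le]
    congr 1
    field_simp
  · rw [← EReal.le_of_forall_lt_iff_le]
    intro b hb
    have h1 : ∀ t : ℝ, 0 < t → κ * (t * ‖ξ‖ - 1) ≤ t * b := fun t ht => by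
      have h2 := (hκ _ (hD.mem_suppSet_add_smul_of_zero ht.le hs)).trans
        (hD.cost_add_smul_le ht.le hb.le)
      rw [EReal.coe_le_coe_iff, norm_smul, Real.norm_of_nonneg ht.le] at h2
      exact h2
    rw [EReal.coe_le_coe_iff, sub_zero]
    by_contra! hcon
    have h2 : 0 < κ * ‖ξ‖ - b := by linarith
    have h3 := h1 ((κ + 1) / (κ * ‖ξ‖ - b)) (by positivity)
    have h4 : (κ + 1) / (κ * ‖ξ‖ - b) * (κ * ‖ξ‖ - b) = κ + 1 := by field_simp
    nlinarith

theorem isCompact_primSet : IsCompact D.primSet := by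
  choose κ hκ0 hκ using hD.exists_linear_le_costTerm
  have hbox : IsCompact ((univ.pi fun _ : Fin I => univ.pi fun j : Fin J => Icc 0 (D.p j)) ×ˢ
      (univ.pi fun _ : Fin I => univ.pi fun j : Fin J =>
        Metric.closedBall (0 : Euc d) (D.eps / κ j + D.p j))) :=
    (isCompact_univ_pi fun _ => isCompact_univ_pi fun _ => isCompact_Icc).prod
      (isCompact_univ_pi fun _ => isCompact_univ_pi fun _ => isCompact_closedBall _ _)
  refine hbox.of_isClosed_subset hD.isClosed_primSet fun x hx => ?_
  have hq : ∀ i j, x.1 i j ≤ D.p j := fun i j => by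
    rw [← hx.1.2.2 j]
    exact Finset.single_le_sum (f := fun i => x.1 i j) (fun i _ => hx.1.1 i j) (Finset.mem_univ i)
  refine ⟨fun i _ j _ => ⟨hx.1.1 i j, hq i j⟩, fun i _ j _ => ?_⟩
  have h1 : D.costTerm j (x.1 i j) (x.2 i j) ≤ (D.eps : EReal) := by
    refine le_trans ?_ hx.2
    refine le_trans ?_ (Finset.single_le_sum (f := fun i => ∑ j, D.costTerm j (x.1 i j) (x.2 i j))
      (fun i _ => Finset.sum_nonneg fun j _ => hD.costTerm_nonneg j (hx.1.1 i j) _)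
      (Finset.mem_univ i))
    exact Finset.single_le_sum (f := fun j => D.costTerm j (x.1 i j) (x.2 i j))
      (fun j _ => hD.costTerm_nonneg j (hx.1.1 i j) _) (Finset.mem_univ j)
  have h2 := (hκ j _ (x.2 i j) (hx.1.1 i j) (hx.1.2.1 i j)).trans h1
  rw [EReal.coe_le_coe_iff, mul_comm, ← le_div_iff₀ (hκ0 j)] at h2
  rw [mem_closedBall_zero_iff]
  linarith [hq i j]

/-- The feasible pairs without mass at infinity suffice to compute the worst case. -/
theorem neg_negLoss_le_worstCase (θ : Euc m) {x : PrimVar d I J} (hx : x ∈ D.primSet) :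
    -D.negLoss θ x ≤ D.worstCase θ := by
  have hI : (0 : ℝ) < I := by exact_mod_cast hD.convex.saddle_nonempty
  rcases eq_or_ne (D.negLoss θ x) ⊤ with h | h
  · simp [h]
  have hb := ((hD.isSupAffineOn_negLoss θ).bot_lt hx.1.1).ne'
  lift D.negLoss θ x to ℝ using ⟨h, hb⟩ with r hr
  have hc := hD.negLoss_eq_coe θ hD.center_mem_baseSet.1 center_mem_finiteSet
  set rc := -D.phi θ D.center
  have key : ∀ t : ℝ, 0 < t → t ≤ 1 →
      ((-((1 - t) * r + t * rc) : ℝ) : EReal) ≤ D.worstCase θ := by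
    intro t ht ht1
    have h1 := ((hD.isSupAffineOn_negLoss θ).convex_epi convex_nonnegSet
      (x := (x, r)) ⟨hx.1.1, hr.ge⟩ (y := (D.center, rc))
      ⟨hD.center_mem_baseSet.1, hc.le⟩ (sub_nonneg.2 ht1) ht.le (by ring)).2
    have hmem := hD.convex_primSet hx hD.center_mem_primSet (sub_nonneg.2 ht1) ht.le (by ring)
    simp only [Prod.smul_mk, Prod.mk_add_mk, smul_eq_mul] at h1
    set y := (1 - t) • x + t • D.center with hy
    have hpos : ∀ i j, 0 < y.1 i j := fun i j => by
      change 0 < (1 - t) * x.1 i j + t * (D.p j / I)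
      have h2 := mul_nonneg (sub_nonneg.2 ht1) (hx.1.1 i j)
      have h3 := mul_pos ht (div_pos (hD.ref.p_pos j) hI)
      linarith
    have hfin : y ∈ finiteSet d I J := fun i j h => absurd h (hpos i j).ne'
    rw [hD.negLoss_eq_coe θ hmem.1.1 hfin, EReal.coe_le_coe_iff] at h1
    refine le_trans ?_ (le_iSup₂ (f := fun x (_ : x ∈ D.primSet ∩ finiteSet d I J) =>
      (D.phi θ x : EReal)) y ⟨hmem, hfin⟩)
    rw [EReal.coe_le_coe_iff]
    linarith
  rw [← EReal.coe_neg]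
  have hlim : Tendsto (fun t : ℝ => ((-((1 - t) * r + t * rc) : ℝ) : EReal)) (𝓝[>] 0)
      (𝓝 ((-r : ℝ) : EReal)) := by
    rw [EReal.tendsto_coe]
    have : Continuous fun t : ℝ => -((1 - t) * r + t * rc) := by fun_prop
    have h2 := this.tendsto 0
    simp only [sub_zero, one_mul, zero_mul, add_zero] at h2
    exact h2.mono_left nhdsWithin_le_nhds
  refine le_of_tendsto hlim ?_
  filter_upwards [Ioc_mem_nhdsGT one_pos] with t ht
  exact key t ht.1 ht.2

end StandingAssumptions

end DROData

namespace DROData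

variable {m d I J K L : ℕ} {D : DROData m d I J K L}

/-- The coordinate map `(q, ξ, α, β, ν) ↦ ((α_ij, ξ_ij), q_ij)`. -/
def saddleCoordMap (i : Fin I) (j : Fin J) :
    DualVar m d I J L →L[ℝ] WithLp 2 (Euc m × Euc d) × ℝ where
  toFun x := (WithLp.toLp 2 (x.alpha i j, x.xi i j), x.q i j)
  map_add' _ _ := rfl
  map_smul' _ _ := rfl
  cont := by
    unfold DualVar.alpha DualVar.xi DualVar.q
    fun_prop

/-- The coordinate map `(q, ξ, α, β, ν) ↦ (β_l, ν_l)`. -/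
def feasCoordMap (l : Fin L) : DualVar m d I J L →L[ℝ] Euc m × ℝ where
  toFun x := (x.beta l, x.nu l)
  map_add' _ _ := rfl
  map_smul' _ _ := rfl
  cont := by
    unfold DualVar.beta DualVar.nu
    fun_prop

namespace StandingAssumptions

variable (hD : D.StandingAssumptions)
include hD

/-- Finitely many feasible decisions can be beaten simultaneously up to any level below the
optimal value of the primal problem. -/
theorem exists_forall_le_phi {ι : Type*} [Fintype ι] (θ : ι → Euc m)
    (hθ : ∀ k, θ k ∈ D.feasSet) {a : ℝ} (ha : (a : EReal) < D.primValue) :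
    ∃ x ∈ D.primSet ∩ finiteSet d I J, ∀ k, a ≤ D.phi (θ k) x := by
  by_contra! hcon
  have hsub : D.primSet ∩ finiteSet d I J ⊆ D.baseSet ∩ finiteSet d I J :=
    fun x hx => ⟨hx.1.1, hx.2⟩
  have hc : ∀ k, ConvexOn ℝ (D.primSet ∩ finiteSet d I J) fun x => a - D.phi (θ k) x := fun k =>
    (convexOn_const a hD.convex_primSet_inter).sub
      ((hD.concaveOn_phi (θ k)).subset hsub hD.convex_primSet_inter)
  obtain ⟨μ, hμ0, hμ1, hμ⟩ := exists_weights_of_forall_exists_nonneg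
    (C := D.primSet ∩ finiteSet d I J)
    ⟨D.center, hD.center_mem_primSet, center_mem_finiteSet⟩ hc fun x hx => by
      obtain ⟨k, hk⟩ := hcon x hx
      exact ⟨k, by linarith⟩
  have hmem : ∑ k, μ k • θ k ∈ D.feasSet :=
    hD.convex_feasSet.sum_mem (fun k _ => hμ0 k) hμ1 fun k _ => hθ k
  have h1 : D.worstCase (∑ k, μ k • θ k) ≤ (a : EReal) := iSup₂_le fun x hx => by
    rw [EReal.coe_le_coe_iff]
    have h2 := (hD.convexOn_phi x hx.1.1.1).map_sum_le (t := Finset.univ) (p := θ)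
      (fun k _ => hμ0 k) hμ1 fun k _ => mem_univ _
    have h3 := hμ x hx
    simp only [mul_sub, Finset.sum_sub_distrib, ← Finset.sum_mul, hμ1, one_mul] at h3
    simp only [smul_eq_mul] at h2
    linarith
  exact absurd ha (not_lt.2 ((iInf₂_le _ hmem).trans h1))

/-- The minimax theorem over the compact set of feasible pairs. -/
theorem exists_primValue_le : ∃ x ∈ D.primSet, ∀ θ ∈ D.feasSet,
    D.primValue ≤ -D.negLoss θ x := by
  set T := {r : Euc m × ℝ // r.1 ∈ D.feasSet ∧ (r.2 : EReal) < D.primValue} with hT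
  set A : T → Set (PrimVar d I J) := fun r =>
    {x | x ∈ nonnegSet d I J ∧ D.negLoss r.1.1 x ≤ ((-r.1.2 : ℝ) : EReal)} with hA
  have hne : (D.primSet ∩ ⋂ r, A r).Nonempty := by
    by_contra! hcon
    obtain ⟨u, hu⟩ := hD.isCompact_primSet.elim_finite_subfamily_closed A
      (fun r => (hD.isSupAffineOn_negLoss _).isClosed_le isClosed_nonnegSet _) hcon
    have hbound : ∃ a : ℝ, (∀ r ∈ u, r.1.2 ≤ a) ∧ (u.Nonempty → (a : EReal) < D.primValue) := by
      rcases u.eq_empty_or_nonempty with h | h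
      · exact ⟨0, by simp [h], by simp [h]⟩
      · obtain ⟨r, hr, hmax⟩ := u.exists_max_image (fun r => r.1.2) h
        exact ⟨r.1.2, hmax, fun _ => r.2.2⟩
    obtain ⟨a, ha, ha'⟩ := hbound
    rcases u.eq_empty_or_nonempty with h | h
    · have : D.center ∈ D.primSet ∩ ⋂ r ∈ u, A r := ⟨hD.center_mem_primSet, by simp [h]⟩
      rw [hu] at this
      exact this
    · obtain ⟨x, hx, hxa⟩ := hD.exists_forall_le_phi (fun r : u => r.1.1.1)
        (fun r => r.1.2.1) (ha' h)
      have : x ∈ D.primSet ∩ ⋂ r ∈ u, A r := by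
        refine ⟨hx.1, mem_iInter₂.2 fun r hr => ⟨hx.1.1.1, ?_⟩⟩
        rw [hD.negLoss_eq_coe _ hx.1.1.1 hx.2, EReal.coe_le_coe_iff]
        have := hxa ⟨r, hr⟩
        simp only at this
        linarith [ha r hr]
      rw [hu] at this
      exact this
  obtain ⟨x, hx, hxA⟩ := hne
  refine ⟨x, hx, fun θ hθ => ?_⟩
  rw [← EReal.ge_of_forall_gt_iff_ge]
  intro a ha
  have h1 := (mem_iInter.1 hxA ⟨(θ, a), hθ, ha⟩).2
  rw [EReal.le_neg, ← EReal.coe_neg]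
  exact h1

theorem bot_lt_sum_saddleTerm {x : DualVar m d I J L} (hq : ∀ i j, 0 ≤ x.q i j) :
    ⊥ < ∑ i, ∑ j, D.saddleTerm i j (x.q i j) (x.alpha i j) (x.xi i j) := by
  rw [← Fintype.sum_prod_type']
  refine Finset.sum_induction _ (fun e : EReal => ⊥ < e)
    (fun a b ha hb => EReal.bot_lt_add_iff.2 ⟨ha, hb⟩) (by simp) fun p _ => ?_
  exact hD.bot_lt_saddleTerm p.1 p.2 (hq _ _) _ _

theorem bot_lt_sum_feasTerm {x : DualVar m d I J L} (hν : ∀ l, 0 ≤ x.nu l) :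
    ⊥ < ∑ l, D.feasTerm l (x.nu l) (x.beta l) :=
  Finset.sum_induction _ (fun e : EReal => ⊥ < e)
    (fun a b ha hb => EReal.bot_lt_add_iff.2 ⟨ha, hb⟩) (by simp)
    fun l _ => hD.bot_lt_feasTerm l (hν l) _

theorem progObjective_eq {x : DualVar m d I J L} (hq : ∀ i j, 0 ≤ x.q i j)
    (hν : ∀ l, 0 ≤ x.nu l) : D.progObjective x =
      -(∑ i, ∑ j, D.saddleTerm i j (x.q i j) (x.alpha i j) (x.xi i j) +
        ∑ l, D.feasTerm l (x.nu l) (x.beta l)) := by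
  rw [progObjective, EReal.neg_add (Or.inl (hD.bot_lt_sum_saddleTerm hq).ne')
    (Or.inr (hD.bot_lt_sum_feasTerm hν).ne')]

omit hD in
theorem mem_primSet_of_mem_progFeasible {x : DualVar m d I J L} (hx : x ∈ D.progFeasible) :
    ((x.q, x.xi) : PrimVar d I J) ∈ D.primSet :=
  ⟨⟨hx.1, hx.2.2.1, hx.2.2.2.1⟩, hx.2.2.2.2.2⟩

/-- Weak duality at a fixed decision. -/
theorem progObjective_le_neg_negLoss {x : DualVar m d I J L} (hx : x ∈ D.progFeasible)
    {θ : Euc m} (hθ : θ ∈ D.feasSet) :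
    D.progObjective x ≤ -D.negLoss θ (x.q, x.xi) := by
  rw [hD.progObjective_eq hx.1 hx.2.1, EReal.neg_le_neg_iff]
  have h1 : ∑ i, ∑ j, (((inner ℝ (x.alpha i j) θ : ℝ) : EReal) +
      D.lossTerm i j θ (x.q i j) (x.xi i j)) ≤
      ∑ i, ∑ j, D.saddleTerm i j (x.q i j) (x.alpha i j) (x.xi i j) :=
    Finset.sum_le_sum fun i _ => Finset.sum_le_sum fun j _ => by
      rw [hD.saddleTerm_eq i j (hx.1 i j)]
      exact le_iSup (fun θ => ((inner ℝ (x.alpha i j) θ : ℝ) : EReal) +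
        D.lossTerm i j θ (x.q i j) (x.xi i j)) θ
  have h2 : ∑ l, ((inner ℝ (x.beta l) θ : ℝ) : EReal) ≤
      ∑ l, D.feasTerm l (x.nu l) (x.beta l) :=
    Finset.sum_le_sum fun l _ => hD.inner_le_feasTerm l (hx.2.1 l) _ hθ
  refine le_trans (le_of_eq ?_) (add_le_add h1 h2)
  have h3 : ∑ i, ∑ j, inner ℝ (x.alpha i j) θ + ∑ l, inner ℝ (x.beta l) θ = (0 : ℝ) := by
    simp only [← sum_inner, ← inner_add_left]
    rw [hx.2.2.2.2.1, inner_zero_left]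
  simp only [Finset.sum_add_distrib, ← EReal.coe_finsetSum_real]
  rw [add_right_comm, ← EReal.coe_add, h3, EReal.coe_zero, zero_add]
  rfl

theorem progObjective_le_primValue {x : DualVar m d I J L} (hx : x ∈ D.progFeasible) :
    D.progObjective x ≤ D.primValue :=
  le_iInf₂ fun θ hθ => (hD.progObjective_le_neg_negLoss hx hθ).trans
    (hD.neg_negLoss_le_worstCase θ (mem_primSet_of_mem_progFeasible hx))

theorem tendsto_lossTerm (i : Fin I) (j : Fin J) (θ : Euc m) (ξ : Euc d) :
    Tendsto (fun t : ℝ => ((t⁻¹ * D.negSaddle i j θ (t • ξ) : ℝ) : EReal)) atTop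
      (𝓝 (D.lossTerm i j θ 0 ξ)) :=
  tendsto_inv_mul_apply_smul (hD.isClosedConvexFn_negSaddle i j θ) ξ

theorem concaveOn_negSaddle (i : Fin I) (j : Fin J) (u : Euc d) :
    ConcaveOn ℝ univ fun θ => D.negSaddle i j θ u :=
  (hD.convex.saddle_convex i _).neg

theorem lossTerm_ne_top (i : Fin I) (j : Fin J) {θ₀ : Euc m} {q : ℝ} (hq : 0 ≤ q) {ξ : Euc d}
    (h : D.lossTerm i j θ₀ q ξ ≠ ⊤) (θ : Euc m) : D.lossTerm i j θ q ξ ≠ ⊤ := by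
  rcases hq.lt_or_eq with hq | rfl
  · rw [hD.lossTerm_eq_coe i j θ hq.le fun h => absurd h hq.ne']
    exact EReal.coe_ne_top _
  intro htop
  obtain ⟨b, hb, -⟩ := EReal.lt_iff_exists_real_btwn.1 h.lt_top
  obtain ⟨r, -, hr⟩ := EReal.lt_iff_exists_real_btwn.1
    (hD.bot_lt_lossTerm i j ((2 : ℝ) • θ₀ - θ) (le_refl (0 : ℝ)) ξ)
  have h1 := (hD.tendsto_lossTerm i j θ₀ ξ).eventually (gt_mem_nhds hb)
  have h2 := (hD.tendsto_lossTerm i j ((2 : ℝ) • θ₀ - θ) ξ).eventually (lt_mem_nhds hr)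
  have h3 := (hD.tendsto_lossTerm i j θ ξ).eventually
    (lt_mem_nhds (show ((2 * b - r : ℝ) : EReal) < D.lossTerm i j θ 0 ξ by
      rw [htop]
      exact EReal.coe_lt_top _))
  obtain ⟨t, ⟨⟨ht1, ht2⟩, ht3⟩, ht0⟩ := (((h1.and h2).and h3).and (eventually_gt_atTop 0)).exists
  rw [EReal.coe_lt_coe_iff] at ht1 ht2 ht3
  have h4 := (hD.concaveOn_negSaddle i j (t • ξ)).2 (mem_univ θ)
    (mem_univ ((2 : ℝ) • θ₀ - θ)) (show (0 : ℝ) ≤ 1 / 2 by norm_num)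
    (show (0 : ℝ) ≤ 1 / 2 by norm_num) (by norm_num)
  have h5 : (1 / 2 : ℝ) • θ + (1 / 2 : ℝ) • ((2 : ℝ) • θ₀ - θ) = θ₀ := by
    rw [smul_sub, smul_smul]
    norm_num
  rw [h5] at h4
  simp only [smul_eq_mul] at h4
  have h6 := mul_le_mul_of_nonneg_left h4 (inv_nonneg.2 ht0.le)
  linarith

theorem convexOn_neg_toReal_lossTerm (i : Fin I) (j : Fin J) {q : ℝ} (hq : 0 ≤ q) {ξ : Euc d}
    (h : ∀ θ, D.lossTerm i j θ q ξ ≠ ⊤) :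
    ConvexOn ℝ univ fun θ => -(D.lossTerm i j θ q ξ).toReal := by
  rcases hq.lt_or_eq with hq | rfl
  · simp only [hD.lossTerm_eq_coe i j _ hq.le fun h => absurd h hq.ne', EReal.toReal_coe, neg_neg]
    exact (hD.convex.saddle_convex i _).smul hq.le
  refine ⟨convex_univ, fun θ _ θ' _ a b ha hb hab => ?_⟩
  have hlim : ∀ θ, Tendsto (fun t : ℝ => t⁻¹ * D.negSaddle i j θ (t • ξ)) atTop
      (𝓝 (D.lossTerm i j θ 0 ξ).toReal) := fun θ => by
    have h1 := hD.tendsto_lossTerm i j θ ξ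
    rw [← EReal.coe_toReal (h θ) (hD.bot_lt_lossTerm i j θ le_rfl ξ).ne'] at h1
    exact EReal.tendsto_coe.1 h1
  refine le_of_tendsto_of_tendsto (hlim _).neg
    (((hlim θ).neg.const_mul a).add ((hlim θ').neg.const_mul b)) ?_
  filter_upwards [eventually_gt_atTop 0] with t ht
  have h4 := (hD.concaveOn_negSaddle i j (t • ξ)).2 (mem_univ θ) (mem_univ θ') ha hb hab
  simp only [smul_eq_mul] at h4
  have h6 := mul_le_mul_of_nonneg_left h4 (inv_nonneg.2 ht.le)
  linarith

/-- A feasible pair extends to a feasible point of the finite program whose objective value is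
the infimum of the expectations over the feasible decisions. -/
theorem exists_extension {x : PrimVar d I J} (hx : x ∈ D.primSet) {P : ℝ}
    (hP : ∀ θ ∈ D.feasSet, (P : EReal) ≤ -D.negLoss θ x) :
    ∃ y ∈ D.progFeasible, (P : EReal) ≤ D.progObjective y := by
  obtain ⟨θs, hθs⟩ := hD.slater
  have hne : ∀ i j θ, D.lossTerm i j θ (x.1 i j) (x.2 i j) ≠ ⊤ := by
    intro i j θ
    refine hD.lossTerm_ne_top i j (hx.1.1 i j) (θ₀ := θs) (fun htop => ?_) θ
    have h1 := hP θs hθs.1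
    have h2 : D.negLoss θs x = ⊤ := by
      rw [negLoss, ← Fintype.sum_prod_type', ← Finset.add_sum_erase _ _ (Finset.mem_univ (i, j)),
        htop, EReal.top_add_of_ne_bot]
      refine ne_of_gt (Finset.sum_induction _ (fun e : EReal => ⊥ < e)
        (fun a b ha hb => EReal.bot_lt_add_iff.2 ⟨ha, hb⟩) (by simp) fun p _ => ?_)
      exact hD.bot_lt_lossTerm p.1 p.2 _ (hx.1.1 _ _) _
    rw [h2] at h1
    exact absurd h1 (not_le.2 (EReal.bot_lt_coe _))
  set φ : Fin I × Fin J → Euc m → ℝ := fun p θ =>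
    -(D.lossTerm p.1 p.2 θ (x.1 p.1 p.2) (x.2 p.1 p.2)).toReal with hφ
  have hφ' : ∀ i j θ, D.lossTerm i j θ (x.1 i j) (x.2 i j) = ((-φ (i, j) θ : ℝ) : EReal) :=
    fun i j θ => by
      rw [hφ, neg_neg, EReal.coe_toReal (hne i j θ) (hD.bot_lt_lossTerm i j θ (hx.1.1 i j) _).ne']
  obtain ⟨α, β, ν, hν, hsum, hle⟩ := exists_dual_solution φ
    (fun p => hD.convexOn_neg_toReal_lossTerm p.1 p.2 (hx.1.1 _ _) (hne p.1 p.2)) D.g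
    hD.convex.g_closedConvex hθs (P := P) fun θ hθ => by
      have h1 := hP θ hθ
      simp only [negLoss, hφ', ← EReal.coe_finsetSum_real, ← EReal.coe_neg] at h1
      rw [EReal.coe_le_coe_iff] at h1
      simp only [Finset.sum_neg_distrib, neg_neg] at h1
      rwa [Fintype.sum_prod_type]
  refine ⟨(x.1, x.2, fun i j => α (i, j), β, ν), ⟨hx.1.1, hν, hx.1.2.1, hx.1.2.2, ?_, hx.2⟩, ?_⟩
  · rw [Fintype.sum_prod_type] at hsum
    exact hsum
  · rw [hD.progObjective_eq (x := (x.1, x.2, fun i j => α (i, j), β, ν)) hx.1.1 hν, EReal.le_neg,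
      ← EReal.coe_neg]
    refine le_trans (add_le_add_left (le_of_eq ?_) _) hle
    rw [Fintype.sum_prod_type]
    refine Finset.sum_congr rfl fun i _ => Finset.sum_congr rfl fun j _ => ?_
    change D.saddleTerm i j (x.1 i j) (α (i, j)) (x.2 i j) = _
    rw [hD.saddleTerm_eq i j (hx.1.1 i j)]
    refine iSup_congr fun θ => ?_
    rw [hφ', ← EReal.coe_add, sub_eq_add_neg]

/-- The finite program attains the optimal value of the primal problem. -/
theorem exists_primValue_le_progObjective (hfin : D.primValue < ⊤) :
    ∃ y ∈ D.progFeasible, D.primValue ≤ D.progObjective y := by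
  obtain ⟨x, hx, hxP⟩ := hD.exists_primValue_le
  rcases eq_or_ne D.primValue ⊥ with h | h
  · refine ⟨(D.center.1, D.center.2, 0, 0, 0), ⟨hD.center_mem_baseSet.1, fun _ => le_rfl,
      hD.center_mem_baseSet.2.1, hD.center_mem_baseSet.2.2, ?_, hD.center_mem_primSet.2⟩, ?_⟩
    · simp [DualVar.alpha, DualVar.beta]
    · simp [h]
  · have h1 := EReal.coe_toReal hfin.ne h
    rw [← h1] at hxP ⊢
    exact hD.exists_extension hx hxP

theorem convex_progFeasible : Convex ℝ D.progFeasible := by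
  intro x hx y hy a b ha hb hab
  have h1 := hD.convex_primSet (mem_primSet_of_mem_progFeasible hx)
    (mem_primSet_of_mem_progFeasible hy) ha hb hab
  refine ⟨h1.1.1, fun l => add_nonneg (mul_nonneg ha (hx.2.1 l)) (mul_nonneg hb (hy.2.1 l)),
    h1.1.2.1, h1.1.2.2, ?_, h1.2⟩
  have h2 := hx.2.2.2.2.1
  have h3 := hy.2.2.2.2.1
  change ∑ i, ∑ j, (a • x.alpha i j + b • y.alpha i j) + ∑ l, (a • x.beta l + b • y.beta l) = 0
  calc _ = a • (∑ i, ∑ j, x.alpha i j + ∑ l, x.beta l) +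
      b • (∑ i, ∑ j, y.alpha i j + ∑ l, y.beta l) := by
        simp only [Finset.sum_add_distrib, smul_add, Finset.smul_sum]
        abel
    _ = 0 := by rw [h2, h3, smul_zero, smul_zero, add_zero]

/-- The points of the finite program with `q ≥ 0` and `ν ≥ 0`. -/
abbrev dualNonnegSet (m d I J L : ℕ) : Set (DualVar m d I J L) :=
  {x | (∀ i j, 0 ≤ x.q i j) ∧ ∀ l, 0 ≤ x.nu l}

omit hD in
theorem convex_dualNonnegSet : Convex ℝ (dualNonnegSet m d I J L) :=
  fun _ hx _ hy _ _ ha hb _ =>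
    ⟨fun i j => add_nonneg (mul_nonneg ha (hx.1 i j)) (mul_nonneg hb (hy.1 i j)),
      fun l => add_nonneg (mul_nonneg ha (hx.2 l)) (mul_nonneg hb (hy.2 l))⟩

theorem isSupAffineOn_progObjective : IsSupAffineOn (dualNonnegSet m d I J L) fun x =>
    ∑ i, ∑ j, D.saddleTerm i j (x.q i j) (x.alpha i j) (x.xi i j) +
      ∑ l, D.feasTerm l (x.nu l) (x.beta l) := by
  refine .add (.sum _ fun i _ => .sum _ fun j _ => ?_) (.sum _ fun l _ => ?_)
  · exact (hD.isClosedConvexFn_saddleConj i j).isSupAffineOn_perspective.comp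
      (saddleCoordMap i j) fun x hx => hx.1 i j
  · exact (hD.convex.g_closedConvex l).conjugate.isSupAffineOn_perspective.comp
      (feasCoordMap l) fun x hx => hx.2 l

theorem convex_hypograph : Convex ℝ {w : DualVar m d I J L × ℝ |
    w.1 ∈ D.progFeasible ∧ (w.2 : EReal) ≤ D.progObjective w.1} := by
  have hmem : ∀ x : DualVar m d I J L, x ∈ D.progFeasible → ∀ r : ℝ,
      ((r : EReal) ≤ D.progObjective x ↔
        ∑ i, ∑ j, D.saddleTerm i j (x.q i j) (x.alpha i j) (x.xi i j) +
          ∑ l, D.feasTerm l (x.nu l) (x.beta l) ≤ ((-r : ℝ) : EReal)) := fun x hx r => by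
    rw [hD.progObjective_eq hx.1 hx.2.1, EReal.le_neg, EReal.coe_neg]
  rintro ⟨x, r⟩ ⟨hx, hr⟩ ⟨y, s⟩ ⟨hy, hs⟩ a b ha hb hab
  have hxy := hD.convex_progFeasible hx hy ha hb hab
  refine ⟨hxy, (hmem _ hxy _).2 ?_⟩
  have := (hD.isSupAffineOn_progObjective.convex_epi convex_dualNonnegSet
    (x := (x, -r)) ⟨⟨hx.1, hx.2.1⟩, (hmem x hx r).1 hr⟩
    (y := (y, -s)) ⟨⟨hy.1, hy.2.1⟩, (hmem y hy s).1 hs⟩ ha hb hab).2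
  simp only [Prod.smul_mk, Prod.mk_add_mk, smul_eq_mul] at this ⊢
  convert this using 2
  ring

end StandingAssumptions

end DROData

/-! ### Expected losses over the ambiguity set -/

theorem EReal.coe_ennreal_sum' {ι : Type*} (s : Finset ι) (f : ι → ℝ≥0∞) :
    ((∑ i ∈ s, f i : ℝ≥0∞) : EReal) = ∑ i ∈ s, (f i : EReal) := by
  classical
  induction s using Finset.induction_on with
  | empty => simp
  | insert i s hi ih =>
    rw [Finset.sum_insert hi, Finset.sum_insert hi, EReal.coe_ennreal_add, ih]

/-- If the weighted sums of the elements chosen from nonempty sets are bounded by `B`, then so is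
the weighted sum of their suprema. -/
theorem sum_mul_sSup_le {ι : Type*} [Fintype ι] {p : ι → ℝ} (hp : ∀ j, 0 < p j)
    (hp1 : ∑ j, p j = 1) {A : ι → Set ℝ} (hA : ∀ j, (A j).Nonempty) {B : ℝ}
    (h : ∀ r : ι → ℝ, (∀ j, r j ∈ A j) → ∑ j, p j * r j ≤ B) :
    (∀ j, BddAbove (A j)) ∧ ∑ j, p j * sSup (A j) ≤ B := by
  classical
  choose r₀ hr₀ using hA
  constructor
  · intro j
    refine ⟨(B - ∑ k ∈ Finset.univ.erase j, p k * r₀ k) / p j, fun r hr => ?_⟩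
    rw [le_div_iff₀ (hp j)]
    have h1 := h (Function.update r₀ j r) fun k => by
      rcases eq_or_ne k j with rfl | hk
      · rwa [Function.update_self]
      · rw [Function.update_of_ne hk]
        exact hr₀ k
    rw [← Finset.add_sum_erase _ _ (Finset.mem_univ j), Function.update_self] at h1
    have h2 : ∑ k ∈ Finset.univ.erase j, p k * Function.update r₀ j r k =
        ∑ k ∈ Finset.univ.erase j, p k * r₀ k :=
      Finset.sum_congr rfl fun k hk => by rw [Function.update_of_ne (Finset.ne_of_mem_erase hk)]
    linarith
  · refine le_of_forall_pos_le_add fun δ hδ => ?_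
    have h1 : ∀ j, ∃ r ∈ A j, sSup (A j) - δ < r := fun j =>
      exists_lt_of_lt_csSup ⟨_, hr₀ j⟩ (by linarith)
    choose r hr hr' using h1
    have h2 : ∑ j, p j * (sSup (A j) - δ) ≤ ∑ j, p j * r j :=
      Finset.sum_le_sum fun j _ => mul_le_mul_of_nonneg_left (hr' j).le (hp j).le
    simp only [mul_sub, Finset.sum_sub_distrib, ← Finset.sum_mul, hp1, one_mul] at h2
    linarith [h r hr]

theorem ENNReal.ofReal_add_ofReal_neg_le {a s c : ℝ} (h : a ≤ s + c) (hc : 0 ≤ c) :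
    ENNReal.ofReal a + ENNReal.ofReal (-s) ≤
      ENNReal.ofReal (-a) + ENNReal.ofReal s + ENNReal.ofReal c := by
  have e : ∀ x : ℝ, ENNReal.ofReal x = ENNReal.ofReal (max x 0) := fun x => by simp
  rw [e a, e (-s), e (-a), e s, ← ENNReal.ofReal_add (by positivity) (by positivity),
    ← ENNReal.ofReal_add (by positivity) (by positivity),
    ← ENNReal.ofReal_add (by positivity) hc]
  refine ENNReal.ofReal_le_ofReal ?_
  have h1 : max a 0 - max (-a) 0 = a := max_zero_sub_max_neg_zero_eq_self a
  have h2 : max s 0 - max (-s) 0 = s := max_zero_sub_max_neg_zero_eq_self s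
  linarith

namespace DROData

variable {m d I J K L : ℕ} {D : DROData m d I J K L}

/-- The discrete distribution `∑_ij w_ij δ_{z_ij}`. -/
noncomputable def gridDist (w : Fin I → Fin J → ℝ) (z : Fin I → Fin J → Euc d) :
    Measure (Euc d) :=
  ∑ j, ∑ i, ENNReal.ofReal (w i j) • Measure.dirac (z i j)

theorem lintegral_gridDist (w : Fin I → Fin J → ℝ) (z : Fin I → Fin J → Euc d)
    (h : Euc d → ℝ≥0∞) :
    ∫⁻ u, h u ∂(gridDist w z) = ∑ j, ∑ i, ENNReal.ofReal (w i j) * h (z i j) := by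
  simp [gridDist, lintegral_finsetSum_measure, lintegral_smul_measure]

theorem expectation_gridDist {w : Fin I → Fin J → ℝ} (hw : ∀ i j, 0 ≤ w i j)
    (z : Fin I → Fin J → Euc d) (h : Euc d → ℝ) :
    expectation (gridDist w z) h = ((∑ j, ∑ i, w i j * h (z i j) : ℝ) : EReal) := by
  have key : ∀ h : Euc d → ℝ, ((∫⁻ u, ENNReal.ofReal (h u) ∂(gridDist w z) : ℝ≥0∞) : EReal) =
      ((∑ j, ∑ i, w i j * max (h (z i j)) 0 : ℝ) : EReal) := by
    intro h
    rw [lintegral_gridDist]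
    simp only [EReal.coe_ennreal_sum', EReal.coe_finsetSum_real, EReal.coe_ennreal_mul,
      EReal.coe_ennreal_ofReal, max_eq_left (hw _ _), EReal.coe_mul]
  rw [expectation, key, key fun u => -h u, ← EReal.coe_sub, ← Finset.sum_sub_distrib]
  simp only [← Finset.sum_sub_distrib, ← mul_sub]
  congr 1
  refine Finset.sum_congr rfl fun j _ => Finset.sum_congr rfl fun i _ => ?_
  congr 1
  rcases le_total 0 (h (z i j)) with h0 | h0
  · rw [max_eq_left h0, max_eq_right (by linarith), sub_zero]
  · rw [max_eq_right h0, max_eq_left (by linarith)]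
    ring

namespace StandingAssumptions

variable (hD : D.StandingAssumptions)
include hD

theorem measurable_cost : Measurable fun w : Euc d × Euc d => D.cost w.1 w.2 :=
  hD.convex.cost_lsc.measurable

theorem measurable_loss (θ : Euc m) : Measurable (D.loss θ) := by
  unfold loss
  refine Measurable.iSup fun i => Continuous.measurable ?_
  rw [← continuousOn_univ]
  exact (hD.convex.saddle_concave i θ).continuousOn isOpen_univ

omit hD in
theorem saddle_le_loss (i : Fin I) (θ : Euc m) (z : Euc d) : D.saddle i θ z ≤ D.loss θ z :=
  le_ciSup (f := fun i => D.saddle i θ z) (finite_range _).bddAbove i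

theorem loss_le {θ : Euc m} {z : Euc d} {r : ℝ} (h : ∀ i, D.saddle i θ z ≤ r) :
    D.loss θ z ≤ r := by
  have : Nonempty (Fin I) := ⟨⟨0, hD.convex.saddle_nonempty⟩⟩
  exact ciSup_le h

/-- Discrete distributions that arise from splitting the atoms within the transportation budget
belong to the ambiguity set. -/
theorem gridDist_mem_ambiguitySet {w : Fin I → Fin J → ℝ} (hw : ∀ i j, 0 ≤ w i j)
    (hsum : ∀ j, ∑ i, w i j = D.p j) {z : Fin I → Fin J → Euc d}
    (hz : ∀ i j, 0 < w i j → z i j ∈ D.suppSet)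
    (hcost : ∑ j, ∑ i, ENNReal.ofReal (w i j) * D.cost (z i j) (D.zhat j) ≤
      ENNReal.ofReal D.eps) :
    gridDist w z ∈ D.ambiguitySet := by
  have hsum' : ∀ j, ∑ i, ENNReal.ofReal (w i j) = ENNReal.ofReal (D.p j) := fun j => by
    rw [← ENNReal.ofReal_sum_of_nonneg fun i _ => hw i j, hsum]
  refine ⟨⟨?_⟩, ?_, ?_⟩
  · have h1 : gridDist w z univ = ∑ j, ENNReal.ofReal (D.p j) := by
      simp [gridDist, hsum']
    rw [h1, ← ENNReal.ofReal_sum_of_nonneg fun j _ => (hD.ref.p_pos j).le, hD.ref.p_sum,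
      ENNReal.ofReal_one]
  · simp only [gridDist, Measure.coe_finsetSum, Finset.sum_apply, Measure.smul_apply, smul_eq_mul]
    refine Finset.sum_eq_zero fun j _ => Finset.sum_eq_zero fun i _ => ?_
    rcases (hw i j).lt_or_eq with h | h
    · rw [Measure.dirac_apply' _ hD.isClosed_suppSet.measurableSet.compl]
      simp [hz i j h]
    · simp [← h]
  · set π : Measure (Euc d × Euc d) :=
      ∑ j, ∑ i, ENNReal.ofReal (w i j) • Measure.dirac (z i j, D.zhat j) with hπ
    have hmap : ∀ {g : Euc d × Euc d → Euc d}, Measurable g → π.map g =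
        ∑ j, ∑ i, ENNReal.ofReal (w i j) • Measure.dirac (g (z i j, D.zhat j)) := by
      intro g hg
      ext s hs
      rw [Measure.map_apply hg hs]
      simp only [hπ, Measure.coe_finsetSum, Finset.sum_apply, Measure.smul_apply,
        Measure.dirac_apply' _ hs, Measure.dirac_apply' _ (hg hs)]
      rfl
    have hmem : π ∈ couplings (gridDist w z) D.refDist := by
      refine ⟨hmap measurable_fst, ?_⟩
      rw [hmap measurable_snd, refDist]
      refine Finset.sum_congr rfl fun j _ => ?_
      simp only []
      rw [← Finset.sum_smul, hsum']
    refine (iInf₂_le π hmem).trans (le_trans (le_of_eq ?_) hcost)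
    simp [hπ, lintegral_finsetSum_measure, lintegral_smul_measure]

theorem coe_cost_eq_costTerm {j : Fin J} {q : ℝ} (hq : 0 ≤ q) {ξ : Euc d} (h : q = 0 → ξ = 0) :
    ((ENNReal.ofReal q * D.cost (D.zhat j + q⁻¹ • ξ) (D.zhat j) : ℝ≥0∞) : EReal) =
      D.costTerm j q ξ := by
  rcases hq.lt_or_eq with hq | rfl
  · rw [costTerm, perspective, if_pos hq, EReal.coe_ennreal_mul, EReal.coe_ennreal_ofReal,
      max_eq_left hq.le]
  · rw [h rfl, hD.costTerm_zero_right j le_rfl]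
    simp

theorem sum_le_eps_of_le_costTerm {c : Fin I → Fin J → ℝ≥0∞} {x : PrimVar d I J}
    (hx : D.totalCost x ≤ (D.eps : EReal))
    (hc : ∀ i j, (c i j : EReal) ≤ D.costTerm j (x.1 i j) (x.2 i j)) :
    ∑ j, ∑ i, c i j ≤ ENNReal.ofReal D.eps := by
  rw [Finset.sum_comm, ← EReal.coe_ennreal_le_coe_ennreal_iff, EReal.coe_ennreal_ofReal,
    max_eq_left hD.eps_pos.le]
  simp only [EReal.coe_ennreal_sum']
  exact (Finset.sum_le_sum fun i _ => Finset.sum_le_sum fun j _ => hc i j).trans hx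

/-- The distribution defined by a feasible pair belongs to the ambiguity set. -/
theorem gridDist_mem_of_mem_primSet {x : PrimVar d I J}
    (hx : x ∈ D.primSet ∩ finiteSet d I J) :
    gridDist x.1 (fun i j => D.zhat j + (x.1 i j)⁻¹ • x.2 i j) ∈ D.ambiguitySet :=
  hD.gridDist_mem_ambiguitySet hx.1.1.1 hx.1.1.2.2
    (fun i j h => mem_suppSet_add_smul h (hx.1.1.2.1 i j))
    (hD.sum_le_eps_of_le_costTerm hx.1.2 fun i j =>
      (hD.coe_cost_eq_costTerm (hx.1.1.1 i j) (hx.2 i j)).le)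

omit hD in
theorem phi_le_expectedLoss (θ : Euc m) {x : PrimVar d I J} (hx : ∀ i j, 0 ≤ x.1 i j) :
    (D.phi θ x : EReal) ≤
      D.expectedLoss (gridDist x.1 fun i j => D.zhat j + (x.1 i j)⁻¹ • x.2 i j) θ := by
  rw [expectedLoss, expectation_gridDist hx, EReal.coe_le_coe_iff, phi, Finset.sum_comm]
  exact Finset.sum_le_sum fun j _ => Finset.sum_le_sum fun i _ =>
    mul_le_mul_of_nonneg_left (saddle_le_loss i θ _) (hx i j)

/-- A Lagrange multiplier of the transportation budget. -/
theorem exists_budget_multiplier (θ : Euc m) {S : ℝ} (hS : D.worstCase θ ≤ S) :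
    ∃ lam : ℝ, 0 ≤ lam ∧ ∀ x ∈ D.baseSet ∩ finiteSet d I J, D.totalCost x < ⊤ →
      D.phi θ x ≤ S + lam * ((D.totalCost x).toReal - D.eps) := by
  have hcb : ∀ x ∈ D.baseSet, D.totalCost x ≠ ⊥ := fun x hx =>
    (hD.isSupAffineOn_totalCost.bot_lt hx.1).ne'
  set Y : Set (PrimVar d I J) := {x ∈ D.baseSet ∩ finiteSet d I J | D.totalCost x < ⊤} with hY
  have hYc : Convex ℝ Y := by
    intro x hx y hy a b ha hb hab
    refine ⟨hD.convex_baseSet_inter hx.1 hy.1 ha hb hab, ?_⟩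
    have h1 := (hD.isSupAffineOn_totalCost.convex_epi convex_nonnegSet
      (x := (x, (D.totalCost x).toReal)) ⟨hx.1.1.1, EReal.le_coe_toReal hx.2.ne⟩
      (y := (y, (D.totalCost y).toReal)) ⟨hy.1.1.1, EReal.le_coe_toReal hy.2.ne⟩ ha hb hab).2
    exact lt_of_le_of_lt h1 (EReal.coe_lt_top _)
  have hcenter : D.center ∈ Y := ⟨⟨hD.center_mem_baseSet, center_mem_finiteSet⟩, by
    rw [hD.totalCost_center]
    exact EReal.zero_lt_top⟩
  have h1 : ConvexOn ℝ Y fun x => (D.totalCost x).toReal - D.eps :=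
    (hD.isSupAffineOn_totalCost.convexOn hYc (fun x hx => hx.1.1.1) fun x hx =>
      (EReal.coe_toReal hx.2.ne (hcb x hx.1.1)).symm).sub (concaveOn_const _ hYc)
  have h2 : ConvexOn ℝ Y fun x => S - D.phi θ x :=
    (convexOn_const S hYc).sub ((hD.concaveOn_phi θ).subset (fun x hx => hx.1) hYc)
  obtain ⟨a, b, ha, hb, hab, hpos⟩ := exists_pair_weights_of_forall_nonneg_or ⟨_, hcenter⟩ h1 h2
    fun x hx => by
      rcases le_total 0 ((D.totalCost x).toReal - D.eps) with h | h
      · exact Or.inl h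
      · refine Or.inr (sub_nonneg.2 ?_)
        have h3 : x ∈ D.primSet := ⟨hx.1.1, by
          rw [← EReal.coe_toReal hx.2.ne (hcb x hx.1.1), EReal.coe_le_coe_iff]
          linarith⟩
        have h4 := (le_iSup₂ (f := fun x (_ : x ∈ D.primSet ∩ finiteSet d I J) =>
          (D.phi θ x : EReal)) x ⟨h3, hx.1.2⟩).trans hS
        exact_mod_cast h4
  have hb0 : 0 < b := by
    refine hb.lt_of_ne fun h0 => ?_
    have h3 := hpos _ hcenter
    rw [← h0, hD.totalCost_center, EReal.toReal_zero] at h3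
    have h4 : a = 1 := by linarith
    rw [h4] at h3
    linarith [hD.eps_pos]
  refine ⟨a / b, div_nonneg ha hb, fun x hx hxt => ?_⟩
  have h3 := div_nonneg (hpos x ⟨hx, hxt⟩) hb
  have h4 : (a * ((D.totalCost x).toReal - D.eps) + b * (S - D.phi θ x)) / b =
      a / b * ((D.totalCost x).toReal - D.eps) + (S - D.phi θ x) := by
    field_simp
  rw [h4] at h3
  linarith

/-- The Lagrangian bound on the losses at the points of the support set. -/
theorem exists_lagrangian_bound (θ : Euc m) {S : ℝ} (hS : D.worstCase θ ≤ S) :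
    ∃ (lam : ℝ) (s : Euc d → ℝ), 0 ≤ lam ∧ Measurable s ∧
      (∀ z ∈ D.suppSet, ∀ j, D.cost z (D.zhat j) ≠ ⊤ →
        D.loss θ z ≤ s (D.zhat j) + lam * (D.cost z (D.zhat j)).toReal) ∧
      ∑ j, D.p j * s (D.zhat j) ≤ S - lam * D.eps := by
  classical
  obtain ⟨lam, hlam, hmul⟩ := hD.exists_budget_multiplier θ hS
  set A : Euc d → Set ℝ := fun v => {r | ∃ i, ∃ z ∈ D.suppSet, D.cost z v ≠ ⊤ ∧
    r = D.saddle i θ z - lam * (D.cost z v).toReal} with hA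
  have hAne : ∀ j, (A (D.zhat j)).Nonempty := fun j =>
    ⟨_, ⟨0, hD.convex.saddle_nonempty⟩, D.zhat j, hD.ref.zhat_mem j, by
      rw [hD.cost_self]
      exact ENNReal.zero_ne_top, rfl⟩
  obtain ⟨hbdd, hsum⟩ := sum_mul_sSup_le hD.ref.p_pos hD.ref.p_sum hAne
    (B := S - lam * D.eps) fun r hr => by
      choose ι z hz hcz hrz using hr
      set x : PrimVar d I J := (fun i j => if i = ι j then D.p j else 0,
        fun i j => if i = ι j then D.p j • (z j - D.zhat j) else 0) with hx
      have hp := hD.ref.p_pos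
      have hpt : ∀ j, D.zhat j + (D.p j)⁻¹ • D.p j • (z j - D.zhat j) = z j := fun j => by
        rw [smul_smul, inv_mul_cancel₀ (hp j).ne', one_smul, add_sub_cancel]
      have hq : ∀ i j, 0 ≤ x.1 i j := fun i j => by
        simp only [hx]
        split_ifs
        exacts [(hp j).le, le_rfl]
      have hfin : x ∈ finiteSet d I J := fun i j h => by
        simp only [hx] at h ⊢
        split_ifs at h ⊢
        · exact absurd h (hp j).ne'
        · rfl
      have hbase : x ∈ D.baseSet := by
        refine ⟨hq, fun i j k => ?_, fun j => by simp [hx]⟩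
        simp only [hx]
        split_ifs with h
        · rw [supportTerm, perspective, if_pos (hp j), hpt]
          exact EReal.mul_nonpos_iff.2 (Or.inl ⟨by exact_mod_cast (hp j).le, hz j k⟩)
        · exact hD.supportTerm_zero_right k j le_rfl
      have hcost : D.totalCost x = ((∑ j, D.p j * (D.cost (z j) (D.zhat j)).toReal : ℝ) :
          EReal) := by
        rw [totalCost, Finset.sum_comm, EReal.coe_finsetSum_real]
        refine Finset.sum_congr rfl fun j _ => ?_
        rw [Finset.sum_eq_single (ι j)]
        · simp only [hx, if_true]
          rw [costTerm, perspective, if_pos (hp j), hpt, EReal.coe_mul,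
            EReal.coe_ennreal_toReal (hcz j)]
        · intro i _ hi
          simp only [hx, if_neg hi]
          exact hD.costTerm_zero_right j le_rfl
        · simp
      have hphi : D.phi θ x = ∑ j, D.p j * D.saddle (ι j) θ (z j) := by
        rw [phi, Finset.sum_comm]
        refine Finset.sum_congr rfl fun j _ => ?_
        rw [Finset.sum_eq_single (ι j)]
        · simp only [hx, if_true, hpt]
        · intro i _ hi
          simp [hx, if_neg hi]
        · simp
      have h1 := hmul x ⟨hbase, hfin⟩ (by rw [hcost]; exact EReal.coe_lt_top _)
      rw [hcost, hphi, EReal.toReal_coe, mul_sub, Finset.mul_sum] at h1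
      have h2 : ∑ j, D.p j * r j = ∑ j, D.p j * D.saddle (ι j) θ (z j) -
          ∑ j, lam * (D.p j * (D.cost (z j) (D.zhat j)).toReal) := by
        rw [← Finset.sum_sub_distrib]
        refine Finset.sum_congr rfl fun j _ => ?_
        rw [hrz j]
        ring
      linarith
  set s : Euc d → ℝ := fun y =>
    ∑ v ∈ Finset.univ.image D.zhat, if y = v then sSup (A v) else 0 with hs
  have hsz : ∀ j, s (D.zhat j) = sSup (A (D.zhat j)) := fun j => by
    simp [hs]
  refine ⟨lam, s, hlam, ?_, fun z hz j hcz => ?_, by simpa only [hsz] using hsum⟩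
  · refine Finset.measurable_fun_sum _ fun v _ => ?_
    exact Measurable.ite (measurableSet_singleton v) measurable_const measurable_const
  · rw [hsz]
    refine hD.loss_le fun i => ?_
    have := le_csSup (hbdd j) ⟨i, z, hz, hcz, rfl⟩
    linarith

/-- The worst-case expectation over the ambiguity set is bounded by the supremum over the feasible
pairs. -/
theorem expectedLoss_le_worstCase {Q : Measure (Euc d)} (hQ : Q ∈ D.ambiguitySet) (θ : Euc m) :
    D.expectedLoss Q θ ≤ D.worstCase θ := by
  rcases eq_or_ne (D.worstCase θ) ⊤ with htop | htop
  · rw [htop]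
    exact le_top
  have hbot : D.worstCase θ ≠ ⊥ := ne_of_gt <| lt_of_lt_of_le (EReal.bot_lt_coe _)
    (le_iSup₂ (f := fun x (_ : x ∈ D.primSet ∩ finiteSet d I J) => (D.phi θ x : EReal)) D.center
      ⟨hD.center_mem_primSet, center_mem_finiteSet⟩)
  obtain ⟨lam, s, hlam, hsm, hloss, hsum⟩ :=
    hD.exists_lagrangian_bound θ (EReal.le_coe_toReal htop)
  set S := (D.worstCase θ).toReal with hS
  rw [← EReal.coe_toReal htop hbot, ← EReal.le_of_forall_lt_iff_le]
  intro r hr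
  rw [EReal.coe_lt_coe_iff] at hr
  set η := (r - S) / (lam + 1) with hη
  have hη0 : 0 < η := div_pos (by linarith) (by linarith)
  have hηr : lam * η ≤ r - S := by
    have h1 : η * (lam + 1) = r - S := div_mul_cancel₀ _ (by linarith)
    nlinarith
  obtain ⟨π, hπ, hcost⟩ : ∃ π ∈ couplings Q D.refDist,
      ∫⁻ w, D.cost w.1 w.2 ∂π < ENNReal.ofReal (D.eps + η) := by
    have h1 : transportDiscrepancy D.cost Q D.refDist < ENNReal.ofReal (D.eps + η) :=
      lt_of_le_of_lt hQ.2.2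
        ((ENNReal.ofReal_lt_ofReal_iff (by linarith [hD.eps_pos])).2 (by linarith))
    simp only [transportDiscrepancy, iInf_lt_iff] at h1
    obtain ⟨π, hπ, h2⟩ := h1
    exact ⟨π, hπ, h2⟩
  have hml := hD.measurable_loss θ
  have hae1 : ∀ᵐ w ∂π, w.1 ∈ D.suppSet := by
    have h1 : π.map Prod.fst (D.suppSet)ᶜ = 0 := by rw [hπ.1]; exact hQ.2.1
    rw [Measure.map_apply measurable_fst hD.isClosed_suppSet.measurableSet.compl] at h1
    exact h1
  have hae2 : ∀ᵐ w ∂π, w.2 ∈ range D.zhat := by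
    have h1 : π.map Prod.snd (range D.zhat)ᶜ = 0 := by
      rw [hπ.2, refDist, Measure.finsetSum_apply]
      refine Finset.sum_eq_zero fun j _ => ?_
      rw [Measure.smul_apply, Measure.dirac_apply' _ (finite_range _).measurableSet.compl]
      simp
    rw [Measure.map_apply measurable_snd (finite_range _).measurableSet.compl] at h1
    exact h1
  have hae3 : ∀ᵐ w ∂π, D.cost w.1 w.2 < ⊤ :=
    ae_lt_top hD.measurable_cost (hcost.trans ENNReal.ofReal_lt_top).ne
  have hineq : ∫⁻ w, (ENNReal.ofReal (D.loss θ w.1) + ENNReal.ofReal (-s w.2)) ∂π ≤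
      ∫⁻ w, ((ENNReal.ofReal (-D.loss θ w.1) + ENNReal.ofReal (s w.2)) +
        ENNReal.ofReal lam * D.cost w.1 w.2) ∂π := by
    refine lintegral_mono_ae ?_
    filter_upwards [hae1, hae2, hae3] with w h1 h2 h3
    obtain ⟨j, hj⟩ := h2
    rw [← hj] at h3 ⊢
    have h4 := hloss w.1 h1 j h3.ne
    have h5 : 0 ≤ lam * (D.cost w.1 (D.zhat j)).toReal := mul_nonneg hlam ENNReal.toReal_nonneg
    conv_rhs => rw [← ENNReal.ofReal_toReal h3.ne, ← ENNReal.ofReal_mul hlam]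
    exact ENNReal.ofReal_add_ofReal_neg_le h4 h5
  have hmf : ∀ {h : Euc d → ℝ}, Measurable h →
      ∫⁻ w, ENNReal.ofReal (h w.1) ∂π = ∫⁻ z, ENNReal.ofReal (h z) ∂Q := fun {h} hh => by
    rw [← hπ.1, lintegral_map hh.ennreal_ofReal measurable_fst]
  have hms : ∀ {h : Euc d → ℝ}, Measurable h →
      ∫⁻ w, ENNReal.ofReal (h w.2) ∂π = ∫⁻ z, ENNReal.ofReal (h z) ∂D.refDist := fun {h} hh => by
    rw [← hπ.2, lintegral_map hh.ennreal_ofReal measurable_snd]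
  have hgrid : D.refDist = gridDist (fun (_ : Fin 1) j => D.p j) fun _ j => D.zhat j := by
    simp [refDist, gridDist]
  have href : ∀ h : Euc d → ℝ, ∫⁻ z, ENNReal.ofReal (h z) ∂D.refDist ≠ ⊤ := fun h => by
    rw [hgrid, lintegral_gridDist]
    simp [ENNReal.sum_eq_top, ENNReal.mul_eq_top]
  have hexp := expectation_gridDist (I := 1) (w := fun _ j => D.p j)
    (fun _ j => (hD.ref.p_pos j).le) (fun _ j => D.zhat j) s
  rw [← hgrid, expectation] at hexp
  simp only [Finset.univ_unique, Finset.sum_const, Finset.card_singleton, one_smul] at hexp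
  have hmln : Measurable fun z => -D.loss θ z := hml.neg
  have hsmn : Measurable fun z => -s z := hsm.neg
  have m1 : Measurable fun w : Euc d × Euc d => ENNReal.ofReal (D.loss θ w.1) :=
    (hml.comp measurable_fst).ennreal_ofReal
  have m2 : Measurable fun w : Euc d × Euc d => ENNReal.ofReal (-D.loss θ w.1) :=
    (hmln.comp measurable_fst).ennreal_ofReal
  have m3 : Measurable fun w : Euc d × Euc d => ENNReal.ofReal (s w.2) :=
    (hsm.comp measurable_snd).ennreal_ofReal
  have m4 : Measurable fun w : Euc d × Euc d =>
      ENNReal.ofReal (-D.loss θ w.1) + ENNReal.ofReal (s w.2) := m2.add m3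
  rw [lintegral_add_left m1, lintegral_add_left m4, lintegral_add_left m2,
    lintegral_const_mul _ hD.measurable_cost, hmf hml, hmf hmln, hms hsm, hms hsmn] at hineq
  have hineq' := hineq.trans (add_le_add le_rfl (mul_le_mul' le_rfl hcost.le))
  rw [← ENNReal.ofReal_mul hlam] at hineq'
  rw [expectedLoss, expectation]
  have hsp := href s
  have hsn := href fun z => -s z
  generalize ∫⁻ z, ENNReal.ofReal (s z) ∂D.refDist = sp at *
  generalize ∫⁻ z, ENNReal.ofReal (-s z) ∂D.refDist = sn at *
  generalize ∫⁻ z, ENNReal.ofReal (D.loss θ z) ∂Q = A at *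
  generalize ∫⁻ z, ENNReal.ofReal (-D.loss θ z) ∂Q = B at *
  rcases eq_or_ne B ⊤ with rfl | hB
  · simp
  have hA : A ≠ ⊤ := by
    refine ne_top_of_le_ne_top ?_ (le_self_add.trans hineq')
    simp [hB, hsp]
  lift A to NNReal using hA
  lift B to NNReal using hB
  lift sp to NNReal using hsp
  lift sn to NNReal using hsn
  rw [ENNReal.ofReal] at hineq'
  norm_cast at hineq'
  rw [← NNReal.coe_le_coe] at hineq'
  simp only [NNReal.coe_add, Real.coe_toNNReal _
    (mul_nonneg hlam (by linarith [hD.eps_pos] : 0 ≤ D.eps + η))] at hineq'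
  simp only [EReal.coe_nnreal_eq_coe_real] at hexp ⊢
  norm_cast at hexp ⊢
  nlinarith

end StandingAssumptions

end DROData

/-! ### Discrete distributions and their limits -/

theorem EReal.sum_ne_top {ι : Type*} {s : Finset ι} {f : ι → EReal} (h : ∀ i ∈ s, f i ≠ ⊤) :
    ∑ i ∈ s, f i ≠ ⊤ := by
  classical
  induction s using Finset.induction_on with
  | empty => simp
  | insert i s hi ih =>
    rw [Finset.sum_insert hi]
    exact EReal.add_ne_top (h i (Finset.mem_insert_self _ _))
      (ih fun k hk => h k (Finset.mem_insert_of_mem hk))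

theorem EReal.tendsto_sum {ι α : Type*} {s : Finset ι} {F : Filter α} {f : ι → α → EReal}
    {l : ι → EReal} (hl : ∀ i ∈ s, l i ≠ ⊤) (h : ∀ i ∈ s, Tendsto (f i) F (𝓝 (l i))) :
    Tendsto (fun n => ∑ i ∈ s, f i n) F (𝓝 (∑ i ∈ s, l i)) := by
  classical
  induction s using Finset.induction_on with
  | empty => simpa using tendsto_const_nhds
  | insert i s hi ih =>
    have h1 := hl i (Finset.mem_insert_self _ _)
    have h2 : ∑ i ∈ s, l i ≠ ⊤ := EReal.sum_ne_top fun k hk => hl k (Finset.mem_insert_of_mem hk)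
    simp only [Finset.sum_insert hi]
    exact (EReal.continuousAt_add (p := (l i, ∑ i ∈ s, l i)) (Or.inl h1) (Or.inr h2)).tendsto.comp
      ((h i (Finset.mem_insert_self _ _)).prodMk_nhds
        (ih (fun k hk => hl k (Finset.mem_insert_of_mem hk))
          fun k hk => h k (Finset.mem_insert_of_mem hk)))

theorem EReal.neg_sum_of_bot_lt {ι : Type*} {s : Finset ι} {f : ι → EReal}
    (h : ∀ i ∈ s, ⊥ < f i) : -∑ i ∈ s, f i = ∑ i ∈ s, -f i ∧ ⊥ < ∑ i ∈ s, f i := by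
  classical
  induction s using Finset.induction_on with
  | empty => simp
  | insert i s hi ih =>
    obtain ⟨h1, h2⟩ := ih fun k hk => h k (Finset.mem_insert_of_mem hk)
    have h3 := h i (Finset.mem_insert_self _ _)
    rw [Finset.sum_insert hi, Finset.sum_insert hi]
    exact ⟨by rw [EReal.neg_add (Or.inl h3.ne') (Or.inr h2.ne'), sub_eq_add_neg, h1],
      EReal.bot_lt_add_iff.2 ⟨h3, h2⟩⟩

theorem EReal.coe_iSup_of_finite {ι : Type*} [Finite ι] [Nonempty ι] (f : ι → ℝ) :
    ((⨆ i, f i : ℝ) : EReal) = ⨆ i, (f i : EReal) := by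
  apply le_antisymm
  · obtain ⟨i, hi⟩ := exists_eq_ciSup_of_finite (f := f)
    rw [← hi]
    exact le_iSup (fun i => (f i : EReal)) i
  · exact iSup_le fun i => EReal.coe_le_coe_iff.2 (le_ciSup (finite_range f).bddAbove i)

theorem tendsto_iSup_of_fintype {ι α β : Type*} [Fintype ι] {F : Filter α} [CompleteLattice β]
    [TopologicalSpace β] [ContinuousSup β] {f : ι → α → β} {l : ι → β}
    (h : ∀ i, Tendsto (f i) F (𝓝 (l i))) :
    Tendsto (fun t => ⨆ i, f i t) F (𝓝 (⨆ i, l i)) := by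
  simp only [← Finset.sup_univ_eq_iSup]
  exact Tendsto.finset_sup_nhds_apply fun i _ => h i

namespace DualVar

variable {m d I J L : ℕ} (x : DualVar m d I J L)

theorem sum_posIdx {M : Type*} [AddCommMonoid M] (j : Fin J) (f : Fin I → M) :
    ∑ i ∈ x.posIdx j, f i = ∑ i, if 0 < x.q i j then f i else 0 := by
  classical
  rw [← Finset.sum_filter]
  exact Finset.sum_congr (by ext; simp [posIdx]) fun _ _ => rfl

theorem sum_infIdx {M : Type*} [AddCommMonoid M] (j : Fin J) (f : Fin I → M) :
    ∑ i ∈ x.infIdx j, f i =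
      ∑ i, open Classical in if x.q i j = 0 ∧ x.xi i j ≠ 0 then f i else 0 := by
  classical
  rw [← Finset.sum_filter]
  exact Finset.sum_congr (by ext; simp [infIdx]) fun _ _ => rfl

theorem mem_infIdx {i : Fin I} {j : Fin J} : i ∈ x.infIdx j ↔ x.q i j = 0 ∧ x.xi i j ≠ 0 := by
  simp [infIdx]

end DualVar

namespace DROData

variable {m d I J K L : ℕ} (D : DROData m d I J K L)

open Classical in
/-- The weights of the distributions that approximate a feasible point with mass at infinity. -/
noncomputable def seqWeight (x : DualVar m d I J L) (n : ℕ) (i : Fin I) (j : Fin J) : ℝ :=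
  if 0 < x.q i j then x.q i j * (1 - ((x.infIdx j).card : ℝ) / n)
  else if x.xi i j ≠ 0 then D.p j / n else 0

/-- The atoms of the distributions that approximate a feasible point with mass at infinity. -/
noncomputable def seqPoint (x : DualVar m d I J L) (n : ℕ) (i : Fin I) (j : Fin J) : Euc d :=
  if 0 < x.q i j then D.zhat j + (x.q i j)⁻¹ • x.xi i j
  else D.zhat j + ((n : ℝ) / D.p j) • x.xi i j

open Classical in
/-- The limits of the contributions of the atoms to the expected loss. -/
noncomputable def limTerm (x : DualVar m d I J L) (θ : Euc m) (i : Fin I) (j : Fin J) : EReal :=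
  if 0 < x.q i j then
    ((x.q i j * D.loss θ (D.zhat j + (x.q i j)⁻¹ • x.xi i j) : ℝ) : EReal)
  else if x.xi i j ≠ 0 then ⨆ k, -D.lossTerm k j θ 0 (x.xi i j) else 0

/-- The limit of the expected losses under `seqDist`. -/
noncomputable def limLoss (x : DualVar m d I J L) (θ : Euc m) : EReal :=
  ∑ j, ∑ i, D.limTerm x θ i j

variable {D}

theorem starDist_eq_gridDist {x : DualVar m d I J L} (hq : ∀ i j, 0 ≤ x.q i j) :
    D.starDist x = gridDist x.q fun i j => D.zhat j + (x.q i j)⁻¹ • x.xi i j := by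
  rw [starDist, gridDist]
  refine Finset.sum_congr rfl fun j _ => ?_
  rw [x.sum_posIdx]
  refine Finset.sum_congr rfl fun i _ => ?_
  split_ifs with h
  · rfl
  · rw [le_antisymm (not_lt.1 h) (hq i j)]
    simp

theorem seqDist_eq_gridDist {x : DualVar m d I J L} (hq : ∀ i j, 0 ≤ x.q i j) (n : ℕ) :
    D.seqDist x n = gridDist (D.seqWeight x n) (D.seqPoint x n) := by
  classical
  rw [seqDist, gridDist]
  refine Finset.sum_congr rfl fun j _ => ?_
  rw [x.sum_posIdx, x.sum_infIdx, ← Finset.sum_add_distrib]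
  refine Finset.sum_congr rfl fun i _ => ?_
  rcases (hq i j).lt_or_eq with h | h
  · simp [seqWeight, seqPoint, h, h.ne']
  · by_cases h' : x.xi i j = 0 <;> simp [seqWeight, seqPoint, ← h, h']

theorem gridDist_compl_image (w : Fin I → Fin J → ℝ) (z : Fin I → Fin J → Euc d) :
    ∃ s : Finset (Euc d), gridDist w z (s : Set (Euc d))ᶜ = 0 := by
  classical
  refine ⟨Finset.univ.image fun k : Fin I × Fin J => z k.1 k.2, ?_⟩
  simp only [gridDist, Measure.coe_finsetSum, Finset.sum_apply, Measure.smul_apply, smul_eq_mul]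
  refine Finset.sum_eq_zero fun j _ => Finset.sum_eq_zero fun i _ => ?_
  rw [Measure.dirac_apply' _ (Finset.measurableSet _).compl]
  simp

namespace StandingAssumptions

variable (hD : D.StandingAssumptions)
include hD

theorem costTerm_lt_top {x : PrimVar d I J} (hx : x ∈ D.primSet) (i : Fin I) (j : Fin J) :
    D.costTerm j (x.1 i j) (x.2 i j) < ⊤ := by
  have h0 : ∀ i j, 0 ≤ D.costTerm j (x.1 i j) (x.2 i j) := fun i j =>
    hD.costTerm_nonneg j (hx.1.1 i j) _
  refine lt_of_le_of_lt ?_ (EReal.coe_lt_top D.eps)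
  refine le_trans ?_ hx.2
  refine le_trans ?_ (Finset.single_le_sum (f := fun i => ∑ j, D.costTerm j (x.1 i j) (x.2 i j))
    (fun i _ => Finset.sum_nonneg fun j _ => h0 i j) (Finset.mem_univ i))
  exact Finset.single_le_sum (f := fun j => D.costTerm j (x.1 i j) (x.2 i j))
    (fun j _ => h0 i j) (Finset.mem_univ j)

omit hD in
theorem sum_seqWeight {x : DualVar m d I J L} (hq : ∀ i j, 0 ≤ x.q i j)
    (hp : ∀ j, ∑ i, x.q i j = D.p j) (n : ℕ) (j : Fin J) : ∑ i, D.seqWeight x n i j = D.p j := by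
  classical
  have h1 : ∀ i, D.seqWeight x n i j = x.q i j * (1 - ((x.infIdx j).card : ℝ) / n) +
      if x.q i j = 0 ∧ x.xi i j ≠ 0 then D.p j / n else 0 := fun i => by
    rcases (hq i j).lt_or_eq with h | h
    · simp [seqWeight, h, h.ne']
    · by_cases h' : x.xi i j = 0 <;> simp [seqWeight, ← h, h']
  simp only [h1, Finset.sum_add_distrib, ← Finset.sum_mul, hp]
  rw [← Finset.sum_filter, Finset.sum_const]
  have h2 : Finset.univ.filter (fun i => x.q i j = 0 ∧ x.xi i j ≠ 0) = x.infIdx j := by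
    ext; simp [x.mem_infIdx]
  rw [h2, nsmul_eq_mul]
  ring

theorem seqDist_mem_ambiguitySet {x : DualVar m d I J L} (hx : x ∈ D.progFeasible) {n : ℕ}
    (hn : ∀ j, (x.infIdx j).card < n) : D.seqDist x n ∈ D.ambiguitySet := by
  have hx' := mem_primSet_of_mem_progFeasible hx
  have hq := hx.1
  have hw : ∀ j, 0 ≤ 1 - ((x.infIdx j).card : ℝ) / n := fun j => by
    rw [sub_nonneg]
    exact div_le_one_of_le₀ (by exact_mod_cast (hn j).le) (Nat.cast_nonneg n)
  have hp := hD.ref.p_pos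
  rw [seqDist_eq_gridDist hq]
  refine hD.gridDist_mem_ambiguitySet (fun i j => ?_) (sum_seqWeight hq hx.2.2.2.1 n)
    (fun i j _ => ?_) (hD.sum_le_eps_of_le_costTerm hx'.2 fun i j => ?_)
  · unfold seqWeight
    split_ifs
    exacts [mul_nonneg (hq i j) (hw j), div_nonneg (hp j).le (Nat.cast_nonneg n), le_rfl]
  · unfold seqPoint
    split_ifs with h
    · exact mem_suppSet_add_smul h (hx.2.2.1 i j)
    · refine hD.mem_suppSet_add_smul_of_zero (div_nonneg (Nat.cast_nonneg n) (hp j).le) fun k => ?_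
      have := hx.2.2.1 i j k
      rwa [le_antisymm (not_lt.1 h) (hq i j)] at this
  · change _ ≤ D.costTerm j (x.q i j) (x.xi i j)
    unfold seqPoint seqWeight
    rcases (hq i j).lt_or_eq with h | h
    · rw [if_pos h, if_pos h, ← hD.coe_cost_eq_costTerm (hq i j) fun h' => absurd h' h.ne']
      rw [EReal.coe_ennreal_le_coe_ennreal_iff]
      refine mul_le_mul' (ENNReal.ofReal_le_ofReal (mul_le_of_le_one_right h.le ?_)) le_rfl
      rw [sub_le_self_iff]
      positivity
    · rw [← h, if_neg (lt_irrefl _), if_neg (lt_irrefl _)]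
      split_ifs with h'
      · have h1 := hD.costTerm_lt_top hx' i j
        have h2 := hD.costTerm_nonneg j (hq i j) (x.xi i j)
        simp only [← h] at h1 h2
        lift D.costTerm j 0 (x.xi i j) to ℝ using ⟨h1.ne, (lt_of_lt_of_le EReal.bot_lt_zero h2).ne'⟩
          with b hb
        have h3 := hD.cost_add_smul_le (t := n / D.p j)
          (div_nonneg (Nat.cast_nonneg n) (hp j).le) hb.ge
        have hn0 : (0 : ℝ) < n := by exact_mod_cast (Nat.zero_le _).trans_lt (hn j)
        have hpn : 0 ≤ D.p j / n := div_nonneg (hp j).le hn0.le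
        rw [EReal.coe_ennreal_mul, EReal.coe_ennreal_ofReal, max_eq_left hpn]
        refine (mul_le_mul_of_nonneg_left h3 (EReal.coe_nonneg.2 hpn)).trans (le_of_eq ?_)
        rw [← EReal.coe_mul]
        congr 1
        have := (hp j).ne'
        field_simp
      · simpa using hD.costTerm_nonneg j le_rfl _

theorem limTerm_ne_top {x : DualVar m d I J L} (θ : Euc m) (i : Fin I) (j : Fin J) :
    D.limTerm x θ i j ≠ ⊤ := by
  have : Nonempty (Fin I) := ⟨i⟩
  unfold limTerm
  split_ifs
  · exact EReal.coe_ne_top _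
  · obtain ⟨k, hk⟩ := exists_eq_ciSup_of_finite (f := fun k => -D.lossTerm k j θ 0 (x.xi i j))
    rw [← hk, Ne, EReal.neg_eq_top_iff]
    exact (hD.bot_lt_lossTerm k j θ le_rfl _).ne'
  · exact EReal.zero_ne_top

theorem neg_lossTerm_le_limTerm {x : DualVar m d I J L} (hq : ∀ i j, 0 ≤ x.q i j) (θ : Euc m)
    (i : Fin I) (j : Fin J) : -D.lossTerm i j θ (x.q i j) (x.xi i j) ≤ D.limTerm x θ i j := by
  unfold limTerm
  rcases (hq i j).lt_or_eq with h | h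
  · rw [if_pos h, hD.lossTerm_eq_coe i j θ h.le fun h' => absurd h' h.ne', ← EReal.coe_neg,
      EReal.coe_le_coe_iff, neg_neg]
    exact mul_le_mul_of_nonneg_left (saddle_le_loss i θ _) h.le
  · rw [← h, if_neg (lt_irrefl _)]
    split_ifs with h'
    · exact le_iSup (fun k => -D.lossTerm k j θ 0 (x.xi i j)) i
    · rw [hD.lossTerm_eq_coe i j θ le_rfl fun _ => not_not.1 h']
      simp

theorem neg_negLoss_le_limLoss {x : DualVar m d I J L} (hq : ∀ i j, 0 ≤ x.q i j) (θ : Euc m) :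
    -D.negLoss θ (x.q, x.xi) ≤ D.limLoss x θ := by
  have h0 : ∀ i j, ⊥ < D.lossTerm i j θ (x.q i j) (x.xi i j) := fun i j =>
    hD.bot_lt_lossTerm i j θ (hq i j) _
  rw [negLoss, limLoss, Finset.sum_comm,
    (EReal.neg_sum_of_bot_lt fun j _ => (EReal.neg_sum_of_bot_lt fun i _ => h0 i j).2).1]
  refine Finset.sum_le_sum fun j _ => ?_
  rw [(EReal.neg_sum_of_bot_lt fun i _ => h0 i j).1]
  exact Finset.sum_le_sum fun i _ => hD.neg_lossTerm_le_limTerm hq θ i j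

theorem tendsto_limTerm {x : DualVar m d I J L} (θ : Euc m) (i : Fin I) (j : Fin J) :
    Tendsto (fun n => ((D.seqWeight x n i j * D.loss θ (D.seqPoint x n i j) : ℝ) : EReal)) atTop
      (𝓝 (D.limTerm x θ i j)) := by
  have : Nonempty (Fin I) := ⟨i⟩
  unfold limTerm seqWeight seqPoint
  split_ifs with h h'
  · refine (continuous_coe_real_ereal.tendsto _).comp (Tendsto.mul_const _ ?_)
    have h1 : Tendsto (fun n : ℕ => x.q i j * (1 - ((x.infIdx j).card : ℝ) / n)) atTop
        (𝓝 (x.q i j * (1 - 0))) :=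
      (tendsto_const_nhds.sub (tendsto_const_div_atTop_nhds_zero_nat _)).const_mul _
    simpa using h1
  · have h1 : Tendsto (fun n : ℕ => (n : ℝ) / D.p j) atTop atTop :=
      tendsto_natCast_atTop_atTop.atTop_div_const (hD.ref.p_pos j)
    have h2 : Tendsto (fun t : ℝ => ⨆ k, -((t⁻¹ * D.negSaddle k j θ (t • x.xi i j) : ℝ) : EReal))
        atTop (𝓝 (⨆ k, -D.lossTerm k j θ 0 (x.xi i j))) :=
      tendsto_iSup_of_fintype fun k => (hD.tendsto_lossTerm k j θ (x.xi i j)).neg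
    refine (h2.comp h1).congr fun n => ?_
    simp only [Function.comp_apply, ← EReal.coe_neg]
    rw [← EReal.coe_iSup_of_finite, inv_div, loss, Real.mul_iSup_of_nonneg
      (div_nonneg (hD.ref.p_pos j).le (Nat.cast_nonneg n))]
    simp [negSaddle]
  · simp

theorem tendsto_expectedLoss_seqDist {x : DualVar m d I J L} (hx : x ∈ D.progFeasible)
    (θ : Euc m) :
    Tendsto (fun n => D.expectedLoss (D.seqDist x n) θ) atTop (𝓝 (D.limLoss x θ)) := by
  have h1 : Tendsto (fun n => ∑ j, ∑ i,
      ((D.seqWeight x n i j * D.loss θ (D.seqPoint x n i j) : ℝ) : EReal)) atTop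
      (𝓝 (D.limLoss x θ)) :=
    EReal.tendsto_sum (fun j _ => EReal.sum_ne_top fun i _ => hD.limTerm_ne_top θ i j)
      fun j _ => EReal.tendsto_sum (fun i _ => hD.limTerm_ne_top θ i j)
        fun i _ => hD.tendsto_limTerm θ i j
  refine h1.congr' ?_
  filter_upwards [eventually_ge_atTop I] with n hn
  rw [seqDist_eq_gridDist hx.1, expectedLoss, expectation_gridDist]
  · simp only [EReal.coe_finsetSum_real]
  · intro i j
    have h2 : ((x.infIdx j).card : ℝ) ≤ n := by
      exact_mod_cast (Finset.card_le_univ _).trans (by simpa using hn)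
    unfold seqWeight
    split_ifs
    exacts [mul_nonneg (hx.1 i j) (sub_nonneg.2 (div_le_one_of_le₀ h2 (Nat.cast_nonneg n))),
      div_nonneg (hD.ref.p_pos j).le (Nat.cast_nonneg n), le_rfl]

theorem limLoss_le_worstCase {x : DualVar m d I J L} (hx : x ∈ D.progFeasible) (θ : Euc m) :
    D.limLoss x θ ≤ D.worstCase θ := by
  refine le_of_tendsto (hD.tendsto_expectedLoss_seqDist hx θ) ?_
  filter_upwards [eventually_gt_atTop I] with n hn
  refine hD.expectedLoss_le_worstCase (hD.seqDist_mem_ambiguitySet hx fun j => ?_) θ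
  exact lt_of_le_of_lt ((Finset.card_le_univ _).trans (by simp)) hn

end StandingAssumptions

end DROData

/-! ### The dual value -/

namespace DROData

variable {m d I J K L : ℕ} {D : DROData m d I J K L}

theorem dualObjective_le_dualValue {Q : Measure (Euc d)} (hQ : Q ∈ D.ambiguitySet) :
    D.dualObjective Q ≤ D.dualValue :=
  le_iSup₂ (f := fun Q (_ : Q ∈ D.ambiguitySet) => D.dualObjective Q) Q hQ

namespace StandingAssumptions

variable (hD : D.StandingAssumptions)
include hD

omit hD in
theorem phi_le_worstCase (θ : Euc m) {x : PrimVar d I J} (hx : x ∈ D.primSet ∩ finiteSet d I J) :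
    (D.phi θ x : EReal) ≤ D.worstCase θ :=
  le_iSup₂ (f := fun x (_ : x ∈ D.primSet ∩ finiteSet d I J) => (D.phi θ x : EReal)) x hx

theorem exists_worstCase_le (hfin : D.WorstCaseFinite) :
    ∃ θ ∈ D.feasSet, ∃ M : ℝ, D.worstCase θ ≤ M := by
  obtain ⟨θ, hθ, h⟩ := hfin
  obtain ⟨M, hM, -⟩ := EReal.lt_iff_exists_real_btwn.1 h
  refine ⟨θ, hθ, M, iSup₂_le fun x hx => le_trans ?_ hM.le⟩
  exact (phi_le_expectedLoss θ hx.1.1.1).trans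
    (le_iSup₂ (f := fun Q (_ : Q ∈ D.ambiguitySet) => D.expectedLoss Q θ) _
      (hD.gridDist_mem_of_mem_primSet hx))

theorem primValue_lt_top (hfin : D.WorstCaseFinite) : D.primValue < ⊤ := by
  obtain ⟨θ, hθ, M, hM⟩ := hD.exists_worstCase_le hfin
  exact lt_of_le_of_lt ((iInf₂_le θ hθ).trans hM) (EReal.coe_lt_top M)

theorem dualValue_le_primValue : D.dualValue ≤ D.primValue :=
  iSup₂_le fun _ hQ => le_iInf₂ fun θ hθ =>
    (iInf₂_le θ hθ).trans (hD.expectedLoss_le_worstCase hQ θ)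

omit hD in
theorem le_dualObjective_gridDist {x : PrimVar d I J} (hx : ∀ i j, 0 ≤ x.1 i j) {a : EReal}
    (h : ∀ θ ∈ D.feasSet, a ≤ D.phi θ x) :
    a ≤ D.dualObjective (gridDist x.1 fun i j => D.zhat j + (x.1 i j)⁻¹ • x.2 i j) :=
  le_iInf₂ fun θ hθ => (h θ hθ).trans (phi_le_expectedLoss θ hx)

theorem iSup_progObjective (hfin : D.WorstCaseFinite) :
    ⨆ x ∈ D.progFeasible, D.progObjective x = D.primValue := by
  obtain ⟨y, hy, h⟩ := hD.exists_primValue_le_progObjective (hD.primValue_lt_top hfin)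
  exact le_antisymm (iSup₂_le fun x hx => hD.progObjective_le_primValue hx)
    (h.trans (le_iSup₂ (f := fun x (_ : x ∈ D.progFeasible) => D.progObjective x) y hy))

theorem exists_isProgMaximizer (hfin : D.WorstCaseFinite) : ∃ x, D.IsProgMaximizer x := by
  obtain ⟨y, hy, h⟩ := hD.exists_primValue_le_progObjective (hD.primValue_lt_top hfin)
  exact ⟨y, hy, fun x hx => (hD.progObjective_le_primValue hx).trans h⟩

theorem primValue_le_neg_negLoss (hfin : D.WorstCaseFinite) {x : DualVar m d I J L}
    (hx : D.IsProgMaximizer x) {θ : Euc m} (hθ : θ ∈ D.feasSet) :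
    D.primValue ≤ -D.negLoss θ (x.q, x.xi) := by
  rw [← hD.iSup_progObjective hfin]
  exact (iSup₂_le fun y hy => hx.2 y hy).trans (hD.progObjective_le_neg_negLoss hx.1 hθ)

theorem starDist_mem_and_primValue_le (hfin : D.WorstCaseFinite) {x : DualVar m d I J L}
    (hx : D.IsProgMaximizer x) (hinf : ∀ j, x.infIdx j = ∅) :
    D.starDist x ∈ D.ambiguitySet ∧ D.primValue ≤ D.dualObjective (D.starDist x) := by
  have hfs : ((x.q, x.xi) : PrimVar d I J) ∈ finiteSet d I J := fun i j h => by
    by_contra h'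
    have h1 : i ∈ x.infIdx j := x.mem_infIdx.2 ⟨h, h'⟩
    rw [hinf] at h1
    exact absurd h1 (Finset.notMem_empty i)
  have h1 : ∀ θ ∈ D.feasSet, D.primValue ≤ D.phi θ (x.q, x.xi) := fun θ hθ => by
    have h2 := hD.primValue_le_neg_negLoss hfin hx hθ
    rwa [hD.negLoss_eq_coe θ hx.1.1 hfs, ← EReal.coe_neg, neg_neg] at h2
  have h2 := hD.gridDist_mem_of_mem_primSet ⟨mem_primSet_of_mem_progFeasible hx.1, hfs⟩
  have h3 := le_dualObjective_gridDist hx.1.1 h1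
  rw [starDist_eq_gridDist hx.1.1]
  exact ⟨h2, h3⟩

theorem iInf_limLoss (hfin : D.WorstCaseFinite) {x : DualVar m d I J L}
    (hx : D.IsProgMaximizer x) : ⨅ θ ∈ D.feasSet, D.limLoss x θ = D.primValue :=
  le_antisymm
    (le_iInf₂ fun θ hθ => (iInf₂_le θ hθ).trans (hD.limLoss_le_worstCase hx.1 θ))
    (le_iInf₂ fun θ hθ => (hD.primValue_le_neg_negLoss hfin hx hθ).trans
      (hD.neg_negLoss_le_limLoss hx.1.1 θ))

/-- If the support set is compact or the transportation cost is superlinear, then no feasible pair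
has mass at infinity. -/
theorem mem_finiteSet_of_mem_primSet (h : IsCompact D.suppSet ∨ D.SuperlinearCost)
    {x : PrimVar d I J} (hx : x ∈ D.primSet) : x ∈ finiteSet d I J := by
  intro i j hq
  by_contra hξ
  have hsupp : ∀ t : ℝ, 0 ≤ t → D.zhat j + t • x.2 i j ∈ D.suppSet := fun t ht =>
    hD.mem_suppSet_add_smul_of_zero ht fun k => by
      rw [← hq]
      exact hx.1.2.1 i j k
  have hξ0 : 0 < ‖x.2 i j‖ := norm_pos_iff.2 hξ
  have hnorm : ∀ t : ℝ, 0 ≤ t → t * ‖x.2 i j‖ - ‖D.zhat j‖ ≤ ‖D.zhat j + t • x.2 i j‖ := by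
    intro t ht
    have h1 := norm_sub_le (D.zhat j + t • x.2 i j) (D.zhat j)
    rw [add_sub_cancel_left, norm_smul, Real.norm_of_nonneg ht] at h1
    linarith
  have hlim : Tendsto (fun t : ℝ => t * ‖x.2 i j‖ - ‖D.zhat j‖) atTop atTop :=
    tendsto_atTop_add_const_right _ _ (tendsto_id.atTop_mul_const hξ0)
  rcases h with h | h
  · obtain ⟨C, hC⟩ := h.isBounded.exists_norm_le
    obtain ⟨t, ht, ht0⟩ := ((hlim.eventually_gt_atTop C).and (eventually_ge_atTop 0)).exists
    linarith [hC _ (hsupp t ht0), hnorm t ht0]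
  · have h1 := hD.costTerm_lt_top hx i j
    have h2 := hD.costTerm_nonneg j (hx.1.1 i j) (x.2 i j)
    rw [hq] at h1 h2
    lift D.costTerm j 0 (x.2 i j) to ℝ using
      ⟨h1.ne, (lt_of_lt_of_le EReal.bot_lt_zero h2).ne'⟩ with b hb
    have hcost : ∀ t : ℝ, 0 ≤ t →
        D.cost (D.zhat j + t • x.2 i j) (D.zhat j) ≤ ENNReal.ofReal (t * b) := fun t ht => by
      rw [← EReal.coe_ennreal_le_coe_ennreal_iff, EReal.coe_ennreal_ofReal]
      exact (hD.cost_add_smul_le ht hb.ge).trans (EReal.coe_le_coe_iff.2 (le_max_left _ _))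
    have hcurve : Tendsto (fun t : ℝ => D.zhat j + t • x.2 i j) atTop
        (Bornology.cobounded (Euc d) ⊓ 𝓟 D.suppSet) := by
      refine tendsto_inf.2 ⟨?_, tendsto_principal.2 ?_⟩
      · rw [← tendsto_norm_atTop_iff_cobounded]
        exact tendsto_atTop_mono' _ ((eventually_ge_atTop 0).mono hnorm) hlim
      · exact (eventually_ge_atTop 0).mono hsupp
    have h3 := ((h _ (hD.ref.zhat_mem j)).comp hcurve).eventually
      (lt_mem_nhds (ENNReal.ofReal_lt_top (r := 2 * b / ‖x.2 i j‖)))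
    obtain ⟨t, h4, h5, h6⟩ := (h3.and ((eventually_gt_atTop 0).and
      (eventually_ge_atTop (2 * ‖D.zhat j‖ / ‖x.2 i j‖)))).exists
    rw [div_le_iff₀ hξ0] at h6
    have h7 := hnorm t h5.le
    refine absurd h4 (not_lt.2 ?_)
    have h8 : 0 < t * ‖x.2 i j‖ / 2 := by positivity
    refine (ENNReal.div_le_div (hcost t h5.le)
      (ENNReal.ofReal_le_ofReal (by linarith : t * ‖x.2 i j‖ / 2 ≤ _))).trans (le_of_eq ?_)
    rw [← ENNReal.ofReal_div_of_pos h8]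
    congr 1
    field_simp

/-- On compact sets, finitely many feasible pairs suffice to exceed a lower bound on the worst
case. -/
theorem exists_finset_lt_phi {C : Set (Euc m)} (hC : IsCompact C) {b : ℝ}
    (h : ∀ θ ∈ C, (b : EReal) < D.worstCase θ) :
    ∃ T : Finset (PrimVar d I J), (∀ x ∈ T, x ∈ D.primSet ∩ finiteSet d I J) ∧
      ∀ θ ∈ C, ∃ x ∈ T, b < D.phi θ x := by
  classical
  have hopen : ∀ x : ↥(D.primSet ∩ finiteSet d I J), IsOpen {θ | b < D.phi θ x} := fun x => by
    have h1 : Continuous fun θ => D.phi θ x := by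
      rw [← continuousOn_univ]
      exact (hD.convexOn_phi x x.2.1.1.1).continuousOn isOpen_univ
    exact isOpen_lt continuous_const h1
  obtain ⟨T, hT⟩ := hC.elim_finite_subcover _ hopen fun θ hθ => by
    obtain ⟨x, hx, hbx⟩ := lt_biSup_iff.1 (h θ hθ)
    exact mem_iUnion.2 ⟨⟨x, hx⟩, EReal.coe_lt_coe_iff.1 hbx⟩
  refine ⟨T.image Subtype.val, fun x hx => ?_, fun θ hθ => ?_⟩
  · obtain ⟨y, -, rfl⟩ := Finset.mem_image.1 hx
    exact y.2
  · obtain ⟨y, hy, hθy⟩ := mem_iUnion₂.1 (hT hθ)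
    exact ⟨y, Finset.mem_image_of_mem _ hy, hθy⟩

/-- Finitely many feasible pairs that jointly exceed a level on the feasible set can be merged
into one. -/
theorem exists_le_phi_of_finset (T : Finset (PrimVar d I J))
    (hT : ∀ x ∈ T, x ∈ D.primSet ∩ finiteSet d I J) {a : ℝ}
    (h : ∀ θ ∈ D.feasSet, ∃ x ∈ T, a ≤ D.phi θ x) :
    ∃ x ∈ D.primSet ∩ finiteSet d I J, ∀ θ ∈ D.feasSet, a ≤ D.phi θ x := by
  obtain ⟨θ₀, hθ₀⟩ := hD.slater
  obtain ⟨μ, hμ0, hμ1, hμ⟩ := exists_weights_of_forall_exists_nonneg (ι := T)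
    ⟨θ₀, (hθ₀.1 : θ₀ ∈ D.feasSet)⟩ (f := fun k θ => D.phi θ k - a)
    (fun k => ((hD.convexOn_phi k (hT k k.2).1.1.1).subset (subset_univ _) hD.convex_feasSet).sub
      (concaveOn_const a hD.convex_feasSet))
    fun θ hθ => by
      obtain ⟨x, hx, hax⟩ := h θ hθ
      exact ⟨⟨x, hx⟩, sub_nonneg.2 hax⟩
  refine ⟨∑ k, μ k • (k : PrimVar d I J),
    hD.convex_primSet_inter.sum_mem (fun k _ => hμ0 k) hμ1 fun k _ => hT k k.2, fun θ hθ => ?_⟩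
  have h1 := (hD.concaveOn_phi θ).le_map_sum (t := Finset.univ) (w := μ)
    (p := fun k : T => (k : PrimVar d I J)) (fun k _ => hμ0 k) hμ1
    fun k _ => ⟨(hT k k.2).1.1, (hT k k.2).2⟩
  refine le_trans ?_ h1
  have h2 := hμ θ hθ
  simp only [mul_sub, Finset.sum_sub_distrib, ← Finset.sum_mul, hμ1, one_mul] at h2
  simpa only [smul_eq_mul] using sub_nonneg.1 h2

theorem exists_forall_le_phi_of_infCompact (hfin : D.WorstCaseFinite) (h : D.InfCompact) {a : ℝ}
    (ha : (a : EReal) < D.primValue) :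
    ∃ x ∈ D.primSet ∩ finiteSet d I J, ∀ θ ∈ D.feasSet, a ≤ D.phi θ x := by
  classical
  obtain ⟨θ₀, hθ₀, M, hM⟩ := hD.exists_worstCase_le hfin
  obtain ⟨Q, hQ, hQc⟩ := h
  obtain ⟨R, hR0, hR⟩ := (hQc (max a M)).isBounded.subset_ball_lt 0 θ₀
  obtain ⟨T₁, hT₁, h₁⟩ := hD.exists_finset_lt_phi (b := a)
    ((isCompact_closedBall θ₀ R).inter_left hD.isClosed_feasSet)
    fun θ hθ => ha.trans_le (iInf₂_le θ hθ.1)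
  obtain ⟨T₂, hT₂, h₂⟩ := hD.exists_finset_lt_phi (b := max a M)
    ((isCompact_sphere θ₀ R).inter_left hD.isClosed_feasSet) fun θ hθ => by
      by_contra hle
      have h1 := hR ⟨hθ.1, (hD.expectedLoss_le_worstCase hQ θ).trans (not_lt.1 hle)⟩
      exact absurd hθ.2 (ne_of_lt (Metric.mem_ball.1 h1))
  refine hD.exists_le_phi_of_finset (T₁ ∪ T₂)
    (fun x hx => (Finset.mem_union.1 hx).elim (hT₁ x) (hT₂ x)) fun θ hθ => ?_
  rcases le_or_gt (dist θ θ₀) R with hle | hgt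
  · obtain ⟨x, hx, hax⟩ := h₁ θ ⟨hθ, hle⟩
    exact ⟨x, Finset.mem_union_left _ hx, hax.le⟩
  · have hr0 : 0 < dist θ θ₀ := hR0.trans hgt
    set s := R / dist θ θ₀ with hs
    have hs0 : 0 < s := div_pos hR0 hr0
    have hs1 : s ≤ 1 := (div_le_one hr0).2 hgt.le
    have hy : (1 - s) • θ₀ + s • θ ∈ D.feasSet ∩ Metric.sphere θ₀ R := by
      refine ⟨hD.convex_feasSet hθ₀ hθ (by linarith) hs0.le (by ring), ?_⟩
      have h1 : (1 - s) • θ₀ + s • θ - θ₀ = s • (θ - θ₀) := by module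
      rw [mem_sphere_iff_norm, h1, norm_smul, Real.norm_of_nonneg hs0.le, ← dist_eq_norm, hs,
        div_mul_cancel₀ _ hr0.ne']
    obtain ⟨x, hx, hax⟩ := h₂ _ hy
    refine ⟨x, Finset.mem_union_right _ hx, ?_⟩
    have h1 := (hD.convexOn_phi x (hT₂ x hx).1.1.1).2 (mem_univ θ₀) (mem_univ θ)
      (by linarith : 0 ≤ 1 - s) hs0.le (by ring)
    have h2 : D.phi θ₀ x ≤ M := by
      exact_mod_cast (phi_le_worstCase θ₀ (hT₂ x hx)).trans hM
    simp only [smul_eq_mul] at h1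
    by_contra hlt
    have h3 : s * D.phi θ x ≤ s * max a M :=
      mul_le_mul_of_nonneg_left ((not_le.1 hlt).le.trans (le_max_left _ _)) hs0.le
    have h4 : (1 - s) * D.phi θ₀ x ≤ (1 - s) * max a M :=
      mul_le_mul_of_nonneg_left (h2.trans (le_max_right _ _)) (by linarith)
    linarith

theorem exists_forall_le_phi_of_regularity (hfin : D.WorstCaseFinite)
    (h : D.RegularityCondition) {a : ℝ} (ha : (a : EReal) < D.primValue) :
    ∃ x ∈ D.primSet ∩ finiteSet d I J, ∀ θ ∈ D.feasSet, a ≤ D.phi θ x := by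
  rcases h with h | h
  · exact hD.exists_forall_le_phi_of_infCompact hfin h ha
  · obtain ⟨x, hx, hP⟩ := hD.exists_primValue_le
    have hx' := hD.mem_finiteSet_of_mem_primSet h hx
    refine ⟨x, ⟨hx, hx'⟩, fun θ hθ => ?_⟩
    have h1 := ha.le.trans (hP θ hθ)
    rw [hD.negLoss_eq_coe θ hx.1.1 hx', ← EReal.coe_neg, neg_neg] at h1
    exact_mod_cast h1

theorem exists_tendsto_dualObjective (hfin : D.WorstCaseFinite) (h : D.RegularityCondition) :
    ∃ Q : ℕ → Measure (Euc d),
      (∀ n, Q n ∈ D.ambiguitySet ∧ ∃ s : Finset (Euc d), Q n (s : Set (Euc d))ᶜ = 0) ∧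
      Tendsto (fun n => D.dualObjective (Q n)) atTop (𝓝 D.primValue) := by
  have hle : ∀ Q ∈ D.ambiguitySet, D.dualObjective Q ≤ D.primValue := fun Q hQ =>
    (dualObjective_le_dualValue hQ).trans hD.dualValue_le_primValue
  rcases eq_or_ne D.primValue ⊥ with hbot | hbot
  · have h1 := hD.gridDist_mem_of_mem_primSet ⟨hD.center_mem_primSet, center_mem_finiteSet⟩
    refine ⟨fun _ => _, fun _ => ⟨h1, gridDist_compl_image _ _⟩, ?_⟩
    simp only [le_bot_iff.1 ((hle _ h1).trans hbot.le), hbot]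
    exact tendsto_const_nhds
  · have htop := (hD.primValue_lt_top hfin).ne
    obtain ⟨P, hP⟩ : ∃ P : ℝ, D.primValue = P := ⟨_, (EReal.coe_toReal htop hbot).symm⟩
    have h1 : ∀ n : ℕ, ((P - 1 / ((n : ℝ) + 1) : ℝ) : EReal) < D.primValue := fun n => by
      rw [hP, EReal.coe_lt_coe_iff, sub_lt_self_iff]
      positivity
    choose x hx hxn using fun n => hD.exists_forall_le_phi_of_regularity hfin h (h1 n)
    have hmem := fun n => hD.gridDist_mem_of_mem_primSet (hx n)
    refine ⟨fun n => _, fun n => ⟨hmem n, gridDist_compl_image _ _⟩, ?_⟩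
    refine tendsto_of_tendsto_of_tendsto_of_le_of_le ?_ tendsto_const_nhds
      (fun n => le_dualObjective_gridDist (hx n).1.1.1 fun θ hθ =>
        EReal.coe_le_coe_iff.2 (hxn n θ hθ)) fun n => hle _ (hmem n)
    rw [hP]
    refine (continuous_coe_real_ereal.tendsto _).comp ?_
    simpa using tendsto_const_nhds.sub (tendsto_one_div_add_atTop_nhds_zero_nat (𝕜 := ℝ))

end StandingAssumptions

end DROData

theorem proposition2p13 {m d I J K L : ℕ} (D : DROData m d I J K L)
    (hcost : D.IdentityOfIndiscernibles)
    (hint : D.LocallyUniformlyIntegrable)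
    (hfin : D.WorstCaseFinite)
    (href : D.DiscreteReference)
    (hconv : D.ConvexityConditions)
    (hslater : D.SlaterConditions)
    (hreg : D.RegularityCondition)
    (heps : 0 < D.eps) :
    -- the finite program maximizes a concave function over a convex set
    Convex ℝ D.progFeasible ∧
    Convex ℝ {w : DualVar m d I J L × ℝ |
      w.1 ∈ D.progFeasible ∧ (w.2 : EReal) ≤ D.progObjective w.1} ∧
    -- it has the same supremum as the dual DRO problem, and it is solvable
    D.dualValue = (⨆ x ∈ D.progFeasible, D.progObjective x) ∧
    (∃ x, D.IsProgMaximizer x) ∧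
    -- maximizers without mass at infinity yield an optimal discrete distribution
    (∀ x, D.IsProgMaximizer x → (∀ j, x.infIdx j = ∅) →
      D.starDist x ∈ D.ambiguitySet ∧ D.dualObjective (D.starDist x) = D.dualValue) ∧
    -- the others yield feasible discrete distributions that are optimal in the limit
    (∀ x, D.IsProgMaximizer x → (∃ j, x.infIdx j ≠ ∅) →
      (∀ n : ℕ, (∀ j, (x.infIdx j).card < n) → D.seqDist x n ∈ D.ambiguitySet) ∧
      ∃ limLoss : Euc m → EReal,
        (∀ θ ∈ D.feasSet,
          Tendsto (fun n => D.expectedLoss (D.seqDist x n) θ) atTop (𝓝 (limLoss θ))) ∧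
        (⨅ θ ∈ D.feasSet, limLoss θ) = D.dualValue) ∧
    -- finitely supported distributions are asymptotically optimal in the dual DRO problem
    (∃ Q : ℕ → Measure (Euc d),
      (∀ n, Q n ∈ D.ambiguitySet ∧ ∃ s : Finset (Euc d), Q n (s : Set (Euc d))ᶜ = 0) ∧
      Tendsto (fun n => D.dualObjective (Q n)) atTop (𝓝 D.dualValue)) := by
  have hD : D.StandingAssumptions := ⟨hcost, href, hconv, hslater.feasSet, heps⟩
  obtain ⟨Q, hQ, hlim⟩ := hD.exists_tendsto_dualObjective hfin hreg
  have hval : D.dualValue = D.primValue := le_antisymm hD.dualValue_le_primValue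
    (le_of_tendsto' hlim fun n => DROData.dualObjective_le_dualValue (hQ n).1)
  rw [hval]
  refine ⟨hD.convex_progFeasible, hD.convex_hypograph, (hD.iSup_progObjective hfin).symm,
    hD.exists_isProgMaximizer hfin, fun x hx hinf => ?_, fun x hx _ =>
    ⟨fun n hn => hD.seqDist_mem_ambiguitySet hx.1 hn, D.limLoss x,
      fun θ _ => hD.tendsto_expectedLoss_seqDist hx.1 θ, hD.iInf_limLoss hfin hx⟩, Q, hQ, hlim⟩
  obtain ⟨h1, h2⟩ := hD.starDist_mem_and_primValue_le hfin hx hinf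
  exact ⟨h1, le_antisymm (hval ▸ DROData.dualObjective_le_dualValue h1) h2⟩
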